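/- **Setting.** Let $\mathcal C_p^\infty$ be the set of complex functions on $\mathbb R$ that are smooth except on a finite set of points, where they and all their derivatives have finite left and right limits. Let $\mathcal A\subset\mathcal D'(\mathbb R)$ be the set of the functions in $\mathcal C_p^\infty$, regarded as distributions, together with all their distributional derivatives of all orders. For $F,G\in\mathcal A$ put $$F*G=\lim_{\epsilon\downarrow 0}F(x)\cdot G(x+\epsilon)\quad\text{in }\mathcal D'(\mathbb R),$$ where $\cdot$ is the Hörmander product: if there is a finite open cover of $\mathbb R$ on each set of which $F$ or $G$ is a smooth function, then $F\cdot G$ is the unique distribution whose restriction to each set of the cover is the dual product of that smooth function by the other distribution ($\langle fG,t\rangle=\langle G,ft\rangle$). Let $\xi_0\in\mathbb R$, $w\in\mathbb C$, and for $i=0,1$ let $$a_i=a_{i-}H(\xi_0-x)+a_{i+}H(x-\xi_0)+\sum_{j=0}^1A_{ij}\delta_{\xi_0}^{(j)},\qquad b_i=b_{i-}H(\xi_0-x)+b_{i+}H(x-\xi_0)+\sum_{j=0}^3B_{ij}\delta_{\xi_0}^{(j)},$$ where $H$ is the Heaviside function, $a_{i\pm},b_{i\pm}\in C^\infty(\mathbb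 R;\mathbb C)$ and $A_{ij},B_{ij}\in\mathbb C$. Write $a=a_{0-}+a_{1+}$, $a_\pm=a_{0\pm}+a_{1\pm}$, $b_\pm=b_{0\pm}+b_{1\pm}$, and assume that $a(\xi_0)\neq0$ and that $a_+(x)\ne0$ and $a_-(x)\neq0$ for all $x\in\mathbb R$. A solution of $$\sum_{i=0}^2\binom 2i\left(a_0^{(i)}*\phi^{(4-i)}+\phi^{(4-i)}*a_1^{(i)}\right)-w^2\left(b_0*\phi+\phi*b_1\right)=0\qquad(\mathrm E)$$ is a $\phi\in\mathcal A$ that satisfies (E) in the sense of distributions (all derivatives being distributional). **Theorem.** Every solution $\phi$ of (E) is of the form $\phi(x)=H(\xi_0-x)\phi_1(x)+H(x-\xi_0)\phi_2(x)$, where $\phi_1,\phi_2\in C^\infty(\mathbb R;\mathbb C)$ satisfy $$\sum_{i=0}^2\binom 2i a_-^{(i)}\phi_1^{(4-i)}-w^2b_-\phi_1=0\ \text{ on }(-\infty,\xi_0],\qquad \sum_{i=0}^2\binom 2i a_+^{(i)}\phi_2^{(4-i)}-w^2b_+\phi_2=0\ \text{ on }[\xi_0,+\infty),$$ and the interface condition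 $$\mathbf A(\xi_0)\,\bigl(\phi_1,\phi_1',\phi_1'',\phi_1'''\bigr)^T(\xi_0)=\mathbf B(\xi_0)\,\bigl(\phi_2,\phi_2',\phi_2'',\phi_2'''\bigr)^T(\xi_0),$$ with $$\mathbf A=\begin{pmatrix}B_{10}w^2&-B_{11}w^2&a_-'+B_{12}w^2&a_--B_{13}w^2\\ B_{11}w^2&-2B_{12}w^2&a_-+3B_{13}w^2&0\\ -a'+B_{12}w^2&a-3B_{13}w^2&-A_{10}&A_{11}\\ a+B_{13}w^2&0&-A_{11}&0\end{pmatrix},$$ $$\mathbf B=\begin{pmatrix}-B_{00}w^2&B_{01}w^2&a_+'-B_{02}w^2&a_++B_{03}w^2\\ -B_{01}w^2&2B_{02}w^2&a_+-3B_{03}w^2&0\\ -a'-B_{02}w^2&a+3B_{03}w^2&A_{00}&-A_{01}\\ a-B_{03}w^2&0&A_{01}&0\end{pmatrix}.$$ -/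

import Mathlib

open scoped ContDiff Distributions LineDeriv Topology
open TopologicalSpace

noncomputable section

namespace DistODE

/-- Complex-valued Schwartz distributions on the real line. Following Mathlib, they are tested
against real-valued test functions, which is equivalent to testing complex-linearly against
complex-valued test functions, see `pairing`. -/
abbrev Dist : Type := 𝓓'((⊤ : Opens ℝ), ℂ)

/-- The complex-linear pairing of a distribution with a complex-valued test function,
`⟨F, s⟩ = ⟨F, Re s⟩ + i ⟨F, Im s⟩`. -/
def pairing (F : Dist) (s : 𝓓((⊤ : Opens ℝ), ℂ)) : ℂ :=
  F (TestFunction.postcompCLM Complex.reCLM s) +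
    Complex.I * F (TestFunction.postcompCLM Complex.imCLM s)

/-- The regular distribution `t ↦ ∫ t(x) f(x) dx` of a locally integrable function `f`
(it is `0` if `f` is not locally integrable). -/
def regular (f : ℝ → ℂ) : Dist :=
  ContinuousLinearMap.toUniformConvergenceCLM _ _ _
    (TestFunction.integralAgainstBilinCLM (ContinuousLinearMap.lsmul ℝ ℝ) MeasureTheory.volume f)

/-- The distributional derivative of order `k`. -/
def D (k : ℕ) (F : Dist) : Dist := (fun G : Dist => (∂_{(1 : ℝ)} G : Dist))^[k] F

/-- The Dirac measure at `x`, as a complex-valued distribution. -/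
def dirac (x : ℝ) : Dist :=
  Distribution.mapCLM Complex.ofRealCLM (Distribution.delta x)

/-- The Heaviside step function. -/
def heaviside (x : ℝ) : ℂ := if 0 < x then 1 else 0

/-! ### Translations -/

/-- `f ↦ f(· - h)` from the smooth functions supported in `K` to those supported in `h + K`. -/
def translateSupportedIn (h : ℝ) (K : Compacts ℝ) :
    𝓓_{K}(ℝ, ℝ) →L[ℝ] 𝓓_{K.map (fun x => x + h) (by fun_prop)}(ℝ, ℝ) :=
  ContDiffMapSupportedIn.mkCLM ℝ (fun f x => f (x - h))
    (fun _ _ _ => rfl) (fun _ _ _ => rfl)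
    (fun f => f.contDiff.comp (contDiff_id.sub contDiff_const))
    (fun f x hx => f.zero_on_compl (fun hK => hx ⟨x - h, hK, by simp⟩))
    (fun i _ => ⟨{i}, 1, zero_le_one, fun f x _ => by
      rw [iteratedFDeriv_comp_sub]
      simpa using ContDiffMapSupportedIn.norm_iteratedFDeriv_apply_le_seminorm_top ℝ⟩)

/-- The translation `t ↦ t(· - h)` of test functions. -/
def translateTest (h : ℝ) : 𝓓((⊤ : Opens ℝ), ℝ) →L[ℝ] 𝓓((⊤ : Opens ℝ), ℝ) :=
  TestFunction.limitCLM ℝ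
    (fun t => ⟨fun x => t (x - h), t.contDiff.comp (contDiff_id.sub contDiff_const),
      t.hasCompactSupport.comp_homeomorph (Homeomorph.subRight h), fun _ _ => trivial⟩)
    (fun K _ => TestFunction.ofSupportedInCLM ℝ (fun _ _ => trivial) ∘L translateSupportedIn h K)
    (fun _ _ _ => rfl)

/-- The translated distribution `G(x + h)`, that is `⟨G(· + h), t⟩ = ⟨G, t(· - h)⟩`. -/
def shift (h : ℝ) (G : Dist) : Dist :=
  (translateTest h).precompCompactConvergenceCLM _ G

/-! ### The space `𝒜` -/

/-- The class `𝒞_p^∞`: functions which are smooth except on a finite set of points, where they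
and all their derivatives have finite left and right limits. -/
def PiecewiseSmooth (f : ℝ → ℂ) : Prop :=
  ∃ I : Finset ℝ, ContDiffOn ℝ ∞ f (I : Set ℝ)ᶜ ∧
    ∀ x ∈ I, ∀ k : ℕ,
      (∃ l : ℂ, Filter.Tendsto (iteratedDeriv k f) (𝓝[<] x) (𝓝 l)) ∧
      (∃ l : ℂ, Filter.Tendsto (iteratedDeriv k f) (𝓝[>] x) (𝓝 l))

/-- The space `𝒜`: the functions in `𝒞_p^∞`, regarded as distributions, together with all their
distributional derivatives to all orders. -/
def A : Set Dist :=
  {F | ∃ (f : ℝ → ℂ) (k : ℕ), PiecewiseSmooth f ∧ F = D k (regular f)}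

/-! ### Products of distributions -/

/-- The product `f t` of a test function `t` on the open set `U` by a smooth function `f` on `U`,
extended by zero. -/
def mulTest {U : Opens ℝ} {f : ℝ → ℂ} (hf : ContDiffOn ℝ ∞ f U) (t : 𝓓(U, ℝ)) :
    𝓓((⊤ : Opens ℝ), ℂ) where
  toFun x := t x • f x
  contDiff' := by
    rw [contDiff_iff_contDiffAt]
    intro x
    by_cases hx : x ∈ tsupport t
    · exact t.contDiff.contDiffAt.smul
        (hf.contDiffAt (U.isOpen.mem_nhds (t.tsupport_subset hx)))
    · refine (contDiffAt_const (c := (0 : ℂ))).congr_of_eventuallyEq ?_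
      filter_upwards [notMem_tsupport_iff_eventuallyEq.mp hx] with y hy
      simp [hy]
  hasCompactSupport' := t.hasCompactSupport.smul_right
  tsupport_subset' := fun _ _ => trivial

/-- A test function on the open set `U`, extended by zero to the line. -/
def extendTest {U : Opens ℝ} (t : 𝓓(U, ℝ)) : 𝓓((⊤ : Opens ℝ), ℝ) :=
  ⟨t, t.contDiff, t.hasCompactSupport, fun _ _ => trivial⟩

/-- On the open set `U`, the distribution `F` is the function `f`. -/
def EqFunOn (U : Opens ℝ) (F : Dist) (f : ℝ → ℂ) : Prop :=
  ∀ t : 𝓓(U, ℝ), F (extendTest t) = ∫ x, t x • f x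

/-- On the open set `U`, the distribution `P` is the dual product of the smooth function `f` by the
distribution `G`: `⟨P, t⟩ = ⟨G, f t⟩` for all `t ∈ 𝒟(U)`. -/
def EqDualProductOn (U : Opens ℝ) {f : ℝ → ℂ} (hf : ContDiffOn ℝ ∞ f U) (G P : Dist) : Prop :=
  ∀ t : 𝓓(U, ℝ), P (extendTest t) = pairing G (mulTest hf t)

/-- `P` is the Hörmander product of `F` and `G`: there is a finite open cover of the line such that
on each of its sets one of `F`, `G` is a smooth function, and `P` restricts there to the dual
product of this function by the other distribution. -/
def IsHormanderProduct (F G P : Dist) : Prop :=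
  ∃ (d : ℕ) (Ξ : Fin d → Opens ℝ), (∀ x : ℝ, ∃ i, x ∈ Ξ i) ∧ ∀ i,
    (∃ (f : ℝ → ℂ) (hf : ContDiffOn ℝ ∞ f (Ξ i)),
      EqFunOn (Ξ i) F f ∧ EqDualProductOn (Ξ i) hf G P) ∨
    (∃ (g : ℝ → ℂ) (hg : ContDiffOn ℝ ∞ g (Ξ i)),
      EqFunOn (Ξ i) G g ∧ EqDualProductOn (Ξ i) hg F P)

open Classical in
/-- The Hörmander product `F · G` (`0` if it is not defined). -/
def hormander (F G : Dist) : Dist :=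
  if h : ∃ P, IsHormanderProduct F G P then h.choose else 0

/-- `P` is the limit of the Hörmander products `F(x) · G(x + ε)` as `ε ↓ 0`, in the sense of
distributions, the products being defined for all sufficiently small `ε > 0`. -/
def IsStarProduct (F G P : Dist) : Prop :=
  (∀ᶠ ε in 𝓝[>] (0 : ℝ), ∃ Q, IsHormanderProduct F (shift ε G) Q) ∧
  ∀ t : 𝓓((⊤ : Opens ℝ), ℝ),
    Filter.Tendsto (fun ε : ℝ => hormander F (shift ε G) t) (𝓝[>] 0) (𝓝 (P t))

open Classical in
/-- The product `F * G = lim_{ε ↓ 0} F(x) · G(x + ε)` (`0` if it is not defined). -/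
def starProduct (F G : Dist) : Dist :=
  if h : ∃ P, IsStarProduct F G P then h.choose else 0

/-! ### The differential equation -/

/-- The distribution `f₋ H(ξ - x) + f₊ H(x - ξ) + ∑_{j < n} c_j δ_ξ^{(j)}`. -/
def jumpDelta (ξ : ℝ) (fm fp : ℝ → ℂ) {n : ℕ} (c : Fin n → ℂ) : Dist :=
  regular (fun x => fm x * heaviside (ξ - x) + fp x * heaviside (x - ξ)) +
    ∑ j : Fin n, c j • D j (dirac ξ)

/-- `φ` is a solution of
`∑_{i=0}^2 (2 choose i) (a₀^{(i)} * φ^{(4-i)} + φ^{(4-i)} * a₁^{(i)}) - w² (b₀ * φ + φ * b₁) = 0`: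
it belongs to `𝒜` and satisfies the equation in the sense of distributions. -/
def IsSolution (w : ℂ) (a b : Fin 2 → Dist) (φ : Dist) : Prop :=
  φ ∈ A ∧
    ∑ i ∈ Finset.range 3, (Nat.choose 2 i : ℂ) •
        (starProduct (D i (a 0)) (D (4 - i) φ) + starProduct (D (4 - i) φ) (D i (a 1)))
      - w ^ 2 • (starProduct (b 0) φ + starProduct φ (b 1)) = 0

/-- `ψ` satisfies, on the set `s`, the classical equation
`∑_{i=0}^2 (2 choose i) a^{(i)} ψ^{(4-i)} - w² b ψ = 0`. -/
def SolvesClassicalOn (s : Set ℝ) (w : ℂ) (a b ψ : ℝ → ℂ) : Prop :=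
  ∀ x ∈ s, ∑ i ∈ Finset.range 3,
    (Nat.choose 2 i : ℂ) * (iteratedDeriv i a x * iteratedDeriv (4 - i) ψ x)
      - w ^ 2 * (b x * ψ x) = 0

/-- The vector `(ψ, ψ', ψ'', ψ''')ᵀ` at `x`. -/
def jet (ψ : ℝ → ℂ) (x : ℝ) : Fin 4 → ℂ := fun k => iteratedDeriv k ψ x

/-- The matrix multiplying `(φ₁, φ₁', φ₁'', φ₁''')ᵀ`. Here `a = a₀₋ + a₁₊`, `am = a₋ = a₀₋ + a₁₋`,
and `A₁`, `B₁` are the coefficients of the deltas in `a₁`, `b₁`. -/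
def matrixA (w : ℂ) (a am : ℝ → ℂ) (A₁ : Fin 2 → ℂ) (B₁ : Fin 4 → ℂ) (x : ℝ) :
    Matrix (Fin 4) (Fin 4) ℂ :=
  !![B₁ 0 * w ^ 2, -B₁ 1 * w ^ 2, deriv am x + B₁ 2 * w ^ 2, am x - B₁ 3 * w ^ 2;
     B₁ 1 * w ^ 2, -2 * B₁ 2 * w ^ 2, am x + 3 * B₁ 3 * w ^ 2, 0;
     -deriv a x + B₁ 2 * w ^ 2, a x - 3 * B₁ 3 * w ^ 2, -A₁ 0, A₁ 1;
     a x + B₁ 3 * w ^ 2, 0, -A₁ 1, 0]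

/-- The matrix multiplying `(φ₂, φ₂', φ₂'', φ₂''')ᵀ`. Here `a = a₀₋ + a₁₊`, `ap = a₊ = a₀₊ + a₁₊`,
and `A₀`, `B₀` are the coefficients of the deltas in `a₀`, `b₀`. -/
def matrixB (w : ℂ) (a ap : ℝ → ℂ) (A₀ : Fin 2 → ℂ) (B₀ : Fin 4 → ℂ) (x : ℝ) :
    Matrix (Fin 4) (Fin 4) ℂ :=
  !![-B₀ 0 * w ^ 2, B₀ 1 * w ^ 2, deriv ap x - B₀ 2 * w ^ 2, ap x + B₀ 3 * w ^ 2;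
     -B₀ 1 * w ^ 2, 2 * B₀ 2 * w ^ 2, ap x - 3 * B₀ 3 * w ^ 2, 0;
     -deriv a x - B₀ 2 * w ^ 2, a x + 3 * B₀ 3 * w ^ 2, A₀ 0, -A₀ 1;
     a x - B₀ 3 * w ^ 2, 0, A₀ 1, 0]

end DistODE

end

/-! Near a point x, an element of 𝒜 is a jump between two smooth branches plus derivatives of δ_x.
If F and G have branches F₋, F₊ and G₋, G₊ at the same point, the shift in G(x+ε) moves the
singularity of G to the left of that of F. In the limit the deltas of F are multiplied by G₊, the
deltas of G by F₋, and the regular parts branch by branch (`isStarProduct_jumpDelta`). Since a₀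
multiplies φ from the left and a₁ from the right, the deltas of the derivatives of φ meet only
derivatives of a = a₀₋ + a₁₊, the deltas carried by a₀ and b₀ meet the right branch of φ, and those
carried by a₁ and b₁ meet the left branch.

Tested against t, the equation near x becomes the integral of t against the classical operator
applied to the two branches, plus a finite combination of derivatives at x of products of t with
smooth functions (`local_equation`). Tests vanishing near x give the two classical equations, after
which the combination at x vanishes by itself (`vanish_of_local_equation`). Tests equal to (u - x)^k
/ k! near x read it order by order. If c_N is the last nonzero delta coefficient of φ, then k = N +
4 leaves only ±a(x) c_N, because every other contribution has lower order; so a(x) ≠ 0 excludes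
deltas (`coeff_eq_zero_of_singularPart`). Once they are excluded, k = 0, 1, 2, 3 are the four rows
of the interface condition (`interface_of_singularPart`).

At a point other than ξ₀ the coefficients are smooth, and the same interface condition says that the
jets of order three of the two branches agree. The equation can be solved for its leading
derivative, as a₋ and a₊ have no zeros, so agreement propagates to all orders
(`flat_of_beamOp_flat`). Hence ξ₀ is the only possible singularity of φ. To make this global,
Borel's lemma writes an element of 𝒜 as a smooth function plus finitely many pieces H(x - y) h_y
with deltas at y (`exists_representation`). A piece without deltas whose h_y is flat at y is smooth
(`contDiff_jumpFun_of_flat`) and is absorbed into the smooth part.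

The products take the default value 0 when undefined, so their existence is proved for all φ in 𝒜
(`starDefined_of_representation`). Their locality (`IsStarProduct.unique`) then allows each factor
to be replaced by its local model. -/

noncomputable section

open MeasureTheory

namespace DistODE

/-! ### Distributions applied to test functions -/

/-- Real test functions on the line. -/
abbrev Test : Type := 𝓓((⊤ : Opens ℝ), ℝ)

theorem coe_lineDeriv_test (t : Test) : ⇑(∂_{(1 : ℝ)} t : Test) = deriv t := by
  ext x
  rw [TestFunction.lineDerivOp_eq_lineDerivCLM ℝ, TestFunction.lineDerivCLM_apply_of_le (by simp),
    (t.contDiff.differentiable (by simp)).differentiableAt.lineDeriv_eq_fderiv]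
  simp

theorem contDiff_test (t : Test) : ContDiff ℝ ∞ (fun x => (t x : ℂ)) :=
  Complex.ofRealCLM.contDiff.comp t.contDiff

theorem hasCompactSupport_test (t : Test) : HasCompactSupport (fun x => (t x : ℂ)) :=
  t.hasCompactSupport.comp_left (g := fun r : ℝ => (r : ℂ)) (by simp)

theorem deriv_ofReal_test (t : Test) :
    (fun x => ((∂_{(1 : ℝ)} t : Test) x : ℂ)) = deriv (fun x => (t x : ℂ)) := by
  ext x
  rw [coe_lineDeriv_test]
  exact ((t.contDiff.differentiable (by simp) x).hasDerivAt.ofReal_comp).deriv.symm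

theorem dirac_apply (x : ℝ) (t : Test) : dirac x t = t x := rfl

theorem shift_apply (h : ℝ) (F : Dist) (t : Test) : shift h F t = F (translateTest h t) := rfl

theorem translateTest_apply (h : ℝ) (t : Test) (x : ℝ) : translateTest h t x = t (x - h) := rfl

theorem regular_apply {f : ℝ → ℂ} (hf : LocallyIntegrable f) (t : Test) :
    regular f t = ∫ x, (t x : ℂ) * f x := by
  have : LocallyIntegrableOn f ((⊤ : Opens ℝ) : Set ℝ) volume := hf.locallyIntegrableOn _
  exact (TestFunction.integralAgainstBilinCLM_eq_integral this).trans (by simp)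

theorem regular_congr {f g : ℝ → ℂ} (h : f =ᵐ[volume] g) : regular f = regular g := by
  -- `regular` takes the default value 0 on functions that are not locally integrable, so the two
  -- integrability conditions must be identified before the integrals are compared.
  have key : LocallyIntegrable f ↔ LocallyIntegrable g := locallyIntegrable_congr h
  have key' : LocallyIntegrableOn f ((⊤ : Opens ℝ) : Set ℝ) volume ↔
      LocallyIntegrableOn g ((⊤ : Opens ℝ) : Set ℝ) volume := by
    simpa [locallyIntegrableOn_univ] using key
  ext t
  classical
  change (TestFunction.integralAgainstBilinCLM _ _ f) t =
    (TestFunction.integralAgainstBilinCLM _ _ g) t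
  rw [TestFunction.integralAgainstBilinCLM_apply, TestFunction.integralAgainstBilinCLM_apply]
  simp only [key']
  congr 1
  refine integral_congr_ae ?_
  filter_upwards [h] with x hx
  rw [hx]

theorem D_zero (F : Dist) : D 0 F = F := rfl

theorem D_succ (k : ℕ) (F : Dist) : D (k + 1) F = D 1 (D k F) :=
  Function.iterate_succ_apply' _ _ _

theorem D_one_apply (F : Dist) (t : Test) : D 1 F t = -F (∂_{(1 : ℝ)} t) := by
  simp [D]

theorem D_one_add (F G : Dist) : D 1 (F + G) = D 1 F + D 1 G := by
  ext t
  simp [D_one_apply]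
  ring

theorem D_one_sum {ι : Type*} (s : Finset ι) (F : ι → Dist) :
    D 1 (∑ i ∈ s, F i) = ∑ i ∈ s, D 1 (F i) := by
  classical
  induction s using Finset.induction_on with
  | empty => ext t; simp [D_one_apply]
  | insert a s ha ih => rw [Finset.sum_insert ha, Finset.sum_insert ha, D_one_add, ih]

theorem D_sum {ι : Type*} (k : ℕ) (s : Finset ι) (F : ι → Dist) :
    D k (∑ i ∈ s, F i) = ∑ i ∈ s, D k (F i) := by
  induction k with
  | zero => rfl
  | succ k ih => rw [D_succ, ih, D_one_sum]; simp_rw [← D_succ]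

theorem D_dirac_apply (k : ℕ) (x : ℝ) (t : Test) :
    D k (dirac x) t = (-1) ^ k * iteratedDeriv k (fun y => (t y : ℂ)) x := by
  induction k generalizing t with
  | zero => simp [D_zero, dirac_apply]
  | succ k ih =>
    rw [D_succ, D_one_apply, ih, deriv_ofReal_test, ← iteratedDeriv_succ']
    ring

/-! ### Piecewise smooth functions with one jump, and combinations of derivatives of deltas -/

/-- The functional `s ↦ ⟨∑_j c_j δ_x^{(j)}, s⟩` on smooth functions. -/
def jetAt (x : ℝ) {n : ℕ} (c : Fin n → ℂ) (s : ℝ → ℂ) : ℂ :=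
  ∑ j : Fin n, c j * ((-1) ^ (j : ℕ) * iteratedDeriv j s x)

/-- The function equal to `fm` on the left of `x`, to `fp` on the right of `x`, and to `0` at `x`. -/
def jumpFun (x : ℝ) (fm fp : ℝ → ℂ) : ℝ → ℂ :=
  fun y => fm y * heaviside (x - y) + fp y * heaviside (y - x)

theorem jumpFun_of_lt {x y : ℝ} (fm fp : ℝ → ℂ) (h : y < x) : jumpFun x fm fp y = fm y := by
  have h' : ¬ x < y := not_lt.mpr h.le
  simp [jumpFun, heaviside, h, h']

theorem jumpFun_of_gt {x y : ℝ} (fm fp : ℝ → ℂ) (h : x < y) : jumpFun x fm fp y = fp y := by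
  have h' : ¬ y < x := not_lt.mpr h.le
  simp [jumpFun, heaviside, h, h']

theorem jumpFun_self (x : ℝ) (fm fp : ℝ → ℂ) : jumpFun x fm fp x = 0 := by
  simp [jumpFun, heaviside]

theorem jumpFun_ae_eq (x : ℝ) (fm fp : ℝ → ℂ) :
    jumpFun x fm fp =ᵐ[volume] (Set.Iic x).piecewise fm fp := by
  have : ∀ᵐ y : ℝ, y ≠ x := by simp [ae_iff]
  filter_upwards [this] with y hy
  rcases lt_or_gt_of_ne hy with h | h
  · rw [jumpFun_of_lt _ _ h, Set.piecewise_eq_of_mem _ _ _ (Set.mem_Iic.mpr h.le)]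
  · rw [jumpFun_of_gt _ _ h, Set.piecewise_eq_of_notMem _ _ _ (by simpa using h)]

theorem locallyIntegrable_jumpFun (x : ℝ) {fm fp : ℝ → ℂ} (hm : Continuous fm)
    (hp : Continuous fp) : LocallyIntegrable (jumpFun x fm fp) := by
  refine (locallyIntegrable_congr (jumpFun_ae_eq x fm fp)).mpr ?_
  classical
  rw [locallyIntegrable_iff]
  intro K hK
  refine Integrable.piecewise measurableSet_Iic ?_ ?_
  · exact (hm.locallyIntegrable.integrableOn_isCompact hK).integrableOn
  · exact (hp.locallyIntegrable.integrableOn_isCompact hK).integrableOn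

theorem integrable_mul_jumpFun (x : ℝ) {s fm fp : ℝ → ℂ} (hs : Continuous s)
    (hs' : HasCompactSupport s) (hm : Continuous fm) (hp : Continuous fp) :
    Integrable (fun y => s y * jumpFun x fm fp y) := by
  simpa using (locallyIntegrable_jumpFun x hm hp).integrable_smul_left_of_hasCompactSupport hs hs'

theorem jumpDelta_apply (x : ℝ) {fm fp : ℝ → ℂ} (hm : Continuous fm)
    (hp : Continuous fp) {n : ℕ} (c : Fin n → ℂ) (t : Test) :
    jumpDelta x fm fp c t = (∫ y, (t y : ℂ) * jumpFun x fm fp y) +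
      jetAt x c (fun y => (t y : ℂ)) := by
  have h1 := regular_apply (locallyIntegrable_jumpFun x hm hp) t
  have h2 : (∑ j : Fin n, c j • D j (dirac x)) t = jetAt x c (fun y => (t y : ℂ)) := by
    simp [jetAt, D_dirac_apply]
  rw [← h1, ← h2]
  rfl

theorem iteratedDeriv_clm_comp {E F : Type*} [NormedAddCommGroup E] [NormedSpace ℝ E]
    [NormedAddCommGroup F] [NormedSpace ℝ F] (L : E →L[ℝ] F) {s : ℝ → E} (hs : ContDiff ℝ ∞ s)
    (k : ℕ) (x : ℝ) : iteratedDeriv k (fun y => L (s y)) x = L (iteratedDeriv k s x) := by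
  induction k generalizing x with
  | zero => simp
  | succ k ih =>
    rw [iteratedDeriv_succ, iteratedDeriv_succ, show iteratedDeriv k (fun y => L (s y)) =
      fun y => L (iteratedDeriv k s y) from funext ih]
    have hd : DifferentiableAt ℝ (iteratedDeriv k s) x :=
      (hs.differentiable_iteratedDeriv k (by exact_mod_cast ENat.natCast_lt_top k)) x
    exact (L.hasFDerivAt.comp_hasDerivAt x hd.hasDerivAt).deriv

theorem jetAt_re_im (x : ℝ) {n : ℕ} (c : Fin n → ℂ) {s : ℝ → ℂ} (hs : ContDiff ℝ ∞ s) :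
    jetAt x c s = jetAt x c (fun y => ((s y).re : ℂ)) +
      Complex.I * jetAt x c (fun y => ((s y).im : ℂ)) := by
  simp only [jetAt, Finset.mul_sum, ← Finset.sum_add_distrib]
  refine Finset.sum_congr rfl fun j _ => ?_
  have h1 := iteratedDeriv_clm_comp (Complex.ofRealCLM ∘L Complex.reCLM) hs j x
  have h2 := iteratedDeriv_clm_comp (Complex.ofRealCLM ∘L Complex.imCLM) hs j x
  simp only [ContinuousLinearMap.comp_apply, Complex.ofRealCLM_apply, Complex.reCLM_apply,
    Complex.imCLM_apply] at h1 h2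
  rw [h1, h2]
  conv_lhs => rw [← Complex.re_add_im (iteratedDeriv j s x)]
  ring

/-- Dual products test a distribution against t f with f complex-valued, so the formula for real
tests has to be extended complex-linearly. -/
theorem pairing_jumpDelta (x : ℝ) {fm fp : ℝ → ℂ} (hm : Continuous fm)
    (hp : Continuous fp) {n : ℕ} (c : Fin n → ℂ) (s : 𝓓((⊤ : Opens ℝ), ℂ)) :
    pairing (jumpDelta x fm fp c) s = (∫ y, s y * jumpFun x fm fp y) + jetAt x c s := by
  have hre : HasCompactSupport (fun y => ((s y).re : ℂ)) :=
    s.hasCompactSupport.comp_left (g := fun z : ℂ => (z.re : ℂ)) (by simp)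
  have him : HasCompactSupport (fun y => ((s y).im : ℂ)) :=
    s.hasCompactSupport.comp_left (g := fun z : ℂ => (z.im : ℂ)) (by simp)
  have hs := s.continuous
  have h1 := integrable_mul_jumpFun x (by fun_prop) hre hm hp
  have h2 := integrable_mul_jumpFun x (by fun_prop) him hm hp
  rw [pairing, jumpDelta_apply x hm hp, jumpDelta_apply x hm hp, jetAt_re_im x c s.contDiff]
  simp only [TestFunction.postcompCLM_apply, Function.comp_apply, Complex.reCLM_apply,
    Complex.imCLM_apply]
  have : ∫ y, s y * jumpFun x fm fp y = (∫ y, ((s y).re : ℂ) * jumpFun x fm fp y) +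
      Complex.I * ∫ y, ((s y).im : ℂ) * jumpFun x fm fp y := by
    rw [← integral_const_mul, ← integral_add h1 (h2.const_mul _)]
    refine integral_congr_ae (Filter.Eventually.of_forall fun y => ?_)
    change s y * _ = _
    conv_lhs => rw [← Complex.re_add_im (s y)]
    ring
  rw [this]
  ring

theorem integral_mul_jumpFun (x : ℝ) {s fm fp : ℝ → ℂ} (hs : Continuous s)
    (hs' : HasCompactSupport s) (hm : Continuous fm) (hp : Continuous fp) :
    ∫ y, s y * jumpFun x fm fp y =
      (∫ y in Set.Iic x, s y * fm y) + ∫ y in Set.Ioi x, s y * fp y := by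
  have hi := integrable_mul_jumpFun x hs hs' hm hp
  rw [← integral_add_compl measurableSet_Iic hi, Set.compl_Iic]
  congr 1
  · rw [integral_Iic_eq_integral_Iio, integral_Iic_eq_integral_Iio]
    exact setIntegral_congr_fun measurableSet_Iio fun y hy => by
      simp [jumpFun_of_lt fm fp (Set.mem_Iio.mp hy)]
  · exact setIntegral_congr_fun measurableSet_Ioi fun y hy => by
      simp [jumpFun_of_gt fm fp (Set.mem_Ioi.mp hy)]

/-- Integration by parts on each half-line; the two boundary terms at x combine into the jump. -/
theorem integral_deriv_mul_jumpFun (x : ℝ) {s fm fp : ℝ → ℂ} (hs : ContDiff ℝ ∞ s)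
    (hs' : HasCompactSupport s) (hm : ContDiff ℝ ∞ fm) (hp : ContDiff ℝ ∞ fp) :
    -∫ y, deriv s y * jumpFun x fm fp y =
      (∫ y, s y * jumpFun x (deriv fm) (deriv fp) y) + (fp x - fm x) * s x := by
  have h1 : (1 : WithTop ℕ∞) ≤ ∞ := by exact_mod_cast le_top
  have cont_deriv : ∀ {f : ℝ → ℂ}, ContDiff ℝ ∞ f → Continuous (deriv f) :=
    fun hf => hf.continuous_deriv h1
  have prod : ∀ {f : ℝ → ℂ}, ContDiff ℝ ∞ f →
      deriv (fun y => s y * f y) = fun y => deriv s y * f y + s y * deriv f y := fun hf => by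
    ext y
    exact ((hs.differentiable (by simp) y).hasDerivAt.mul
      (hf.differentiable (by simp) y).hasDerivAt).deriv
  have hint : ∀ {f : ℝ → ℂ}, Continuous f → Integrable (fun y => s y * f y) := fun hf =>
    (hs.continuous.mul hf).integrable_of_hasCompactSupport hs'.mul_right
  have hint' : ∀ {f : ℝ → ℂ}, Continuous f → Integrable (fun y => deriv s y * f y) := fun hf =>
    ((cont_deriv hs).mul hf).integrable_of_hasCompactSupport hs'.deriv.mul_right
  have e1 := HasCompactSupport.integral_Iic_deriv_eq ((hs.mul hm).of_le h1)
    (hs'.mul_right (f' := fm)) x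
  have e2 := HasCompactSupport.integral_Ioi_deriv_eq ((hs.mul hp).of_le h1)
    (hs'.mul_right (f' := fp)) x
  rw [prod hm, integral_add (hint' hm.continuous).integrableOn
    (hint (cont_deriv hm)).integrableOn] at e1
  rw [prod hp, integral_add (hint' hp.continuous).integrableOn
    (hint (cont_deriv hp)).integrableOn] at e2
  rw [integral_mul_jumpFun x (cont_deriv hs) hs'.deriv hm.continuous hp.continuous,
    integral_mul_jumpFun x hs.continuous hs' (cont_deriv hm) (cont_deriv hp)]
  linear_combination - e1 - e2

/-- This is how the delta part transforms under differentiation: a new jump enters in front of δ,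
and the old coefficients move up one order, with the sign of ⟨δ', s⟩ = -s'(x). -/
theorem jetAt_cons (x : ℝ) {n : ℕ} (j : ℂ) (c : Fin n → ℂ) (s : ℝ → ℂ) :
    jetAt x (Fin.cons j c : Fin (n + 1) → ℂ) s = j * s x - jetAt x c (deriv s) := by
  simp only [jetAt, Fin.sum_univ_succ, Fin.cons_zero, Fin.cons_succ, Fin.val_zero, pow_zero,
    iteratedDeriv_zero, one_mul, Fin.val_succ, sub_eq_add_neg, ← Finset.sum_neg_distrib]
  congr 1
  refine Finset.sum_congr rfl fun i _ => ?_
  rw [iteratedDeriv_succ']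
  ring

theorem contDiff_deriv {f : ℝ → ℂ} (hf : ContDiff ℝ ∞ f) : ContDiff ℝ ∞ (deriv f) :=
  (contDiff_infty_iff_deriv.mp hf).2

theorem contDiff_iteratedDeriv {f : ℝ → ℂ} (hf : ContDiff ℝ ∞ f) (k : ℕ) :
    ContDiff ℝ ∞ (iteratedDeriv k f) := by
  induction k with
  | zero => simpa using hf
  | succ k ih => rw [iteratedDeriv_succ]; exact contDiff_deriv ih

theorem D_one_jumpDelta (x : ℝ) {fm fp : ℝ → ℂ} (hm : ContDiff ℝ ∞ fm)
    (hp : ContDiff ℝ ∞ fp) {n : ℕ} (c : Fin n → ℂ) :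
    D 1 (jumpDelta x fm fp c) =
      jumpDelta x (deriv fm) (deriv fp) (Fin.cons (fp x - fm x) c : Fin (n + 1) → ℂ) := by
  ext t
  rw [D_one_apply, jumpDelta_apply x hm.continuous hp.continuous,
    jumpDelta_apply x (contDiff_deriv hm).continuous (contDiff_deriv hp).continuous, jetAt_cons,
    deriv_ofReal_test]
  have := integral_deriv_mul_jumpFun x (contDiff_test t) (hasCompactSupport_test t) hm hp
  have h' : (fun y => deriv (fun x => (t x : ℂ)) y * jumpFun x fm fp y) =
    fun y => ((∂_{(1 : ℝ)} t : Test) y : ℂ) * jumpFun x fm fp y := by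
      rw [← deriv_ofReal_test]
  rw [h'] at this
  linear_combination this

/-- The coefficients of the deltas in `D m (jumpDelta x fm fp c)`. -/
def iterCons (x : ℝ) (fm fp : ℝ → ℂ) {n : ℕ} (c : Fin n → ℂ) : (m : ℕ) → Fin (n + m) → ℂ
  | 0 => c
  | m + 1 => (Fin.cons (iteratedDeriv m fp x - iteratedDeriv m fm x) (iterCons x fm fp c m) :
      Fin (n + m + 1) → ℂ)

theorem D_jumpDelta (x : ℝ) {fm fp : ℝ → ℂ} (hm : ContDiff ℝ ∞ fm)
    (hp : ContDiff ℝ ∞ fp) {n : ℕ} (c : Fin n → ℂ) (m : ℕ) :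
    D m (jumpDelta x fm fp c) =
      jumpDelta x (iteratedDeriv m fm) (iteratedDeriv m fp) (iterCons x fm fp c m) := by
  induction m with
  | zero => simp [D_zero, iterCons]
  | succ m ih =>
    rw [D_succ, ih, D_one_jumpDelta x (contDiff_iteratedDeriv hm m) (contDiff_iteratedDeriv hp m),
      iteratedDeriv_succ, iteratedDeriv_succ, iterCons]

theorem translateTest_ofReal (h : ℝ) (t : Test) :
    (fun y => (translateTest h t y : ℂ)) = fun y => (t (y - h) : ℂ) := rfl

theorem shift_jumpDelta (h y : ℝ) {gm gp : ℝ → ℂ} (hm : Continuous gm)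
    (hp : Continuous gp) {n : ℕ} (c : Fin n → ℂ) :
    shift h (jumpDelta y gm gp c) =
      jumpDelta (y - h) (fun z => gm (z + h)) (fun z => gp (z + h)) c := by
  ext t
  rw [shift_apply, jumpDelta_apply y hm hp, jumpDelta_apply (y - h) (by fun_prop) (by fun_prop),
    translateTest_ofReal]
  congr 1
  · rw [← integral_add_right_eq_self _ h]
    refine integral_congr_ae (Filter.Eventually.of_forall fun z => ?_)
    have e1 : y - (z + h) = y - h - z := by ring
    have e2 : z + h - y = z - (y - h) := by ring
    simp [translateTest_apply, jumpFun, e1, e2]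
  · simp only [jetAt]
    refine Finset.sum_congr rfl fun j _ => ?_
    rw [iteratedDeriv_comp_sub_const (f := fun y => (t y : ℂ))]

/-! ### Localization -/

/-- The distributions `F` and `F'` agree on the open set `U`. -/
def EqDistOn (U : Opens ℝ) (F F' : Dist) : Prop :=
  ∀ t : Test, tsupport t ⊆ U → F t = F' t

theorem EqDistOn.mono {U V : Opens ℝ} {F F' : Dist} (h : EqDistOn V F F') (hUV : U ≤ V) :
    EqDistOn U F F' :=
  fun t ht => h t (ht.trans hUV)

theorem EqDistOn.refl (U : Opens ℝ) (F : Dist) : EqDistOn U F F := fun _ _ => rfl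

/-- A smooth function with compact support, as a test function. -/
def mkTest (g : ℝ → ℝ) (hg : ContDiff ℝ ∞ g) (hg' : HasCompactSupport g) : Test :=
  ⟨g, hg, hg', fun _ _ => trivial⟩

theorem mkTest_apply (g : ℝ → ℝ) (hg : ContDiff ℝ ∞ g) (hg' : HasCompactSupport g) (x : ℝ) :
    mkTest g hg hg' x = g x := rfl

/-- A test function on the line supported in `U`, as a test function on `U`. -/
def restrictTest {U : Opens ℝ} (t : Test) (ht : tsupport t ⊆ U) : 𝓓(U, ℝ) :=
  ⟨t, t.contDiff, t.hasCompactSupport, ht⟩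

theorem extendTest_restrictTest {U : Opens ℝ} (t : Test) (ht : tsupport t ⊆ U) :
    extendTest (restrictTest t ht) = t := rfl

theorem extendTest_apply {U : Opens ℝ} (t : 𝓓(U, ℝ)) (x : ℝ) : extendTest t x = t x := rfl

theorem mulTest_apply {U : Opens ℝ} {f : ℝ → ℂ} (hf : ContDiffOn ℝ ∞ f U) (t : 𝓓(U, ℝ)) (x : ℝ) :
    mulTest hf t x = (t x : ℂ) * f x := by
  change t x • f x = _
  simp

theorem tsupport_mulTest_subset {U : Opens ℝ} {f : ℝ → ℂ} (hf : ContDiffOn ℝ ∞ f U)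
    (t : 𝓓(U, ℝ)) : tsupport (mulTest hf t) ⊆ tsupport t := by
  refine closure_mono fun x hx h0 => hx ?_
  rw [mulTest_apply, h0]
  simp

theorem EqFunOn.apply {U : Opens ℝ} {F : Dist} {f : ℝ → ℂ} (h : EqFunOn U F f) (t : Test)
    (ht : tsupport t ⊆ U) : F t = ∫ x, (t x : ℂ) * f x := by
  have := h (restrictTest t ht)
  rw [extendTest_restrictTest] at this
  rw [this]
  exact integral_congr_ae (Filter.Eventually.of_forall fun x => by simp [restrictTest])

theorem EqFunOn.of_apply {U : Opens ℝ} {F : Dist} {f : ℝ → ℂ}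
    (h : ∀ t : Test, tsupport t ⊆ U → F t = ∫ x, (t x : ℂ) * f x) : EqFunOn U F f := by
  intro t
  rw [h (extendTest t) t.tsupport_subset]
  exact integral_congr_ae (Filter.Eventually.of_forall fun x => by simp [extendTest_apply])

theorem EqDualProductOn.apply {U : Opens ℝ} {f : ℝ → ℂ} {hf : ContDiffOn ℝ ∞ f U} {G P : Dist}
    (h : EqDualProductOn U hf G P) (t : Test) (ht : tsupport t ⊆ U) :
    P t = pairing G (mulTest hf (restrictTest t ht)) := h (restrictTest t ht)

theorem EqFunOn.mono {U V : Opens ℝ} {F : Dist} {f : ℝ → ℂ} (h : EqFunOn V F f) (hUV : U ≤ V) :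
    EqFunOn U F f :=
  .of_apply fun t ht => h.apply t (ht.trans hUV)

theorem EqFunOn.congr {U : Opens ℝ} {F F' : Dist} {f : ℝ → ℂ} (h : EqFunOn U F f)
    (hF : EqDistOn U F F') : EqFunOn U F' f :=
  .of_apply fun t ht => (hF t ht).symm.trans (h.apply t ht)

theorem EqDualProductOn.mono {U V : Opens ℝ} {f : ℝ → ℂ} {hf : ContDiffOn ℝ ∞ f V} {G P : Dist}
    (h : EqDualProductOn V hf G P) (hUV : U ≤ V) :
    EqDualProductOn U (hf.mono hUV) G P := by
  intro t
  exact h.apply (extendTest t) (t.tsupport_subset.trans hUV)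

theorem tsupport_re_subset (s : 𝓓((⊤ : Opens ℝ), ℂ)) :
    tsupport (TestFunction.postcompCLM Complex.reCLM s) ⊆ tsupport s :=
  tsupport_comp_subset (map_zero Complex.reCLM) s

theorem tsupport_im_subset (s : 𝓓((⊤ : Opens ℝ), ℂ)) :
    tsupport (TestFunction.postcompCLM Complex.imCLM s) ⊆ tsupport s :=
  tsupport_comp_subset (map_zero Complex.imCLM) s

theorem EqDistOn.pairing_eq {U : Opens ℝ} {F F' : Dist} (h : EqDistOn U F F')
    (s : 𝓓((⊤ : Opens ℝ), ℂ)) (hs : tsupport s ⊆ U) : pairing F s = pairing F' s := by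
  rw [pairing, pairing, h _ ((tsupport_re_subset s).trans hs),
    h _ ((tsupport_im_subset s).trans hs)]

theorem integrable_mul_of_tsupport_subset {U : Opens ℝ} {s f : ℝ → ℂ} (hs : Continuous s)
    (hs' : HasCompactSupport s) (hsU : tsupport s ⊆ U) (hf : ContinuousOn f U) :
    Integrable (fun x => s x * f x) := by
  refine Continuous.integrable_of_hasCompactSupport ?_ hs'.mul_right
  rw [continuous_iff_continuousAt]
  intro x
  by_cases hx : x ∈ tsupport s
  · exact hs.continuousAt.mul (hf.continuousAt (U.isOpen.mem_nhds (hsU hx)))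
  · refine (continuousAt_const (y := (0 : ℂ))).congr ?_
    filter_upwards [notMem_tsupport_iff_eventuallyEq.mp hx] with y hy
    simp [hy]

theorem EqFunOn.pairing_eq {U : Opens ℝ} {F : Dist} {f : ℝ → ℂ} (h : EqFunOn U F f)
    (hf : ContinuousOn f U) (s : 𝓓((⊤ : Opens ℝ), ℂ)) (hs : tsupport s ⊆ U) :
    pairing F s = ∫ x, s x * f x := by
  have hre : HasCompactSupport (fun y => ((s y).re : ℂ)) :=
    s.hasCompactSupport.comp_left (g := fun z : ℂ => (z.re : ℂ)) (by simp)
  have him : HasCompactSupport (fun y => ((s y).im : ℂ)) :=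
    s.hasCompactSupport.comp_left (g := fun z : ℂ => (z.im : ℂ)) (by simp)
  have hc := s.continuous
  have h1 := integrable_mul_of_tsupport_subset (s := fun y => ((s y).re : ℂ)) (by fun_prop) hre
    ((tsupport_comp_subset (g := fun z : ℂ => (z.re : ℂ)) (by simp) s).trans hs) hf
  have h2 := integrable_mul_of_tsupport_subset (s := fun y => ((s y).im : ℂ)) (by fun_prop) him
    ((tsupport_comp_subset (g := fun z : ℂ => (z.im : ℂ)) (by simp) s).trans hs) hf
  rw [pairing, h.apply _ ((tsupport_re_subset s).trans hs),
    h.apply _ ((tsupport_im_subset s).trans hs)]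
  simp only [TestFunction.postcompCLM_apply, Function.comp_apply, Complex.reCLM_apply,
    Complex.imCLM_apply]
  rw [← integral_const_mul, ← integral_add h1 (h2.const_mul _)]
  refine integral_congr_ae (Filter.Eventually.of_forall fun y => ?_)
  change _ = s y * _
  conv_rhs => rw [← Complex.re_add_im (s y)]
  ring

/-- The fundamental lemma of the calculus of variations gives equality almost everywhere, and
continuity upgrades it to equality at every point of U. This makes dual products independent of the
chosen representative. -/
theorem EqFunOn.eqOn {U : Opens ℝ} {F : Dist} {f f' : ℝ → ℂ} (h : EqFunOn U F f)
    (h' : EqFunOn U F f') (hf : ContinuousOn f U) (hf' : ContinuousOn f' U) :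
    Set.EqOn f f' U := by
  have hloc : LocallyIntegrableOn (fun x => f x - f' x) (U : Set ℝ) volume :=
    (hf.sub hf').locallyIntegrableOn U.isOpen.measurableSet
  have hae := U.isOpen.ae_eq_zero_of_integral_contDiff_smul_eq_zero hloc (fun g hg hgc hgU => by
    have e := (h.apply (mkTest g hg hgc) hgU).symm.trans
      (h'.apply (mkTest g hg hgc) hgU)
    simp only [mkTest_apply] at e
    have hgc' : HasCompactSupport (fun y => (g y : ℂ)) :=
      hgc.comp_left (g := fun r : ℝ => (r : ℂ)) (by simp)
    have hgU' : tsupport (fun y => (g y : ℂ)) ⊆ U :=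
      (tsupport_comp_subset (g := fun r : ℝ => (r : ℂ)) (by simp) g).trans hgU
    have hg' := hg.continuous
    have i1 := integrable_mul_of_tsupport_subset (s := fun y => (g y : ℂ)) (by fun_prop) hgc'
      hgU' hf
    have i2 := integrable_mul_of_tsupport_subset (s := fun y => (g y : ℂ)) (by fun_prop) hgc'
      hgU' hf'
    rw [← sub_eq_zero, ← integral_sub i1 i2] at e
    rw [← e]
    exact integral_congr_ae (Filter.Eventually.of_forall fun y => by simp; ring))
  refine Measure.eqOn_open_of_ae_eq (μ := volume) ?_ U.isOpen hf hf'
  refine (ae_restrict_iff' U.isOpen.measurableSet).mpr ?_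
  filter_upwards [hae] with x hx hxU
  exact sub_eq_zero.mp (hx hxU)

theorem mulTest_congr {U V : Opens ℝ} {f f' : ℝ → ℂ} (hf : ContDiffOn ℝ ∞ f U)
    (hf' : ContDiffOn ℝ ∞ f' V) (t : 𝓓(U, ℝ)) (t' : 𝓓(V, ℝ)) (h : ⇑t = t')
    (hff : Set.EqOn f f' (tsupport t)) : mulTest hf t = mulTest hf' t' := by
  ext x
  rw [mulTest_apply, mulTest_apply, ← h]
  by_cases hx : x ∈ tsupport t
  · rw [hff hx]
  · rw [image_eq_zero_of_notMem_tsupport hx]; simp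

/-- On the open set `U`, the distribution `P` is the product of `F` and `G`, one of which is a
smooth function there. -/
def IsLocalProduct (U : Opens ℝ) (F G P : Dist) : Prop :=
  (∃ (f : ℝ → ℂ) (hf : ContDiffOn ℝ ∞ f U), EqFunOn U F f ∧ EqDualProductOn U hf G P) ∨
    (∃ (g : ℝ → ℂ) (hg : ContDiffOn ℝ ∞ g U), EqFunOn U G g ∧ EqDualProductOn U hg F P)

theorem IsLocalProduct.symm {U : Opens ℝ} {F G P : Dist} (h : IsLocalProduct U F G P) :
    IsLocalProduct U G F P := Or.symm h

theorem IsLocalProduct.mono {U V : Opens ℝ} {F G P : Dist} (h : IsLocalProduct V F G P)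
    (hUV : U ≤ V) : IsLocalProduct U F G P := by
  rcases h with ⟨f, hf, h1, h2⟩ | ⟨f, hf, h1, h2⟩
  · exact .inl ⟨f, hf.mono hUV, h1.mono hUV, h2.mono hUV⟩
  · exact .inr ⟨f, hf.mono hUV, h1.mono hUV, h2.mono hUV⟩

theorem EqDualProductOn.congr {U : Opens ℝ} {f f' : ℝ → ℂ} {hf : ContDiffOn ℝ ∞ f U}
    {hf' : ContDiffOn ℝ ∞ f' U} {F G F' G' P : Dist} (h : EqDualProductOn U hf G P)
    (h1 : EqFunOn U F f) (h2 : EqFunOn U F' f') (hF : EqDistOn U F F') (hG : EqDistOn U G G') :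
    EqDualProductOn U hf' G' P := by
  intro t
  rw [h t, hG.pairing_eq _ ((tsupport_mulTest_subset hf t).trans t.tsupport_subset),
    mulTest_congr hf hf' t t rfl]
  exact ((h1.congr hF).eqOn h2 hf.continuousOn hf'.continuousOn).mono t.tsupport_subset

/-- When both factors are functions, either dual product is the integral of t f g, so the two
alternatives in the definition of the product are compatible. -/
theorem EqDualProductOn.swap {U : Opens ℝ} {f g : ℝ → ℂ} {hf : ContDiffOn ℝ ∞ f U}
    {hg : ContDiffOn ℝ ∞ g U} {F G P : Dist} (h : EqDualProductOn U hf G P)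
    (h1 : EqFunOn U F f) (h2 : EqFunOn U G g) : EqDualProductOn U hg F P := by
  intro t
  rw [h t, h2.pairing_eq hg.continuousOn _
    ((tsupport_mulTest_subset hf t).trans t.tsupport_subset), h1.pairing_eq hf.continuousOn _
    ((tsupport_mulTest_subset hg t).trans t.tsupport_subset)]
  refine integral_congr_ae (Filter.Eventually.of_forall fun y => ?_)
  simp only [mulTest_apply]
  ring

theorem EqDualProductOn.unique {U : Opens ℝ} {f : ℝ → ℂ} {hf : ContDiffOn ℝ ∞ f U}
    {G P P' : Dist} (h : EqDualProductOn U hf G P) (h' : EqDualProductOn U hf G P') :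
    EqDistOn U P P' :=
  fun t ht => (h.apply t ht).trans (h'.apply t ht).symm

theorem IsLocalProduct.dual {U : Opens ℝ} {F G P : Dist} (h : IsLocalProduct U F G P)
    {f : ℝ → ℂ} (hf : ContDiffOn ℝ ∞ f U) (hFf : EqFunOn U F f) : EqDualProductOn U hf G P := by
  rcases h with ⟨f', hf', h1, h2⟩ | ⟨g, hg, h1, h2⟩
  · exact h2.congr h1 hFf (.refl U F) (.refl U G)
  · exact h2.swap h1 hFf

/-- Both products can be turned into dual products by the same smooth factor, through
`IsLocalProduct.dual`. Allowing factors that agree only on U gives locality along with uniqueness.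
-/
theorem IsLocalProduct.unique {U : Opens ℝ} {F G F' G' P P' : Dist} (h : IsLocalProduct U F G P)
    (h' : IsLocalProduct U F' G' P') (hF : EqDistOn U F F') (hG : EqDistOn U G G') :
    EqDistOn U P P' := by
  rcases h with ⟨f, hf, h1, h2⟩ | ⟨g, hg, h1, h2⟩
  · have h1' := h1.congr hF
    exact (h2.congr (hf' := hf) h1 h1' hF hG).unique (h'.dual hf h1')
  · have h1' := h1.congr hG
    exact (h2.congr (hf' := hg) h1 h1' hG hF).unique (h'.symm.dual hg h1')

theorem pairing_add (F G : Dist) (s : 𝓓((⊤ : Opens ℝ), ℂ)) :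
    pairing (F + G) s = pairing F s + pairing G s := by
  simp [pairing]
  ring

theorem EqDualProductOn.add {U : Opens ℝ} {f : ℝ → ℂ} {hf : ContDiffOn ℝ ∞ f U}
    {G G' P P' : Dist} (h : EqDualProductOn U hf G P) (h' : EqDualProductOn U hf G' P') :
    EqDualProductOn U hf (G + G') (P + P') := by
  intro t
  rw [pairing_add, ← h t, ← h' t]
  simp

theorem EqFunOn.add {U : Opens ℝ} {f g : ℝ → ℂ} {F G : Dist} (h1 : EqFunOn U F f)
    (h2 : EqFunOn U G g) (hf : ContinuousOn f U) (hg : ContinuousOn g U) :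
    EqFunOn U (F + G) (fun x => f x + g x) := by
  refine .of_apply fun t ht => ?_
  have hU : tsupport (fun y => (t y : ℂ)) ⊆ U :=
    (tsupport_comp_subset (g := fun r : ℝ => (r : ℂ)) (by simp) t).trans ht
  have i1 := integrable_mul_of_tsupport_subset (contDiff_test t).continuous
    (hasCompactSupport_test t) hU hf
  have i2 := integrable_mul_of_tsupport_subset (contDiff_test t).continuous
    (hasCompactSupport_test t) hU hg
  simp only [mul_add]
  rw [integral_add i1 i2, ← h1.apply t ht, ← h2.apply t ht]
  simp

theorem IsLocalProduct.add_right {U : Opens ℝ} {F G G' P P' : Dist} (h : IsLocalProduct U F G P)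
    (h' : IsLocalProduct U F G' P') : IsLocalProduct U F (G + G') (P + P') := by
  -- If F is a smooth function on U, both products become dual products by it. Otherwise the smooth
  -- factor must be G in the first product and G' in the second, and their sum is smooth.
  by_cases hF : ∃ f, ContDiffOn ℝ ∞ f U ∧ EqFunOn U F f
  · obtain ⟨f, hf, hFf⟩ := hF
    exact .inl ⟨f, hf, hFf, (h.dual hf hFf).add (h'.dual hf hFf)⟩
  · rcases h with ⟨f, hf, h1, -⟩ | ⟨g, hg, h1, h2⟩
    · exact (hF ⟨f, hf, h1⟩).elim
    rcases h' with ⟨f, hf, h3, -⟩ | ⟨g', hg', h3, h4⟩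
    · exact (hF ⟨f, hf, h3⟩).elim
    refine .inr ⟨fun x => g x + g' x, hg.add hg', h1.add h3 hg.continuousOn hg'.continuousOn, ?_⟩
    intro t
    have e : mulTest (hg.add hg') t = mulTest hg t + mulTest hg' t := by
      ext x
      change mulTest (hg.add hg') t x = mulTest hg t x + mulTest hg' t x
      simp only [mulTest_apply]
      ring
    have e2 := h2 t
    have e4 := h4 t
    have : pairing F (mulTest hg t + mulTest hg' t) =
        pairing F (mulTest hg t) + pairing F (mulTest hg' t) := by
      simp only [pairing, map_add]
      ring
    have e5 : pairing F (mulTest (hg.add hg') t) = P (extendTest t) + P' (extendTest t) := by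
      rw [e, this, ← e2, ← e4]
    exact Eq.trans (by simp) e5.symm

/-- Smooth partitions of unity reduce the equality of two distributions on a test function to
open sets covering its support. -/
theorem apply_eq_of_cover {ι : Type*} [Fintype ι] (W : ι → Opens ℝ) {F F' : Dist} (t : Test)
    (hW : ∀ x ∈ tsupport t, ∃ i, x ∈ W i) (h : ∀ i, EqDistOn (W i) F F') : F t = F' t := by
  obtain ⟨χ, hχ⟩ := SmoothPartitionOfUnity.exists_isSubordinate (modelWithCornersSelf ℝ ℝ)
    (isClosed_tsupport t) (fun i => (W i : Set ℝ)) (fun i => (W i).isOpen)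
    (fun x hx => by simpa using hW x hx)
  let T : ι → Test := fun i => mkTest (fun x => χ i x * t x)
    ((χ i).contMDiff.contDiff.mul t.contDiff) t.hasCompactSupport.mul_left
  have hT : ∀ i, tsupport (T i) ⊆ W i := fun i =>
    (tsupport_mul_subset_left (f := fun x => χ i x) (g := fun x => t x)).trans (hχ i)
  have hsum : t = ∑ i, T i := by
    ext x
    have : (∑ i, T i) x = ∑ i, χ i x * t x := by
      simp [T, mkTest_apply]
    rw [this, ← Finset.sum_mul]
    by_cases hx : x ∈ tsupport t
    · rw [← finsum_eq_sum_of_fintype, χ.sum_eq_one hx, one_mul]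
    · rw [image_eq_zero_of_notMem_tsupport hx, mul_zero]
  rw [hsum, map_sum, map_sum]
  exact Finset.sum_congr rfl fun i _ => h i _ (hT i)

/-! ### Hörmander products -/

theorem isHormanderProduct_iff {F G P : Dist} : IsHormanderProduct F G P ↔
    ∃ (d : ℕ) (Ξ : Fin d → Opens ℝ), (∀ x : ℝ, ∃ i, x ∈ Ξ i) ∧ ∀ i, IsLocalProduct (Ξ i) F G P :=
  Iff.rfl

theorem IsHormanderProduct.symm {F G P : Dist} (h : IsHormanderProduct F G P) :
    IsHormanderProduct G F P := by
  obtain ⟨d, Ξ, h1, h2⟩ := isHormanderProduct_iff.mp h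
  exact ⟨d, Ξ, h1, fun i => (h2 i).symm⟩

/-- On the common refinement of the two covers, intersected with V, the local products agree; a
partition of unity glues these equalities. -/
theorem IsHormanderProduct.unique {V : Opens ℝ} {F G F' G' P P' : Dist}
    (h : IsHormanderProduct F G P) (h' : IsHormanderProduct F' G' P') (hF : EqDistOn V F F')
    (hG : EqDistOn V G G') : EqDistOn V P P' := by
  obtain ⟨d, Ξ, h1, h2⟩ := isHormanderProduct_iff.mp h
  obtain ⟨d', Ξ', h1', h2'⟩ := isHormanderProduct_iff.mp h'
  intro t ht
  refine apply_eq_of_cover (fun i : Fin d × Fin d' => Ξ i.1 ⊓ Ξ' i.2 ⊓ V) t (fun x hx => ?_) ?_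
  · obtain ⟨i, hi⟩ := h1 x
    obtain ⟨j, hj⟩ := h1' x
    exact ⟨(i, j), ⟨hi, hj⟩, ht hx⟩
  · rintro ⟨i, j⟩
    have le1 : Ξ i ⊓ Ξ' j ⊓ V ≤ Ξ i := inf_le_left.trans inf_le_left
    have le2 : Ξ i ⊓ Ξ' j ⊓ V ≤ Ξ' j := inf_le_left.trans inf_le_right
    exact ((h2 i).mono le1).unique ((h2' j).mono le2) (hF.mono inf_le_right)
      (hG.mono inf_le_right)

theorem hormander_eq {F G P : Dist} (h : IsHormanderProduct F G P) : hormander F G = P := by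
  have hex : ∃ P, IsHormanderProduct F G P := ⟨P, h⟩
  rw [hormander, dif_pos hex]
  ext t
  exact (hex.choose_spec.unique h (V := ⊤) (.refl _ _) (.refl _ _)) t (fun _ _ => trivial)

theorem IsHormanderProduct.add_right {F G G' P P' : Dist} (h : IsHormanderProduct F G P)
    (h' : IsHormanderProduct F G' P') : IsHormanderProduct F (G + G') (P + P') := by
  obtain ⟨d, Ξ, h1, h2⟩ := isHormanderProduct_iff.mp h
  obtain ⟨d', Ξ', h1', h2'⟩ := isHormanderProduct_iff.mp h'
  refine ⟨d * d', fun i => Ξ (finProdFinEquiv.symm i).1 ⊓ Ξ' (finProdFinEquiv.symm i).2,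
    fun x => ?_, fun i => ?_⟩
  · obtain ⟨i, hi⟩ := h1 x
    obtain ⟨j, hj⟩ := h1' x
    refine ⟨finProdFinEquiv (i, j), ?_⟩
    simpa using (⟨hi, hj⟩ : x ∈ Ξ i ⊓ Ξ' j)
  · exact ((h2 _).mono inf_le_left).add_right ((h2' _).mono inf_le_right)

theorem IsHormanderProduct.add_left {F F' G P P' : Dist} (h : IsHormanderProduct F G P)
    (h' : IsHormanderProduct F' G P') : IsHormanderProduct (F + F') G (P + P') :=
  (h.symm.add_right h'.symm).symm

/-! ### Star products -/

theorem shift_add (ε : ℝ) (F G : Dist) : shift ε (F + G) = shift ε F + shift ε G := by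
  ext t
  simp [shift_apply]

theorem IsStarProduct.add_right {F G G' P P' : Dist} (h : IsStarProduct F G P)
    (h' : IsStarProduct F G' P') : IsStarProduct F (G + G') (P + P') := by
  refine ⟨?_, fun t => ?_⟩
  · filter_upwards [h.1, h'.1] with ε ⟨Q, hQ⟩ ⟨Q', hQ'⟩
    rw [shift_add]
    exact ⟨_, hQ.add_right hQ'⟩
  · have : (P + P') t = P t + P' t := by simp
    rw [this]
    refine ((h.2 t).add (h'.2 t)).congr' ?_
    filter_upwards [h.1, h'.1] with ε ⟨Q, hQ⟩ ⟨Q', hQ'⟩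
    rw [shift_add, hormander_eq hQ, hormander_eq hQ', hormander_eq (hQ.add_right hQ')]
    simp

theorem IsStarProduct.add_left {F F' G P P' : Dist} (h : IsStarProduct F G P)
    (h' : IsStarProduct F' G P') : IsStarProduct (F + F') G (P + P') := by
  refine ⟨?_, fun t => ?_⟩
  · filter_upwards [h.1, h'.1] with ε ⟨Q, hQ⟩ ⟨Q', hQ'⟩
    exact ⟨_, hQ.add_left hQ'⟩
  · have : (P + P') t = P t + P' t := by simp
    rw [this]
    refine ((h.2 t).add (h'.2 t)).congr' ?_
    filter_upwards [h.1, h'.1] with ε ⟨Q, hQ⟩ ⟨Q', hQ'⟩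
    rw [hormander_eq hQ, hormander_eq hQ', hormander_eq (hQ.add_left hQ')]
    simp

theorem tsupport_translateTest (ε : ℝ) (t : Test) :
    tsupport (translateTest ε t) ⊆ (fun x => x - ε) ⁻¹' tsupport t :=
  tsupport_comp_subset_preimage t (f := fun x : ℝ => x - ε) (by fun_prop)

/-- The product at scale ε only involves G within distance ε of the support of t, and a compact
subset of U stays inside U under small translations. -/
theorem IsStarProduct.unique {U : Opens ℝ} {F G F' G' P P' : Dist} (h : IsStarProduct F G P)
    (h' : IsStarProduct F' G' P') (hF : EqDistOn U F F') (hG : EqDistOn U G G') :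
    EqDistOn U P P' := by
  intro t ht
  refine tendsto_nhds_unique (h.2 t) ((h'.2 t).congr' ?_)
  obtain ⟨δ, hδ, hU⟩ := t.hasCompactSupport.isCompact.exists_thickening_subset_open U.isOpen ht
  have hsmall : ∀ᶠ ε : ℝ in 𝓝[>] 0, ε < δ := nhdsWithin_le_nhds (gt_mem_nhds hδ)
  filter_upwards [h.1, h'.1, hsmall, self_mem_nhdsWithin] with ε ⟨Q, hQ⟩ ⟨Q', hQ'⟩ hε hε0
  rw [hormander_eq hQ, hormander_eq hQ']
  -- On the set of x with x and x + ε both in U, F agrees with F' and the shifts of G and G' agree.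
  -- It contains the support of t as soon as ε < δ.
  let V : Opens ℝ := U ⊓ ⟨(fun x => x + ε) ⁻¹' U, U.isOpen.preimage (by fun_prop)⟩
  refine ((hQ.unique hQ' (V := V) (hF.mono inf_le_left) ?_) t ?_).symm
  · intro t' ht'
    rw [shift_apply, shift_apply]
    refine hG _ fun x hx => ?_
    have := (ht' (tsupport_translateTest ε t' hx)).2
    simpa using this
  · intro x hx
    refine ⟨ht hx, hU ?_⟩
    rw [Metric.mem_thickening_iff]
    exact ⟨x, hx, by simpa [Real.dist_eq, abs_of_pos (Set.mem_Ioi.mp hε0)] using hε⟩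

theorem starProduct_eq {F G P : Dist} (h : IsStarProduct F G P) : starProduct F G = P := by
  have hex : ∃ P, IsStarProduct F G P := ⟨P, h⟩
  rw [starProduct, dif_pos hex]
  ext t
  exact (hex.choose_spec.unique h (U := ⊤) (.refl _ _) (.refl _ _)) t (fun _ _ => trivial)

/-! ### Products of piecewise smooth functions with deltas -/

theorem contDiffAt_nat {f : ℝ → ℂ} (hf : ContDiff ℝ ∞ f) (n : ℕ) (x : ℝ) :
    ContDiffAt ℝ n f x :=
  (hf.of_le (by exact_mod_cast le_top)).contDiffAt

theorem jetAt_congr {x : ℝ} {n : ℕ} (c : Fin n → ℂ) {s s' : ℝ → ℂ} (h : s =ᶠ[𝓝 x] s') :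
    jetAt x c s = jetAt x c s' := by
  simp only [jetAt]
  exact Finset.sum_congr rfl fun j _ => by rw [h.iteratedDeriv_eq]

theorem jetAt_eq_zero {x : ℝ} {n : ℕ} (c : Fin n → ℂ) {s : ℝ → ℂ} (h : s =ᶠ[𝓝 x] 0) :
    jetAt x c s = 0 := by
  rw [jetAt_congr c h]
  simp only [jetAt]
  refine Finset.sum_eq_zero fun j _ => ?_
  have : iteratedDeriv (j : ℕ) (0 : ℝ → ℂ) x = 0 := by
    rw [show (0 : ℝ → ℂ) = fun _ => 0 from rfl, iteratedDeriv_const]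
    split_ifs <;> rfl
  rw [this, mul_zero, mul_zero]

/-- By Leibniz' rule this functional is a combination of derivatives of deltas, hence continuous.
The explicit formulas for products can thus be realised by distributions. -/
theorem exists_dist_jetAt_mul (x : ℝ) {n : ℕ} (c : Fin n → ℂ) {g : ℝ → ℂ} (hg : ContDiff ℝ ∞ g) :
    ∃ Q : Dist, ∀ t : Test, Q t = jetAt x c (fun y => (t y : ℂ) * g y) := by
  refine ⟨∑ j : Fin n, ∑ i ∈ Finset.range ((j : ℕ) + 1), (c j * (-1) ^ (j : ℕ) *
    ((j : ℕ).choose i * (-1) ^ i * iteratedDeriv (j - i) g x)) • D i (dirac x), fun t => ?_⟩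
  have : ∀ j : Fin n, c j * ((-1) ^ (j : ℕ) * iteratedDeriv j (fun y => (t y : ℂ) * g y) x) =
      ∑ i ∈ Finset.range ((j : ℕ) + 1), (c j * (-1) ^ (j : ℕ) *
        ((j : ℕ).choose i * (-1) ^ i * iteratedDeriv (j - i) g x)) * D i (dirac x) t := by
    intro j
    rw [iteratedDeriv_fun_mul (contDiffAt_nat (contDiff_test t) _ _) (contDiffAt_nat hg _ _),
      ← mul_assoc, Finset.mul_sum]
    refine Finset.sum_congr rfl fun i _ => ?_
    rw [D_dirac_apply]
    have : ((-1 : ℂ) ^ i) * (-1) ^ i = 1 := by rw [← mul_pow]; simp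
    linear_combination (-(c j * (-1) ^ (j : ℕ) * (j : ℕ).choose i * iteratedDeriv (j - i) g x *
      iteratedDeriv i (fun y => (t y : ℂ)) x)) * this
  simp only [jetAt, this]
  simp

theorem locallyIntegrable_jumpFun_mul (x z : ℝ) {fm fp gm gp : ℝ → ℂ} (hfm : Continuous fm)
    (hfp : Continuous fp) (hgm : Continuous gm) (hgp : Continuous gp) :
    LocallyIntegrable (fun y => jumpFun x fm fp y * jumpFun z gm gp y) := by
  have hae : (fun y => jumpFun x fm fp y * jumpFun z gm gp y) =ᵐ[volume]
      (Set.Iic x).piecewise (fun y => fm y * jumpFun z gm gp y)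
        (fun y => fp y * jumpFun z gm gp y) := by
    filter_upwards [jumpFun_ae_eq x fm fp] with y hy
    rw [hy]
    by_cases h : y ∈ Set.Iic x <;> simp [Set.piecewise, h]
  refine (locallyIntegrable_congr hae).mpr ?_
  rw [locallyIntegrable_iff]
  intro K hK
  have hg := (locallyIntegrable_jumpFun z hgm hgp).integrableOn_isCompact hK
  refine Integrable.piecewise measurableSet_Iic ?_ ?_
  · exact (hg.continuousOn_mul hfm.continuousOn hK).integrableOn
  · exact (hg.continuousOn_mul hfp.continuousOn hK).integrableOn

theorem jumpFun_eventuallyEq {x z : ℝ} (h : z ≠ x) (fm fp : ℝ → ℂ) :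
    jumpFun x fm fp =ᶠ[𝓝 z] if z < x then fm else fp := by
  rcases lt_or_gt_of_ne h with h | h
  · rw [if_pos h]
    filter_upwards [gt_mem_nhds h] with y hy
    exact jumpFun_of_lt _ _ hy
  · rw [if_neg h.not_gt]
    filter_upwards [lt_mem_nhds h] with y hy
    exact jumpFun_of_gt _ _ hy

/-- The open set `ℝ \ {x}`. -/
def punctured (x : ℝ) : Opens ℝ := ⟨{x}ᶜ, isOpen_compl_singleton⟩

theorem contDiffOn_jumpFun (x : ℝ) {fm fp : ℝ → ℂ} (hm : ContDiff ℝ ∞ fm)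
    (hp : ContDiff ℝ ∞ fp) : ContDiffOn ℝ ∞ (jumpFun x fm fp) (punctured x) := by
  intro z hz
  refine ContDiffAt.contDiffWithinAt ?_
  refine ContDiffAt.congr_of_eventuallyEq ?_ (jumpFun_eventuallyEq hz fm fp)
  split_ifs
  · exact hm.contDiffAt
  · exact hp.contDiffAt

theorem eqFunOn_jumpDelta (x : ℝ) {fm fp : ℝ → ℂ} (hm : Continuous fm)
    (hp : Continuous fp) {n : ℕ} (c : Fin n → ℂ) :
    EqFunOn (punctured x) (jumpDelta x fm fp c) (jumpFun x fm fp) := by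
  refine .of_apply fun t ht => ?_
  rw [jumpDelta_apply x hm hp, jetAt_eq_zero c, add_zero]
  have hx : x ∉ tsupport t := fun h => ht h rfl
  filter_upwards [notMem_tsupport_iff_eventuallyEq.mp hx] with y hy
  simp [hy]

/-- Off x the first factor is a smooth function, and deltas at x are invisible there, which is why g
may be arbitrary. This freedom lets the same formula serve on both sets of the cover below. -/
theorem isLocalProduct_jumpDelta {x z : ℝ} (hxz : z ≠ x) {fm fp gm gp : ℝ → ℂ}
    (hfm : ContDiff ℝ ∞ fm) (hfp : ContDiff ℝ ∞ fp) (hgm : Continuous gm)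
    (hgp : Continuous gp) {n m : ℕ} (c : Fin n → ℂ) (d : Fin m → ℂ) (g : ℝ → ℂ) {P : Dist}
    (hP : ∀ t : Test, P t = (∫ y, (t y : ℂ) * (jumpFun x fm fp y * jumpFun z gm gp y)) +
      jetAt x c (fun y => (t y : ℂ) * g y) +
      jetAt z d (fun y => (t y : ℂ) * (if z < x then fm else fp) y)) :
    IsLocalProduct (punctured x) (jumpDelta x fm fp c) (jumpDelta z gm gp d) P := by
  refine .inl ⟨jumpFun x fm fp, contDiffOn_jumpFun x hfm hfp,
    eqFunOn_jumpDelta x hfm.continuous hfp.continuous c, fun t => ?_⟩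
  rw [hP, pairing_jumpDelta z hgm hgp]
  have h0 : jetAt x c (fun y => (extendTest t y : ℂ) * g y) = 0 := by
    refine jetAt_eq_zero c ?_
    have hx : x ∉ tsupport t := fun h => t.tsupport_subset h rfl
    filter_upwards [notMem_tsupport_iff_eventuallyEq.mp hx] with y hy
    rw [extendTest_apply, hy]
    simp
  rw [h0, add_zero]
  congr 1
  · refine integral_congr_ae (Filter.Eventually.of_forall fun y => ?_)
    simp only [mulTest_apply, extendTest_apply]
    ring
  · refine jetAt_congr d ?_
    filter_upwards [jumpFun_eventuallyEq hxz fm fp] with y hy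
    rw [mulTest_apply, extendTest_apply, hy]

/-- For z ≠ x the sets ℝ \ {x} and ℝ \ {z} cover the line, and each factor is smooth on one of them.
-/
theorem isHormanderProduct_jumpDelta {x z : ℝ} (hxz : z ≠ x) {fm fp gm gp : ℝ → ℂ}
    (hfm : ContDiff ℝ ∞ fm) (hfp : ContDiff ℝ ∞ fp) (hgm : ContDiff ℝ ∞ gm)
    (hgp : ContDiff ℝ ∞ gp) {n m : ℕ} (c : Fin n → ℂ) (d : Fin m → ℂ) :
    ∃ P, IsHormanderProduct (jumpDelta x fm fp c) (jumpDelta z gm gp d) P ∧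
      ∀ t : Test, P t = (∫ y, (t y : ℂ) * (jumpFun x fm fp y * jumpFun z gm gp y)) +
        jetAt x c (fun y => (t y : ℂ) * (if x < z then gm else gp) y) +
        jetAt z d (fun y => (t y : ℂ) * (if z < x then fm else fp) y) := by
  obtain ⟨Q, hQ⟩ := exists_dist_jetAt_mul x c (g := if x < z then gm else gp)
    (by split_ifs <;> assumption)
  obtain ⟨R, hR⟩ := exists_dist_jetAt_mul z d (g := if z < x then fm else fp)
    (by split_ifs <;> assumption)
  have hP : ∀ t : Test, (regular (fun y => jumpFun x fm fp y * jumpFun z gm gp y) + Q + R) t =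
      (∫ y, (t y : ℂ) * (jumpFun x fm fp y * jumpFun z gm gp y)) +
        jetAt x c (fun y => (t y : ℂ) * (if x < z then gm else gp) y) +
        jetAt z d (fun y => (t y : ℂ) * (if z < x then fm else fp) y) := by
    intro t
    rw [← hQ, ← hR, ← regular_apply (locallyIntegrable_jumpFun_mul x z hfm.continuous
      hfp.continuous hgm.continuous hgp.continuous)]
    rfl
  refine ⟨_, isHormanderProduct_iff.mpr ⟨2, ![punctured x, punctured z], fun y => ?_, fun i => ?_⟩,
    hP⟩
  · by_cases hy : y = x
    · exact ⟨1, fun h => hxz (h.symm.trans hy)⟩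
    · exact ⟨0, hy⟩
  · fin_cases i
    · exact isLocalProduct_jumpDelta hxz hfm hfp hgm.continuous hgp.continuous c d _ hP
    · refine (isLocalProduct_jumpDelta hxz.symm hgm hgp hfm.continuous hfp.continuous d c
        (if z < x then fm else fp) fun t => ?_).symm
      rw [hP]
      simp only [mul_comm (jumpFun z gm gp _)]
      ring

/-! ### Star products of piecewise smooth functions with deltas -/

theorem jumpFun_shift (y ε u : ℝ) (gm gp : ℝ → ℂ) :
    jumpFun (y - ε) (fun z => gm (z + ε)) (fun z => gp (z + ε)) u = jumpFun y gm gp (u + ε) := by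
  have e1 : y - ε - u = y - (u + ε) := by ring
  have e2 : u - (y - ε) = u + ε - y := by ring
  simp [jumpFun, e1, e2]

theorem norm_jumpFun_le (y u : ℝ) (gm gp : ℝ → ℂ) : ‖jumpFun y gm gp u‖ ≤ ‖gm u‖ + ‖gp u‖ := by
  rcases lt_trichotomy u y with h | h | h
  · rw [jumpFun_of_lt _ _ h]; exact le_add_of_nonneg_right (norm_nonneg _)
  · rw [h, jumpFun_self, norm_zero]; positivity
  · rw [jumpFun_of_gt _ _ h]; exact le_add_of_nonneg_left (norm_nonneg _)

theorem continuousAt_jumpFun {x z : ℝ} (h : z ≠ x) {fm fp : ℝ → ℂ} (hm : Continuous fm)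
    (hp : Continuous fp) : ContinuousAt (jumpFun x fm fp) z := by
  refine ContinuousAt.congr ?_ (jumpFun_eventuallyEq h fm fp).symm
  split_ifs
  · exact hm.continuousAt
  · exact hp.continuousAt

theorem tendsto_integral_jumpFun (x y : ℝ) {fm fp gm gp : ℝ → ℂ} (hfm : Continuous fm)
    (hfp : Continuous fp) (hgm : Continuous gm) (hgp : Continuous gp) (t : Test) :
    Filter.Tendsto (fun ε : ℝ => ∫ u, (t u : ℂ) * (jumpFun x fm fp u *
      jumpFun (y - ε) (fun z => gm (z + ε)) (fun z => gp (z + ε)) u)) (𝓝[>] 0)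
      (𝓝 (∫ u, (t u : ℂ) * (jumpFun x fm fp u * jumpFun y gm gp u))) := by
  -- Dominated convergence: M bounds the translated branches uniformly for u in the support of t and
  -- 0 ≤ ε ≤ 1. Pointwise convergence can fail only at u = y.
  obtain ⟨M, hM⟩ : ∃ M : ℝ, ∀ u ∈ tsupport t, ∀ ε ∈ Set.Icc (0 : ℝ) 1,
      ‖gm (u + ε)‖ + ‖gp (u + ε)‖ ≤ M := by
    have hc : ContinuousOn (fun p : ℝ × ℝ => ‖gm (p.1 + p.2)‖ + ‖gp (p.1 + p.2)‖)
        (tsupport t ×ˢ Set.Icc (0 : ℝ) 1) := by fun_prop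
    obtain ⟨M, hM⟩ := (t.hasCompactSupport.isCompact.prod isCompact_Icc).bddAbove_image hc
    exact ⟨M, fun u hu ε hε => hM ⟨(u, ε), ⟨hu, hε⟩, rfl⟩⟩
  have hi := integrable_mul_jumpFun x (contDiff_test t).continuous (hasCompactSupport_test t)
    hfm hfp
  refine tendsto_integral_filter_of_dominated_convergence
    (fun u => ‖(t u : ℂ) * jumpFun x fm fp u‖ * M) ?_ ?_ (hi.norm.mul_const M) ?_
  · refine Filter.Eventually.of_forall fun ε => ?_
    have h1 := (locallyIntegrable_jumpFun (y - ε) (fm := fun z => gm (z + ε))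
      (fp := fun z => gp (z + ε)) (by fun_prop) (by fun_prop)).aestronglyMeasurable
    refine (hi.aestronglyMeasurable.mul h1).congr (Filter.Eventually.of_forall fun u => ?_)
    simp only [Pi.mul_apply, mul_assoc]
  · have hmem : Set.Ioo (0 : ℝ) 1 ∈ 𝓝[>] (0 : ℝ) := Ioo_mem_nhdsGT one_pos
    filter_upwards [hmem] with ε hε
    refine Filter.Eventually.of_forall fun u => ?_
    rw [← mul_assoc, norm_mul]
    by_cases hu : u ∈ tsupport t
    · refine mul_le_mul_of_nonneg_left ?_ (norm_nonneg _)
      rw [jumpFun_shift]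
      exact (norm_jumpFun_le _ _ _ _).trans (hM u hu ε ⟨hε.1.le, hε.2.le⟩)
    · rw [image_eq_zero_of_notMem_tsupport hu]
      simp
  · have : ∀ᵐ u : ℝ, u ≠ y := by simp [ae_iff]
    filter_upwards [this] with u hu
    simp only [jumpFun_shift]
    refine Filter.Tendsto.const_mul _ (Filter.Tendsto.const_mul _ ?_)
    refine (continuousAt_jumpFun hu hgm hgp).tendsto.comp ?_
    refine tendsto_nhdsWithin_of_tendsto_nhds ?_
    exact Continuous.tendsto' (by fun_prop) _ _ (by simp)

theorem continuous_iteratedDeriv_of_contDiff {f : ℝ → ℂ} (hf : ContDiff ℝ ∞ f) (k : ℕ) :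
    Continuous (iteratedDeriv k f) := (contDiff_iteratedDeriv hf k).continuous

theorem tendsto_jetAt_mul_shift (x : ℝ) {n : ℕ} (c : Fin n → ℂ) {s g : ℝ → ℂ}
    (hs : ContDiff ℝ ∞ s) (hg : ContDiff ℝ ∞ g) :
    Filter.Tendsto (fun ε : ℝ => jetAt x c (fun u => s u * g (u + ε))) (𝓝[>] 0)
      (𝓝 (jetAt x c (fun u => s u * g u))) := by
  refine tendsto_nhdsWithin_of_tendsto_nhds ?_
  simp only [jetAt]
  refine tendsto_finsetSum _ fun j _ => Filter.Tendsto.const_mul _ (Filter.Tendsto.const_mul _ ?_)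
  have : ∀ ε : ℝ, iteratedDeriv j (fun u => s u * g (u + ε)) x =
      ∑ i ∈ Finset.range ((j : ℕ) + 1), ((j : ℕ).choose i : ℂ) * iteratedDeriv i s x *
        iteratedDeriv (j - i) g (x + ε) := by
    intro ε
    have hg' : ContDiff ℝ ∞ (fun u => g (u + ε)) := hg.comp (contDiff_id.add contDiff_const)
    rw [iteratedDeriv_fun_mul (contDiffAt_nat hs _ _) (contDiffAt_nat hg' _ _)]
    refine Finset.sum_congr rfl fun i _ => ?_
    rw [iteratedDeriv_comp_add_const]
  have h0 := this 0
  simp only [add_zero] at h0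
  simp only [this, h0]
  refine tendsto_finsetSum _ fun i _ => Filter.Tendsto.const_mul _ ?_
  have := continuous_iteratedDeriv_of_contDiff hg (j - i)
  exact Continuous.tendsto' (by fun_prop) _ _ (by simp)

theorem tendsto_jetAt_point (y : ℝ) {n : ℕ} (d : Fin n → ℂ) {s : ℝ → ℂ} (hs : ContDiff ℝ ∞ s) :
    Filter.Tendsto (fun ε : ℝ => jetAt (y - ε) d s) (𝓝[>] 0) (𝓝 (jetAt y d s)) := by
  refine tendsto_nhdsWithin_of_tendsto_nhds ?_
  simp only [jetAt]
  refine tendsto_finsetSum _ fun j _ => Filter.Tendsto.const_mul _ (Filter.Tendsto.const_mul _ ?_)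
  have := continuous_iteratedDeriv_of_contDiff hs j
  exact Continuous.tendsto' (by fun_prop) _ _ (by simp)

/-- The singular point of the second factor sits at y - ε. It remains to the right of x if x < y,
and lies strictly to its left if y ≤ x. The case y = x produces the asymmetry of the product: deltas
of the first factor see the right branch of the second, deltas of the second see the left branch of
the first. -/
theorem isStarProduct_jumpDelta (x y : ℝ) {fm fp gm gp : ℝ → ℂ}
    (hfm : ContDiff ℝ ∞ fm) (hfp : ContDiff ℝ ∞ fp) (hgm : ContDiff ℝ ∞ gm)
    (hgp : ContDiff ℝ ∞ gp) {n m : ℕ} (c : Fin n → ℂ) (d : Fin m → ℂ) :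
    ∃ P, IsStarProduct (jumpDelta x fm fp c) (jumpDelta y gm gp d) P ∧
      ∀ t : Test, P t = (∫ u, (t u : ℂ) * (jumpFun x fm fp u * jumpFun y gm gp u)) +
        jetAt x c (fun u => (t u : ℂ) * (if x < y then gm else gp) u) +
        jetAt y d (fun u => (t u : ℂ) * (if x < y then fp else fm) u) := by
  have hg : ContDiff ℝ ∞ (if x < y then gm else gp) := by split_ifs <;> assumption
  have hf : ContDiff ℝ ∞ (if x < y then fp else fm) := by split_ifs <;> assumption
  obtain ⟨Q, hQ⟩ := exists_dist_jetAt_mul x c hg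
  obtain ⟨R, hR⟩ := exists_dist_jetAt_mul y d hf
  have hP : ∀ t : Test, (regular (fun u => jumpFun x fm fp u * jumpFun y gm gp u) + Q + R) t =
      (∫ u, (t u : ℂ) * (jumpFun x fm fp u * jumpFun y gm gp u)) +
        jetAt x c (fun u => (t u : ℂ) * (if x < y then gm else gp) u) +
        jetAt y d (fun u => (t u : ℂ) * (if x < y then fp else fm) u) := by
    intro t
    rw [← hQ, ← hR, ← regular_apply (locallyIntegrable_jumpFun_mul x y hfm.continuous
      hfp.continuous hgm.continuous hgp.continuous)]
    rfl
  -- The relative position of x and y - ε is constant for small ε > 0; coincidence y = x counts as y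
  -- - ε < x.
  have hside : ∀ᶠ ε : ℝ in 𝓝[>] 0, y - ε ≠ x ∧ (x < y - ε ↔ x < y) ∧ (y - ε < x ↔ ¬ x < y) := by
    by_cases h : x < y
    · have : ∀ᶠ ε : ℝ in 𝓝[>] 0, ε < y - x :=
        nhdsWithin_le_nhds (gt_mem_nhds (sub_pos.mpr h))
      filter_upwards [this] with ε hε
      refine ⟨by intro h'; linarith, ⟨fun _ => h, fun _ => by linarith⟩,
        ⟨fun _ => by linarith, fun h' => (h' h).elim⟩⟩
    · filter_upwards [self_mem_nhdsWithin] with ε hε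
      have hε : 0 < ε := hε
      have h := not_lt.mp h
      refine ⟨by intro h'; linarith, ⟨fun _ => by linarith, fun _ => by linarith⟩,
        ⟨fun _ => by linarith, fun h' => by linarith⟩⟩
  have hprod : ∀ᶠ ε : ℝ in 𝓝[>] 0, ∃ P, IsHormanderProduct (jumpDelta x fm fp c)
      (shift ε (jumpDelta y gm gp d)) P ∧ ∀ t : Test, P t =
        (∫ u, (t u : ℂ) * (jumpFun x fm fp u *
          jumpFun (y - ε) (fun z => gm (z + ε)) (fun z => gp (z + ε)) u)) +
        jetAt x c (fun u => (t u : ℂ) * (if x < y then gm else gp) (u + ε)) +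
        jetAt (y - ε) d (fun u => (t u : ℂ) * (if x < y then fp else fm) u) := by
    filter_upwards [hside] with ε ⟨h1, h2, h3⟩
    rw [shift_jumpDelta ε y hgm.continuous hgp.continuous]
    have hgm' : ContDiff ℝ ∞ (fun u => gm (u + ε)) := hgm.comp (contDiff_id.add contDiff_const)
    have hgp' : ContDiff ℝ ∞ (fun u => gp (u + ε)) := hgp.comp (contDiff_id.add contDiff_const)
    obtain ⟨P, hP1, hP2⟩ := isHormanderProduct_jumpDelta h1 hfm hfp hgm' hgp' c d
    refine ⟨P, hP1, fun t => ?_⟩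
    rw [hP2]
    simp only [h2, h3, ite_not]
    congr 3
    ext u
    split_ifs <;> rfl
  refine ⟨_, ⟨?_, fun t => ?_⟩, hP⟩
  · filter_upwards [hprod] with ε ⟨P, hP1, _⟩
    exact ⟨P, hP1⟩
  · rw [hP]
    refine Filter.Tendsto.congr' (f₁ := fun ε : ℝ => (∫ u, (t u : ℂ) * (jumpFun x fm fp u *
          jumpFun (y - ε) (fun z => gm (z + ε)) (fun z => gp (z + ε)) u)) +
        jetAt x c (fun u => (t u : ℂ) * (if x < y then gm else gp) (u + ε)) +
        jetAt (y - ε) d (fun u => (t u : ℂ) * (if x < y then fp else fm) u)) ?_ ?_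
    · filter_upwards [hprod] with ε ⟨P, hP1, hP2⟩
      rw [hormander_eq hP1, hP2]
    · exact ((tendsto_integral_jumpFun x y hfm.continuous hfp.continuous hgm.continuous
        hgp.continuous t).add (tendsto_jetAt_mul_shift x c (contDiff_test t) hg)).add
        (tendsto_jetAt_point y d ((contDiff_test t).mul hf))

/-! ### Borel's lemma -/

namespace Borel

/-- The standard bump function at the origin. -/
def bump : ContDiffBump (0 : ℝ) := ⟨1, 2, one_pos, one_lt_two⟩

/-- The monomial `y ^ n` cut off outside of a neighbourhood of the origin. -/
def mono (n : ℕ) (y : ℝ) : ℝ := y ^ n * bump y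

theorem contDiff_mono (n : ℕ) : ContDiff ℝ ∞ (mono n) :=
  (contDiff_id.pow n).mul bump.contDiff

theorem hasCompactSupport_mono (n : ℕ) : HasCompactSupport (mono n) :=
  bump.hasCompactSupport.mul_left

theorem mono_eventuallyEq (n : ℕ) : mono n =ᶠ[𝓝 0] fun y => y ^ n := by
  filter_upwards [bump.eventuallyEq_one] with y hy
  rw [mono, hy]
  simp

theorem iteratedDeriv_mono_zero (n k : ℕ) :
    iteratedDeriv k (mono n) 0 = if k = n then (n.factorial : ℝ) else 0 := by
  rw [(mono_eventuallyEq n).iteratedDeriv_eq, iteratedDeriv_fun_pow_zero]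
  push_cast
  rfl

theorem exists_bound_iteratedDeriv_mono (n k : ℕ) :
    ∃ C : ℝ, ∀ y, ‖iteratedDeriv k (mono n) y‖ ≤ C := by
  have h1 : Continuous (iteratedFDeriv ℝ k (mono n)) :=
    (contDiff_mono n).continuous_iteratedFDeriv (by exact_mod_cast le_top)
  obtain ⟨C, hC⟩ := h1.bounded_above_of_compact_support ((hasCompactSupport_mono n).iteratedFDeriv k)
  exact ⟨C, fun y => norm_iteratedFDeriv_eq_norm_iteratedDeriv.symm.trans_le (hC y)⟩

theorem exists_bound_iteratedDeriv_mono_of_lt (n : ℕ) :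
    ∃ C : ℝ, 0 ≤ C ∧ ∀ k < n, ∀ y, ‖iteratedDeriv k (mono n) y‖ ≤ C := by
  choose C hC using exists_bound_iteratedDeriv_mono n
  refine ⟨∑ k ∈ Finset.range n, |C k|, Finset.sum_nonneg fun _ _ => abs_nonneg _,
    fun k hk y => (hC k y).trans ((le_abs_self _).trans ?_)⟩
  exact Finset.single_le_sum (f := fun k => |C k|) (fun _ _ => abs_nonneg _)
    (Finset.mem_range.mpr hk)

/-- The term `b x ^ n`, cut off at distance of order `1 / l` of the origin. -/
def term (b : ℂ) (l : ℝ) (n : ℕ) (x : ℝ) : ℂ := (b / l ^ n) * (mono n (l * x) : ℝ)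

theorem contDiff_term (b : ℂ) (l : ℝ) (n : ℕ) : ContDiff ℝ ∞ (term b l n) :=
  contDiff_const.mul (Complex.ofRealCLM.contDiff.comp
    ((contDiff_mono n).comp (contDiff_const.mul contDiff_id)))

theorem iteratedDeriv_term (b : ℂ) (l : ℝ) (n k : ℕ) (x : ℝ) :
    iteratedDeriv k (term b l n) x =
      (b / l ^ n) * (l ^ k * iteratedDeriv k (mono n) (l * x) : ℝ) := by
  have h1 : ContDiff ℝ ∞ (fun x => mono n (l * x)) :=
    (contDiff_mono n).comp (contDiff_const.mul contDiff_id)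
  have h2 := DistODE.iteratedDeriv_clm_comp
    ((ContinuousLinearMap.mul ℝ ℂ (b / l ^ n)) ∘L Complex.ofRealCLM) h1 k x
  have h3 : (fun x => ((ContinuousLinearMap.mul ℝ ℂ (b / l ^ n)) ∘L Complex.ofRealCLM)
    (mono n (l * x))) = term b l n := by
    ext x
    simp [term]
  rw [h3] at h2
  rw [h2, iteratedDeriv_comp_const_mul ((contDiff_mono n).of_le (by exact_mod_cast le_top))]
  simp

theorem iteratedDeriv_term_zero (b : ℂ) {l : ℝ} (hl : 0 < l) (n k : ℕ) :
    iteratedDeriv k (term b l n) 0 = if k = n then b * n.factorial else 0 := by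
  have hl' : (l : ℂ) ≠ 0 := by exact_mod_cast hl.ne'
  rw [iteratedDeriv_term, mul_zero, iteratedDeriv_mono_zero]
  split_ifs with h
  · subst h
    push_cast
    field_simp
  · simp

theorem exists_bound_iteratedDeriv_term (b : ℂ) (l : ℝ) (n k : ℕ) :
    ∃ C : ℝ, ∀ x, ‖iteratedDeriv k (term b l n) x‖ ≤ C := by
  obtain ⟨C, hC⟩ := exists_bound_iteratedDeriv_mono n k
  refine ⟨‖b / (l : ℂ) ^ n‖ * (|l ^ k| * C), fun x => ?_⟩
  rw [iteratedDeriv_term, norm_mul, Complex.norm_real, norm_mul, Real.norm_eq_abs (l ^ k)]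
  gcongr
  exact hC _

/-- The k-th derivative of the term carries the factor l ^ (k - n), at most 1 / l when k < n and l ≥
1, so a large l makes all derivatives of order below n small. -/
theorem exists_scale (b : ℂ) (n : ℕ) : ∃ l : ℝ, 0 < l ∧
    ∀ k < n, ∀ x, ‖iteratedDeriv k (term b l n) x‖ ≤ (1 / 2 : ℝ) ^ n := by
  obtain ⟨C, hC0, hC⟩ := exists_bound_iteratedDeriv_mono_of_lt n
  have h2 : (0 : ℝ) < (1 / 2 : ℝ) ^ n := by positivity
  -- Chosen so that l ≥ 1, which gives l ^ (k + 1) ≤ l ^ n, and ‖b‖ C ≤ (1/2)^n l.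
  set l : ℝ := 1 + ‖b‖ * C / (1 / 2 : ℝ) ^ n with hl
  have hl1 : 1 ≤ l := by
    have : 0 ≤ ‖b‖ * C / (1 / 2 : ℝ) ^ n := by positivity
    linarith
  have hl0 : 0 < l := by linarith
  refine ⟨l, hl0, fun k hk x => ?_⟩
  have hbC : ‖b‖ * C ≤ (1 / 2 : ℝ) ^ n * l := by
    rw [hl, mul_add, mul_div_cancel₀ _ h2.ne']
    linarith
  rw [iteratedDeriv_term, norm_mul, Complex.norm_real, norm_mul, norm_div, norm_pow, norm_pow,
    Complex.norm_real, Real.norm_of_nonneg hl0.le]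
  have hpow : l ^ k * l ≤ l ^ n := by
    rw [← pow_succ]
    exact pow_le_pow_right₀ hl1 hk
  have hln : 0 < l ^ n := by positivity
  rw [div_mul_eq_mul_div, div_le_iff₀ hln]
  calc ‖b‖ * (l ^ k * ‖iteratedDeriv k (mono n) (l * x)‖) ≤ ‖b‖ * (l ^ k * C) := by
        gcongr
        exact hC k hk _
    _ = (‖b‖ * C) * l ^ k := by ring
    _ ≤ ((1 / 2 : ℝ) ^ n * l) * l ^ k := by gcongr
    _ = (1 / 2 : ℝ) ^ n * (l ^ k * l) := by ring
    _ ≤ (1 / 2 : ℝ) ^ n * l ^ n := by gcongr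

/-- **Borel's lemma**: every sequence is the sequence of derivatives of a smooth function at the
origin. -/
theorem exists_contDiff_iteratedDeriv_zero_eq (c : ℕ → ℂ) :
    ∃ h : ℝ → ℂ, ContDiff ℝ ∞ h ∧ ∀ k, iteratedDeriv k h 0 = c k := by
  choose l hl hb using fun n : ℕ => exists_scale (c n / n.factorial) n
  choose C hC using fun k n : ℕ => exists_bound_iteratedDeriv_term (c n / n.factorial) (l n) n k
  let f : ℕ → ℝ → ℂ := fun n => term (c n / n.factorial) (l n) n
  -- For a fixed order k only the finitely many terms n ≤ k escape the geometric bound; any finite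
  -- bound does for them.
  let v : ℕ → ℕ → ℝ := fun k n => if k < n then (1 / 2 : ℝ) ^ n else C k n
  have hf : ∀ n, ContDiff ℝ ((⊤ : ℕ∞) : WithTop ℕ∞) (f n) := fun n => contDiff_term _ _ _
  have hv : ∀ k : ℕ, (k : ℕ∞) ≤ (⊤ : ℕ∞) → Summable (v k) := by
    intro k _
    refine (summable_nat_add_iff (k + 1)).mp ?_
    have : (fun n => v k (n + (k + 1))) = fun n => (1 / 2 : ℝ) ^ (n + (k + 1)) := by
      ext n
      exact if_pos (by omega)
    rw [this]
    exact (summable_nat_add_iff (k + 1)).mpr summable_geometric_two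
  have hfv : ∀ (k : ℕ) (n : ℕ) (x : ℝ), (k : ℕ∞) ≤ (⊤ : ℕ∞) →
      ‖iteratedFDeriv ℝ k (f n) x‖ ≤ v k n := by
    intro k n x _
    rw [norm_iteratedFDeriv_eq_norm_iteratedDeriv]
    simp only [v]
    split_ifs with h
    · exact hb n k h x
    · exact hC k n x
  refine ⟨fun x => ∑' n, f n x, contDiff_tsum hf hv hfv, fun k => ?_⟩
  rw [iteratedDeriv, iteratedFDeriv_tsum hf hv hfv le_top]
  have hsum : Summable fun n => iteratedFDeriv ℝ k (f n) 0 :=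
    Summable.of_norm_bounded (hv k le_top) fun n => hfv k n 0 le_top
  rw [ContinuousMultilinearMap.tsum_eval hsum]
  have : ∀ n, (iteratedFDeriv ℝ k (f n) 0) (fun _ => 1) = if n = k then c k else 0 := by
    intro n
    change iteratedDeriv k (term _ _ _) 0 = _
    rw [iteratedDeriv_term_zero _ (hl n)]
    by_cases h : k = n
    · subst h
      have : (k.factorial : ℂ) ≠ 0 := by exact_mod_cast k.factorial_ne_zero
      rw [if_pos rfl, if_pos rfl]
      field_simp
    · rw [if_neg h, if_neg (Ne.symm h)]
  simp only [this, tsum_ite_eq]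

theorem exists_contDiff_iteratedDeriv_eq (x : ℝ) (c : ℕ → ℂ) :
    ∃ h : ℝ → ℂ, ContDiff ℝ ∞ h ∧ ∀ k, iteratedDeriv k h x = c k := by
  obtain ⟨h, hh, hc⟩ := exists_contDiff_iteratedDeriv_zero_eq c
  refine ⟨fun y => h (y - x), hh.comp (contDiff_id.sub contDiff_const), fun k => ?_⟩
  have := congrFun (iteratedDeriv_comp_add_const k h (-x)) x
  simp only [← sub_eq_add_neg, sub_self] at this
  rw [this, hc]

end Borel

/-! ### Piecewise smooth functions -/

/-- By the mean value theorem, a function continuous at x whose derivative has a limit at x is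
differentiable there with that derivative. It serves to glue smooth branches at a singular point. -/
theorem hasDerivAt_of_eventually_ne {f g : ℝ → ℂ} {x : ℝ}
    (hd : ∀ᶠ y in 𝓝[≠] x, HasDerivAt f (g y) y) (hf : ContinuousAt f x) (hg : ContinuousAt g x) :
    HasDerivAt f (g x) x := by
  have hlt : ∀ᶠ y in 𝓝[<] x, HasDerivAt f (g y) y :=
    hd.filter_mono (nhdsWithin_mono _ fun y hy => (Set.mem_Iio.mp hy).ne)
  have hgt : ∀ᶠ y in 𝓝[>] x, HasDerivAt f (g y) y :=
    hd.filter_mono (nhdsWithin_mono _ fun y hy => (Set.mem_Ioi.mp hy).ne')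
  have hdiff : DifferentiableOn ℝ f {y | HasDerivAt f (g y) y} := fun y hy =>
    HasDerivAt.differentiableAt hy |>.differentiableWithinAt
  have h1 : HasDerivWithinAt f (g x) (Set.Iic x) x :=
    hasDerivWithinAt_Iic_of_tendsto_deriv hdiff hf.continuousWithinAt hlt
      ((tendsto_nhdsWithin_of_tendsto_nhds hg).congr' (hlt.mono fun y hy => hy.deriv.symm))
  have h2 : HasDerivWithinAt f (g x) (Set.Ici x) x :=
    hasDerivWithinAt_Ici_of_tendsto_deriv hdiff hf.continuousWithinAt hgt
      ((tendsto_nhdsWithin_of_tendsto_nhds hg).congr' (hgt.mono fun y hy => hy.deriv.symm))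
  simpa using h1.union h2

theorem contDiffOn_of_hasDerivAt {U : Set ℝ} (hU : IsOpen U) {G : ℕ → ℝ → ℂ}
    (hG : ∀ k, ∀ u ∈ U, HasDerivAt (G k) (G (k + 1) u) u) : ContDiffOn ℝ ∞ (G 0) U := by
  have key : ∀ n : ℕ, ∀ k, ContDiffOn ℝ n (G k) U := by
    intro n
    induction n with
    | zero =>
      intro k
      refine contDiffOn_zero.mpr fun u hu => (hG k u hu).continuousAt.continuousWithinAt
    | succ n ih =>
      intro k
      rw [Nat.cast_add, Nat.cast_one, contDiffOn_succ_iff_deriv_of_isOpen hU]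
      refine ⟨fun u hu => (hG k u hu).differentiableAt.differentiableWithinAt, by simp, ?_⟩
      exact (ih (k + 1)).congr fun u hu => (hG k u hu).deriv
  exact contDiffOn_infty.mpr fun n => key n 0

theorem iteratedDeriv_eq_of_hasDerivAt {U : Set ℝ} (hU : IsOpen U) {G : ℕ → ℝ → ℂ}
    (hG : ∀ k, ∀ u ∈ U, HasDerivAt (G k) (G (k + 1) u) u) (k : ℕ) {u : ℝ} (hu : u ∈ U) :
    iteratedDeriv k (G 0) u = G k u := by
  induction k generalizing u with
  | zero => simp
  | succ k ih =>
    rw [iteratedDeriv_succ]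
    have : iteratedDeriv k (G 0) =ᶠ[𝓝 u] G k := by
      filter_upwards [hU.mem_nhds hu] with y hy
      exact ih hy
    rw [this.deriv_eq, (hG k u hu).deriv]

theorem hasDerivAt_iteratedDeriv_of_isOpen {U : Set ℝ} (hU : IsOpen U) {f : ℝ → ℂ}
    (hf : ContDiffOn ℝ ∞ f U) (k : ℕ) {u : ℝ} (hu : u ∈ U) :
    HasDerivAt (iteratedDeriv k f) (iteratedDeriv (k + 1) f u) u := by
  have h1 : DifferentiableOn ℝ (iteratedDerivWithin k f U) U :=
    hf.differentiableOn_iteratedDerivWithin (by exact_mod_cast ENat.natCast_lt_top k)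
      hU.uniqueDiffOn
  have h2 : DifferentiableAt ℝ (iteratedDerivWithin k f U) u :=
    (h1 u hu).differentiableAt (hU.mem_nhds hu)
  have h3 : iteratedDeriv k f =ᶠ[𝓝 u] iteratedDerivWithin k f U := by
    filter_upwards [hU.mem_nhds hu] with y hy
    exact (iteratedDerivWithin_of_isOpen hU hy).symm
  rw [iteratedDeriv_succ]
  exact (h2.congr_of_eventuallyEq h3).hasDerivAt

theorem hasDerivAt_iteratedDeriv {f : ℝ → ℂ} (hf : ContDiff ℝ ∞ f) (k : ℕ) (u : ℝ) :
    HasDerivAt (iteratedDeriv k f) (iteratedDeriv (k + 1) f u) u :=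
  hasDerivAt_iteratedDeriv_of_isOpen isOpen_univ hf.contDiffOn k (Set.mem_univ u)

theorem hasDerivAt_jumpFun_of_ne {x u : ℝ} (hu : u ≠ x) {fm fp fm' fp' : ℝ → ℂ}
    (hm : HasDerivAt fm (fm' u) u) (hp : HasDerivAt fp (fp' u) u) :
    HasDerivAt (jumpFun x fm fp) (jumpFun x fm' fp' u) u := by
  have h1 := jumpFun_eventuallyEq hu fm fp
  have h2 := (jumpFun_eventuallyEq hu fm' fp').eq_of_nhds
  rw [h2]
  refine HasDerivAt.congr_of_eventuallyEq ?_ h1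
  split_ifs <;> assumption

theorem jumpFun_tendsto_left (x : ℝ) {fm : ℝ → ℂ} (fp : ℝ → ℂ) {l : ℂ}
    (h : Filter.Tendsto fm (𝓝[<] x) (𝓝 l)) : Filter.Tendsto (jumpFun x fm fp) (𝓝[<] x) (𝓝 l) :=
  h.congr' (by filter_upwards [self_mem_nhdsWithin] with y hy using (jumpFun_of_lt _ _ hy).symm)

theorem jumpFun_tendsto_right (x : ℝ) (fm : ℝ → ℂ) {fp : ℝ → ℂ} {l : ℂ}
    (h : Filter.Tendsto fp (𝓝[>] x) (𝓝 l)) : Filter.Tendsto (jumpFun x fm fp) (𝓝[>] x) (𝓝 l) :=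
  h.congr' (by filter_upwards [self_mem_nhdsWithin] with y hy using (jumpFun_of_gt _ _ hy).symm)

theorem continuousAt_of_tendsto_left_right {f : ℝ → ℂ} {x : ℝ}
    (hl : Filter.Tendsto f (𝓝[<] x) (𝓝 (f x))) (hr : Filter.Tendsto f (𝓝[>] x) (𝓝 (f x))) :
    ContinuousAt f x :=
  continuousAt_iff_continuous_left'_right'.mpr ⟨hl, hr⟩

/-- A smooth function which is flat at `x`, cut off on the left of `x`, is smooth. -/
theorem contDiff_jumpFun_of_flat (x : ℝ) {h : ℝ → ℂ} (hh : ContDiff ℝ ∞ h)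
    (hflat : ∀ k, iteratedDeriv k h x = 0) : ContDiff ℝ ∞ (jumpFun x 0 h) := by
  have hcont : ∀ k, ContinuousAt (jumpFun x 0 (iteratedDeriv k h)) x := by
    intro k
    have h0 := hflat k
    refine continuousAt_of_tendsto_left_right ?_ ?_
    · rw [jumpFun_self]
      exact jumpFun_tendsto_left x _ tendsto_const_nhds
    · rw [jumpFun_self]
      refine jumpFun_tendsto_right x _ ?_
      rw [← h0]
      exact tendsto_nhdsWithin_of_tendsto_nhds (continuous_iteratedDeriv_of_contDiff hh k).continuousAt
  have := contDiffOn_of_hasDerivAt (G := fun k => jumpFun x 0 (iteratedDeriv k h)) isOpen_univ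
    (fun k u _ => by
      have hne : ∀ u, u ≠ x → HasDerivAt (jumpFun x 0 (iteratedDeriv k h))
          (jumpFun x 0 (iteratedDeriv (k + 1) h) u) u := fun u hu =>
        hasDerivAt_jumpFun_of_ne hu (hasDerivAt_const u (0 : ℂ)) (hasDerivAt_iteratedDeriv hh k u)
      by_cases hu : u = x
      · subst hu
        exact hasDerivAt_of_eventually_ne (eventually_nhdsWithin_of_forall hne) (hcont k)
          (hcont (k + 1))
      · exact hne u hu)
  simpa using contDiffOn_univ.mp this

theorem tendsto_sub_jump_left {f h : ℝ → ℂ} {x y : ℝ} (hyx : y ≠ x) {l : ℂ}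
    (hf : Filter.Tendsto f (𝓝[<] y) (𝓝 l)) (hh : Continuous h) :
    ∃ l', Filter.Tendsto (fun u => f u - jumpFun x 0 h u) (𝓝[<] y) (𝓝 l') :=
  ⟨_, hf.sub (tendsto_nhdsWithin_of_tendsto_nhds
    (continuousAt_jumpFun hyx continuous_const hh).tendsto)⟩

theorem tendsto_sub_jump_right {f h : ℝ → ℂ} {x y : ℝ} (hyx : y ≠ x) {l : ℂ}
    (hf : Filter.Tendsto f (𝓝[>] y) (𝓝 l)) (hh : Continuous h) :
    ∃ l', Filter.Tendsto (fun u => f u - jumpFun x 0 h u) (𝓝[>] y) (𝓝 l') :=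
  ⟨_, hf.sub (tendsto_nhdsWithin_of_tendsto_nhds
    (continuousAt_jumpFun hyx continuous_const hh).tendsto)⟩

/-- Subtracting a cut-off smooth function removes one singular point of a piecewise smooth
function. -/
theorem exists_remove_singularity (I : Finset ℝ) {x : ℝ} (hx : x ∉ I) {f : ℝ → ℂ}
    (hf : ContDiffOn ℝ ∞ f ((insert x I : Finset ℝ) : Set ℝ)ᶜ)
    (hlim : ∀ y ∈ insert x I, ∀ k : ℕ,
      (∃ l : ℂ, Filter.Tendsto (iteratedDeriv k f) (𝓝[<] y) (𝓝 l)) ∧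
      (∃ l : ℂ, Filter.Tendsto (iteratedDeriv k f) (𝓝[>] y) (𝓝 l))) :
    ∃ g h : ℝ → ℂ, ContDiff ℝ ∞ h ∧ (∀ u ≠ x, f u = g u + jumpFun x 0 h u) ∧
      ContDiffOn ℝ ∞ g (I : Set ℝ)ᶜ ∧ ∀ y ∈ I, ∀ k : ℕ,
      (∃ l : ℂ, Filter.Tendsto (iteratedDeriv k g) (𝓝[<] y) (𝓝 l)) ∧
      (∃ l : ℂ, Filter.Tendsto (iteratedDeriv k g) (𝓝[>] y) (𝓝 l)) := by
  classical
  choose L hL using fun k => (hlim x (Finset.mem_insert_self x I) k).1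
  choose R hR using fun k => (hlim x (Finset.mem_insert_self x I) k).2
  -- Borel's lemma provides a smooth h whose derivatives at x are exactly the jumps of the
  -- derivatives of f.
  obtain ⟨h, hh, hjet⟩ := Borel.exists_contDiff_iteratedDeriv_eq x (fun k => R k - L k)
  -- `G k` is the prospective k-th derivative of g. After subtraction of the jump, both one-sided
  -- limits at x equal `L k`, and this value fills the gap.
  let G : ℕ → ℝ → ℂ := fun k =>
    Function.update (fun u => iteratedDeriv k f u - jumpFun x 0 (iteratedDeriv k h) u) x (L k)
  have hGne : ∀ k u, u ≠ x → G k u = iteratedDeriv k f u - jumpFun x 0 (iteratedDeriv k h) u :=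
    fun k u hu => Function.update_of_ne hu _ _
  have hGx : ∀ k, G k x = L k := fun k => Function.update_self _ _ _
  have hcont : ∀ k, ContinuousAt (G k) x := by
    intro k
    have hhk := continuous_iteratedDeriv_of_contDiff hh k
    refine continuousAt_of_tendsto_left_right ?_ ?_
    · rw [hGx]
      have h1 : Filter.Tendsto (jumpFun x 0 (iteratedDeriv k h)) (𝓝[<] x) (𝓝 0) :=
        jumpFun_tendsto_left x _ tendsto_const_nhds
      have h2 := (hL k).sub h1
      rw [sub_zero] at h2
      refine h2.congr' ?_
      filter_upwards [self_mem_nhdsWithin] with u hu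
      exact (hGne k u (Set.mem_Iio.mp hu).ne).symm
    · rw [hGx]
      have h1 : Filter.Tendsto (jumpFun x 0 (iteratedDeriv k h)) (𝓝[>] x) (𝓝 (R k - L k)) := by
        rw [← hjet k]
        exact jumpFun_tendsto_right x _ (tendsto_nhdsWithin_of_tendsto_nhds hhk.continuousAt)
      have h2 := (hR k).sub h1
      rw [sub_sub_cancel] at h2
      refine h2.congr' ?_
      filter_upwards [self_mem_nhdsWithin] with u hu
      exact (hGne k u (Set.mem_Ioi.mp hu).ne').symm
  have hIo : IsOpen ((I : Set ℝ)ᶜ) := I.finite_toSet.isClosed.isOpen_compl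
  have hIo' : IsOpen (((insert x I : Finset ℝ) : Set ℝ)ᶜ) :=
    (insert x I).finite_toSet.isClosed.isOpen_compl
  have hderne : ∀ k, ∀ u ∈ (I : Set ℝ)ᶜ, u ≠ x → HasDerivAt (G k) (G (k + 1) u) u := by
    intro k u hu hux
    rw [hGne _ _ hux]
    have hu' : u ∈ ((insert x I : Finset ℝ) : Set ℝ)ᶜ := by
      intro hmem
      rcases Finset.mem_insert.mp (Finset.mem_coe.mp hmem) with h | h
      · exact hux h
      · exact hu h
    have h1 := (hasDerivAt_iteratedDeriv_of_isOpen hIo' hf k hu').sub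
      (hasDerivAt_jumpFun_of_ne (fm := 0) (fm' := 0) hux (hasDerivAt_const u (0 : ℂ))
        (hasDerivAt_iteratedDeriv hh k u))
    refine h1.congr_of_eventuallyEq ?_
    filter_upwards [isOpen_compl_singleton.mem_nhds (show u ∈ ({x} : Set ℝ)ᶜ from hux)] with v hv
    exact hGne k v hv
  have hder : ∀ k, ∀ u ∈ (I : Set ℝ)ᶜ, HasDerivAt (G k) (G (k + 1) u) u := by
    intro k u hu
    by_cases hux : u = x
    · subst hux
      refine hasDerivAt_of_eventually_ne ?_ (hcont k) (hcont (k + 1))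
      filter_upwards [nhdsWithin_le_nhds (hIo.mem_nhds hu), self_mem_nhdsWithin] with v hv hvu
      exact hderne k v hv hvu
    · exact hderne k u hu hux
  refine ⟨G 0, h, hh, fun u hu => ?_, contDiffOn_of_hasDerivAt hIo hder, fun y hy k => ?_⟩
  · rw [hGne 0 u hu]
    simp
  · have hyx : y ≠ x := fun e => hx (e ▸ hy)
    have hev : ∀ᶠ u in 𝓝[≠] y, iteratedDeriv k f u - jumpFun x 0 (iteratedDeriv k h) u =
        iteratedDeriv k (G 0) u := by
      -- The other points of I must be avoided too, since `G k` is known to be the k-th derivative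
      -- of `G 0` only off I.
      have hopen : IsOpen (((I.erase y : Finset ℝ) : Set ℝ)ᶜ) :=
        (I.erase y).finite_toSet.isClosed.isOpen_compl
      have hmem : y ∈ ((I.erase y : Finset ℝ) : Set ℝ)ᶜ := by simp
      filter_upwards [nhdsWithin_le_nhds (hopen.mem_nhds hmem), self_mem_nhdsWithin,
        nhdsWithin_le_nhds (isOpen_compl_singleton.mem_nhds (show y ∈ ({x} : Set ℝ)ᶜ from hyx))]
        with u hu huy hux
      have huI : u ∈ (I : Set ℝ)ᶜ := fun hc => hu (by
        exact Finset.mem_coe.mpr (Finset.mem_erase.mpr ⟨huy, Finset.mem_coe.mp hc⟩))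
      rw [iteratedDeriv_eq_of_hasDerivAt hIo hder k huI, hGne k u hux]
    have hhk := continuous_iteratedDeriv_of_contDiff hh k
    obtain ⟨⟨l, hl⟩, ⟨r, hr⟩⟩ := hlim y (Finset.mem_insert_of_mem hy) k
    obtain ⟨l', hl'⟩ := tendsto_sub_jump_left hyx hl hhk
    obtain ⟨r', hr'⟩ := tendsto_sub_jump_right hyx hr hhk
    exact ⟨⟨l', hl'.congr' (hev.filter_mono
        (nhdsWithin_mono _ fun v hv => (Set.mem_Iio.mp hv).ne))⟩,
      ⟨r', hr'.congr' (hev.filter_mono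
        (nhdsWithin_mono _ fun v hv => (Set.mem_Ioi.mp hv).ne'))⟩⟩

/-- Induction on the singular set, removing one point at a time. Values at singular points are
arbitrary, so equality holds only almost everywhere, which is enough for the associated
distribution. -/
theorem exists_decomposition_of_contDiffOn (I : Finset ℝ) : ∀ f : ℝ → ℂ,
    ContDiffOn ℝ ∞ f (I : Set ℝ)ᶜ →
    (∀ y ∈ I, ∀ k : ℕ,
      (∃ l : ℂ, Filter.Tendsto (iteratedDeriv k f) (𝓝[<] y) (𝓝 l)) ∧
      (∃ l : ℂ, Filter.Tendsto (iteratedDeriv k f) (𝓝[>] y) (𝓝 l))) →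
    ∃ (s : ℝ → ℂ) (h : ℝ → ℝ → ℂ), ContDiff ℝ ∞ s ∧ (∀ y, ContDiff ℝ ∞ (h y)) ∧
      f =ᵐ[volume] fun u => s u + ∑ y ∈ I, jumpFun y 0 (h y) u := by
  classical
  induction I using Finset.induction_on with
  | empty =>
    intro f hf _
    refine ⟨f, 0, ?_, fun _ => contDiff_const, by simp⟩
    simpa [contDiffOn_univ] using hf
  | insert x I hx ih =>
    intro f hf hlim
    obtain ⟨g, h, hh, hfg, hg, hglim⟩ := exists_remove_singularity I hx hf hlim
    obtain ⟨s, H, hs, hH, hae⟩ := ih g hg hglim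
    refine ⟨s, Function.update H x h, hs, fun y => ?_, ?_⟩
    · by_cases hy : y = x
      · subst hy; rw [Function.update_self]; exact hh
      · rw [Function.update_of_ne hy]; exact hH y
    · have : ∀ᵐ u : ℝ, u ≠ x := by simp [ae_iff]
      filter_upwards [hae, this] with u hu hux
      rw [hfg u hux, hu, Finset.sum_insert hx, Function.update_self]
      have : ∑ y ∈ I, jumpFun y 0 (Function.update H x h y) u = ∑ y ∈ I, jumpFun y 0 (H y) u :=
        Finset.sum_congr rfl fun y hy => by
          have hyx : y ≠ x := fun e => hx (e ▸ hy)
          rw [Function.update_of_ne hyx]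
      rw [this]
      ring

theorem PiecewiseSmooth.exists_decomposition {f : ℝ → ℂ} (hf : PiecewiseSmooth f) :
    ∃ (I : Finset ℝ) (s : ℝ → ℂ) (h : ℝ → ℝ → ℂ), ContDiff ℝ ∞ s ∧ (∀ y, ContDiff ℝ ∞ (h y)) ∧
      f =ᵐ[volume] fun u => s u + ∑ y ∈ I, jumpFun y 0 (h y) u := by
  obtain ⟨I, h1, h2⟩ := hf
  obtain ⟨s, h, h3⟩ := exists_decomposition_of_contDiffOn I f h1 h2
  exact ⟨I, s, h, h3⟩

/-! ### The differential equation near a point -/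

theorem EqDistOn.deriv {U : Opens ℝ} {F F' : Dist} (h : EqDistOn U F F') (k : ℕ) :
    EqDistOn U (D k F) (D k F') := by
  induction k with
  | zero => exact h
  | succ k ih =>
    intro t ht
    rw [D_succ k F, D_succ k F', D_one_apply, D_one_apply, ih]
    rw [coe_lineDeriv_test]
    exact (tsupport_deriv_subset (𝕜 := ℝ) (f := t)).trans ht

theorem jumpFun_mul (x y : ℝ) (fm fp gm gp : ℝ → ℂ) :
    jumpFun x fm fp y * jumpFun x gm gp y = jumpFun x (fun u => fm u * gm u)
      (fun u => fp u * gp u) y := by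
  rcases lt_trichotomy y x with h | h | h
  · simp only [jumpFun_of_lt _ _ h]
  · simp only [h, jumpFun_self, zero_mul]
  · simp only [jumpFun_of_gt _ _ h]

/-- Locality reduces the computation to the explicit product of the local models. Existence of the
global product is required, since otherwise `starProduct` is the default value 0. -/
theorem starProduct_apply {U : Opens ℝ} {F G : Dist} (hex : ∃ P, IsStarProduct F G P) {x : ℝ}
    {fm fp gm gp : ℝ → ℂ} (hfm : ContDiff ℝ ∞ fm) (hfp : ContDiff ℝ ∞ fp)
    (hgm : ContDiff ℝ ∞ gm) (hgp : ContDiff ℝ ∞ gp) {n m : ℕ} {c : Fin n → ℂ} {d : Fin m → ℂ}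
    (hF : EqDistOn U F (jumpDelta x fm fp c)) (hG : EqDistOn U G (jumpDelta x gm gp d))
    (t : Test) (ht : tsupport t ⊆ U) :
    starProduct F G t = (∫ u, (t u : ℂ) * jumpFun x (fun u => fm u * gm u)
      (fun u => fp u * gp u) u) + jetAt x c (fun u => (t u : ℂ) * gp u) +
      jetAt x d (fun u => (t u : ℂ) * fm u) := by
  obtain ⟨P, hP⟩ := hex
  obtain ⟨Q, hQ, hQt⟩ := isStarProduct_jumpDelta x x hfm hfp hgm hgp c d
  rw [starProduct_eq hP, hP.unique hQ hF hG t ht, hQt]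
  simp only [lt_irrefl, if_false, jumpFun_mul]

/-- The operator `ψ ↦ ∑_{i=0}^2 (2 choose i) a^{(i)} ψ^{(4-i)} - w² b ψ`. -/
def beamOp (w : ℂ) (a b ψ : ℝ → ℂ) (x : ℝ) : ℂ :=
  ∑ i ∈ Finset.range 3, (Nat.choose 2 i : ℂ) * (iteratedDeriv i a x * iteratedDeriv (4 - i) ψ x)
    - w ^ 2 * (b x * ψ x)

theorem contDiff_beamOp (w : ℂ) {a b ψ : ℝ → ℂ} (ha : ContDiff ℝ ∞ a) (hb : ContDiff ℝ ∞ b)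
    (hψ : ContDiff ℝ ∞ ψ) : ContDiff ℝ ∞ (beamOp w a b ψ) :=
  (ContDiff.sum fun i _ => contDiff_const.mul
    ((contDiff_iteratedDeriv ha i).mul (contDiff_iteratedDeriv hψ (4 - i)))).sub
    (contDiff_const.mul (hb.mul hψ))

/-- The singular part of the left-hand side of the differential equation, for coefficients and
an unknown which are piecewise smooth with deltas at the same point `x`. -/
def singularPart (x : ℝ) (w : ℂ) (am ap bm bp : Fin 2 → ℝ → ℂ) (Ac : Fin 2 → Fin 2 → ℂ)
    (Bc : Fin 2 → Fin 4 → ℂ) (fm fp : ℝ → ℂ) {n : ℕ} (c : Fin n → ℂ) (s : ℝ → ℂ) : ℂ :=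
  ∑ i ∈ Finset.range 3, (Nat.choose 2 i : ℂ) *
    (jetAt x (iterCons x (am 0) (ap 0) (Ac 0) i) (fun u => s u * iteratedDeriv (4 - i) fp u) +
      jetAt x (iterCons x fm fp c (4 - i)) (fun u => s u * iteratedDeriv i (am 0) u) +
      (jetAt x (iterCons x fm fp c (4 - i)) (fun u => s u * iteratedDeriv i (ap 1) u) +
      jetAt x (iterCons x (am 1) (ap 1) (Ac 1) i) (fun u => s u * iteratedDeriv (4 - i) fm u)))
  - w ^ 2 * (jetAt x (Bc 0) (fun u => s u * fp u) + jetAt x c (fun u => s u * bm 0 u) +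
      (jetAt x c (fun u => s u * bp 1 u) + jetAt x (Bc 1) (fun u => s u * fm u)))

theorem singularPart_eq_zero (x : ℝ) (w : ℂ) (am ap bm bp : Fin 2 → ℝ → ℂ)
    (Ac : Fin 2 → Fin 2 → ℂ) (Bc : Fin 2 → Fin 4 → ℂ) (fm fp : ℝ → ℂ) {n : ℕ} (c : Fin n → ℂ)
    {s : ℝ → ℂ} (hs : s =ᶠ[𝓝 x] 0) : singularPart x w am ap bm bp Ac Bc fm fp c s = 0 := by
  have h : ∀ (m : ℕ) (d : Fin m → ℂ) (g : ℝ → ℂ), jetAt x d (fun u => s u * g u) = 0 := by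
    intro m d g
    refine jetAt_eq_zero d ?_
    filter_upwards [hs] with u hu
    simp [hu]
  simp [singularPart, h]

/-- The star products which appear in the differential equation are defined. -/
def StarDefined (a b : Fin 2 → Dist) (φ : Dist) : Prop :=
  (∀ i, (∃ P, IsStarProduct (D i (a 0)) (D (4 - i) φ) P) ∧
    ∃ P, IsStarProduct (D (4 - i) φ) (D i (a 1)) P) ∧
  (∃ P, IsStarProduct (b 0) φ P) ∧ ∃ P, IsStarProduct φ (b 1) P

theorem jumpFun_combination (x u : ℝ) (w : ℂ) (am ap bm bp : Fin 2 → ℝ → ℂ)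
    (ham : ∀ i, ContDiff ℝ ∞ (am i)) (hap : ∀ i, ContDiff ℝ ∞ (ap i)) (fm fp : ℝ → ℂ) :
    ∑ i ∈ Finset.range 3, (Nat.choose 2 i : ℂ) *
      (jumpFun x (fun u => iteratedDeriv i (am 0) u * iteratedDeriv (4 - i) fm u)
        (fun u => iteratedDeriv i (ap 0) u * iteratedDeriv (4 - i) fp u) u +
      jumpFun x (fun u => iteratedDeriv (4 - i) fm u * iteratedDeriv i (am 1) u)
        (fun u => iteratedDeriv (4 - i) fp u * iteratedDeriv i (ap 1) u) u) -
      w ^ 2 * (jumpFun x (fun u => bm 0 u * fm u) (fun u => bp 0 u * fp u) u +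
        jumpFun x (fun u => fm u * bm 1 u) (fun u => fp u * bp 1 u) u) =
    jumpFun x (beamOp w (am 0 + am 1) (bm 0 + bm 1) fm)
      (beamOp w (ap 0 + ap 1) (bp 0 + bp 1) fp) u := by
  have h1 : ∀ i, iteratedDeriv i (am 0 + am 1) u =
      iteratedDeriv i (am 0) u + iteratedDeriv i (am 1) u := fun i =>
    iteratedDeriv_add (contDiffAt_nat (ham 0) i u) (contDiffAt_nat (ham 1) i u)
  have h2 : ∀ i, iteratedDeriv i (ap 0 + ap 1) u =
      iteratedDeriv i (ap 0) u + iteratedDeriv i (ap 1) u := fun i =>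
    iteratedDeriv_add (contDiffAt_nat (hap 0) i u) (contDiffAt_nat (hap 1) i u)
  rcases lt_trichotomy u x with h | h | h
  · simp only [jumpFun_of_lt _ _ h, beamOp, h1, Finset.sum_range_succ, Finset.sum_range_zero,
      Pi.add_apply]
    ring
  · simp [h, jumpFun_self]
  · simp only [jumpFun_of_gt _ _ h, beamOp, h2, Finset.sum_range_succ, Finset.sum_range_zero,
      Pi.add_apply]
    ring

/-- Regular parts multiply branchwise, so the left and right products add up to the coefficients a₀
+ a₁ and b₀ + b₁ on each side of x. The delta contributions remain separate, in `singularPart`. -/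
theorem local_equation {U : Opens ℝ} {x : ℝ} {w : ℂ} {a b : Fin 2 → Dist} {φ : Dist}
    (hdef : StarDefined a b φ) (hφ : IsSolution w a b φ) {am ap bm bp : Fin 2 → ℝ → ℂ}
    (ham : ∀ i, ContDiff ℝ ∞ (am i)) (hap : ∀ i, ContDiff ℝ ∞ (ap i))
    (hbm : ∀ i, ContDiff ℝ ∞ (bm i)) (hbp : ∀ i, ContDiff ℝ ∞ (bp i))
    {Ac : Fin 2 → Fin 2 → ℂ} {Bc : Fin 2 → Fin 4 → ℂ}
    {fm fp : ℝ → ℂ} (hfm : ContDiff ℝ ∞ fm) (hfp : ContDiff ℝ ∞ fp) {n : ℕ} {c : Fin n → ℂ}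
    (ha : ∀ i, EqDistOn U (a i) (jumpDelta x (am i) (ap i) (Ac i)))
    (hb : ∀ i, EqDistOn U (b i) (jumpDelta x (bm i) (bp i) (Bc i)))
    (hf : EqDistOn U φ (jumpDelta x fm fp c)) (t : Test) (ht : tsupport t ⊆ U) :
    (∫ u, (t u : ℂ) * jumpFun x (beamOp w (am 0 + am 1) (bm 0 + bm 1) fm)
      (beamOp w (ap 0 + ap 1) (bp 0 + bp 1) fp) u) +
      singularPart x w am ap bm bp Ac Bc fm fp c (fun u => (t u : ℂ)) = 0 := by
  have haD : ∀ j i, EqDistOn U (D i (a j)) (jumpDelta x (iteratedDeriv i (am j))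
      (iteratedDeriv i (ap j)) (iterCons x (am j) (ap j) (Ac j) i)) := fun j i => by
    rw [← D_jumpDelta x (ham j) (hap j)]
    exact (ha j).deriv i
  have hfD : ∀ i, EqDistOn U (D i φ) (jumpDelta x (iteratedDeriv i fm)
      (iteratedDeriv i fp) (iterCons x fm fp c i)) := fun i => by
    rw [← D_jumpDelta x hfm hfp]
    exact hf.deriv i
  have cd : ∀ {f : ℝ → ℂ}, ContDiff ℝ ∞ f → ∀ i, ContDiff ℝ ∞ (iteratedDeriv i f) :=
    fun hf i => contDiff_iteratedDeriv hf i
  have e1 : ∀ i, starProduct (D i (a 0)) (D (4 - i) φ) t = _ := fun i =>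
    starProduct_apply (hdef.1 i).1 (cd (ham 0) i) (cd (hap 0) i) (cd hfm _) (cd hfp _)
      (haD 0 i) (hfD (4 - i)) t ht
  have e2 : ∀ i, starProduct (D (4 - i) φ) (D i (a 1)) t = _ := fun i =>
    starProduct_apply (hdef.1 i).2 (cd hfm _) (cd hfp _) (cd (ham 1) i) (cd (hap 1) i)
      (hfD (4 - i)) (haD 1 i) t ht
  have e3 := starProduct_apply hdef.2.1 (hbm 0) (hbp 0) hfm hfp (hb 0) hf t ht
  have e4 := starProduct_apply hdef.2.2 hfm hfp (hbm 1) (hbp 1) hf (hb 1) t ht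
  have h0 : ∑ i ∈ Finset.range 3, (Nat.choose 2 i : ℂ) *
        (starProduct (D i (a 0)) (D (4 - i) φ) t + starProduct (D (4 - i) φ) (D i (a 1)) t)
      - w ^ 2 * (starProduct (b 0) φ t + starProduct φ (b 1) t) = 0 := by
    have := congrArg (fun F : Dist => F t) hφ.2
    simpa [mul_add] using this
  have hint : ∀ {g h : ℝ → ℂ}, ContDiff ℝ ∞ g → ContDiff ℝ ∞ h →
      Integrable (fun u => (t u : ℂ) * jumpFun x g h u) := fun hg hh =>
    integrable_mul_jumpFun x (contDiff_test t).continuous (hasCompactSupport_test t)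
      hg.continuous hh.continuous
  have hsum : ∫ u, (t u : ℂ) * jumpFun x (beamOp w (am 0 + am 1) (bm 0 + bm 1) fm)
      (beamOp w (ap 0 + ap 1) (bp 0 + bp 1) fp) u =
      ∑ i ∈ Finset.range 3, (Nat.choose 2 i : ℂ) *
      ((∫ u, (t u : ℂ) * jumpFun x (fun u => iteratedDeriv i (am 0) u * iteratedDeriv (4 - i) fm u)
        (fun u => iteratedDeriv i (ap 0) u * iteratedDeriv (4 - i) fp u) u) +
      ∫ u, (t u : ℂ) * jumpFun x (fun u => iteratedDeriv (4 - i) fm u * iteratedDeriv i (am 1) u)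
        (fun u => iteratedDeriv (4 - i) fp u * iteratedDeriv i (ap 1) u) u) -
      w ^ 2 * ((∫ u, (t u : ℂ) * jumpFun x (fun u => bm 0 u * fm u) (fun u => bp 0 u * fp u) u) +
        ∫ u, (t u : ℂ) * jumpFun x (fun u => fm u * bm 1 u) (fun u => fp u * bp 1 u) u) := by
    have i1 : ∀ i, Integrable (fun u => (t u : ℂ) * jumpFun x
        (fun u => iteratedDeriv i (am 0) u * iteratedDeriv (4 - i) fm u)
        (fun u => iteratedDeriv i (ap 0) u * iteratedDeriv (4 - i) fp u) u) := fun i =>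
      hint ((cd (ham 0) i).mul (cd hfm _)) ((cd (hap 0) i).mul (cd hfp _))
    have i2 : ∀ i, Integrable (fun u => (t u : ℂ) * jumpFun x
        (fun u => iteratedDeriv (4 - i) fm u * iteratedDeriv i (am 1) u)
        (fun u => iteratedDeriv (4 - i) fp u * iteratedDeriv i (ap 1) u) u) := fun i =>
      hint ((cd hfm _).mul (cd (ham 1) i)) ((cd hfp _).mul (cd (hap 1) i))
    have i3 := hint ((hbm 0).mul hfm) ((hbp 0).mul hfp)
    have i4 := hint (hfm.mul (hbm 1)) (hfp.mul (hbp 1))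
    rw [← integral_add i3 i4, ← integral_const_mul]
    simp_rw [← integral_add (i1 _) (i2 _), ← integral_const_mul]
    have i5 : ∀ i, Integrable (fun u => (Nat.choose 2 i : ℂ) * ((t u : ℂ) * jumpFun x
        (fun u => iteratedDeriv i (am 0) u * iteratedDeriv (4 - i) fm u)
        (fun u => iteratedDeriv i (ap 0) u * iteratedDeriv (4 - i) fp u) u + (t u : ℂ) * jumpFun x
        (fun u => iteratedDeriv (4 - i) fm u * iteratedDeriv i (am 1) u)
        (fun u => iteratedDeriv (4 - i) fp u * iteratedDeriv i (ap 1) u) u)) := fun i =>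
      ((i1 i).add (i2 i)).const_mul _
    have i6 := (i3.add i4).const_mul (w ^ 2)
    simp only [Pi.add_apply] at i6
    rw [← integral_finsetSum _ fun i _ => i5 i,
      ← integral_sub (integrable_finsetSum _ fun i _ => i5 i) i6]
    refine integral_congr_ae (Filter.Eventually.of_forall fun u => ?_)
    simp only [← jumpFun_combination x u w am ap bm bp ham hap fm fp]
    rw [mul_sub, Finset.mul_sum]
    congr 1
    · exact Finset.sum_congr rfl fun i _ => by ring
    · ring
  rw [hsum, singularPart, ← h0]
  simp only [e1, e2, e3, e4, Finset.sum_range_succ, Finset.sum_range_zero]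
  ring

/-- S depends only on the germ of the test at x, so tests supported off x see the integral alone.
They force the branches to vanish off x; the integral is then zero for every test, and S is left. -/
theorem vanish_of_local_equation {U : Opens ℝ} {x : ℝ} {Lm Lp : ℝ → ℂ} (hm : Continuous Lm)
    (hp : Continuous Lp) {S : (ℝ → ℂ) → ℂ} (hS : ∀ s : ℝ → ℂ, s =ᶠ[𝓝 x] 0 → S s = 0)
    (h : ∀ t : Test, tsupport t ⊆ U → (∫ u, (t u : ℂ) * jumpFun x Lm Lp u) +
      S (fun u => (t u : ℂ)) = 0) :
    (∀ u ∈ U, u < x → Lm u = 0) ∧ (∀ u ∈ U, x < u → Lp u = 0) ∧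
      ∀ t : Test, tsupport t ⊆ U → S (fun u => (t u : ℂ)) = 0 := by
  have hV : Set.EqOn (jumpFun x Lm Lp) 0 (U ⊓ punctured x : Opens ℝ) := by
    refine EqFunOn.eqOn (F := 0) (.of_apply fun t ht => ?_) (.of_apply fun t ht => ?_) ?_
      continuousOn_const
    · have := h t fun u hu => (ht hu).1
      rw [hS, add_zero] at this
      · rw [this]; rfl
      · have hx : x ∉ tsupport t := fun hx => (ht hx).2 rfl
        filter_upwards [notMem_tsupport_iff_eventuallyEq.mp hx] with y hy
        simp [hy]
    · simp
    · exact fun u hu => (continuousAt_jumpFun hu.2 hm hp).continuousWithinAt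
  refine ⟨fun u hu hux => ?_, fun u hu hux => ?_, fun t ht => ?_⟩
  · rw [← jumpFun_of_lt Lm Lp hux]
    exact hV ⟨hu, hux.ne⟩
  · rw [← jumpFun_of_gt Lm Lp hux]
    exact hV ⟨hu, hux.ne'⟩
  · have h1 := h t ht
    have h2 : ∫ u, (t u : ℂ) * jumpFun x Lm Lp u = 0 := by
      refine integral_eq_zero_of_ae (Filter.Eventually.of_forall fun u => ?_)
      by_cases hu : u ∈ tsupport t
      · by_cases hux : u = x
        · simp [hux, jumpFun_self]
        · have := hV (show u ∈ (U ⊓ punctured x : Opens ℝ) from ⟨ht hu, hux⟩)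
          simp [this]
      · simp [image_eq_zero_of_notMem_tsupport hu]
    rwa [h2, zero_add] at h1

/-! ### Monomial test functions -/

theorem exists_test_monomial {U : Opens ℝ} {x : ℝ} (hx : x ∈ U) (k : ℕ) :
    ∃ t : Test, tsupport t ⊆ U ∧
      (fun u => (t u : ℂ)) =ᶠ[𝓝 x] fun u => (((u - x) ^ k : ℝ) : ℂ) / k.factorial := by
  obtain ⟨r, hr, hrU⟩ := Metric.isOpen_iff.mp U.isOpen x hx
  let χ : ContDiffBump x := ⟨r / 4, r / 2, by positivity, by linarith⟩
  refine ⟨mkTest (fun u => (u - x) ^ k / k.factorial * χ u) ?_ χ.hasCompactSupport.mul_left, ?_, ?_⟩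
  · exact (((contDiff_id.sub contDiff_const).pow k).div_const _).mul χ.contDiff
  · refine (tsupport_mul_subset_right (f := fun u => (u - x) ^ k / k.factorial)
      (g := fun u => χ u)).trans ?_
    rw [χ.tsupport_eq]
    exact (Metric.closedBall_subset_ball (by simp only [χ]; linarith)).trans hrU
  · filter_upwards [χ.eventuallyEq_one] with u hu
    rw [mkTest_apply, hu]
    simp

theorem iteratedDeriv_monomial (x : ℝ) (k n : ℕ) :
    iteratedDeriv n (fun u => (((u - x) ^ k : ℝ) : ℂ) / k.factorial) x =
      if n = k then 1 else 0 := by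
  have h1 : ContDiff ℝ ∞ (fun u : ℝ => (u - x) ^ k) := (contDiff_id.sub contDiff_const).pow k
  have h2 := iteratedDeriv_clm_comp
    ((ContinuousLinearMap.mul ℝ ℂ (k.factorial : ℂ)⁻¹) ∘L Complex.ofRealCLM) h1 n x
  have h3 : (fun u => ((ContinuousLinearMap.mul ℝ ℂ (k.factorial : ℂ)⁻¹) ∘L Complex.ofRealCLM)
    ((u - x) ^ k)) = fun u => (((u - x) ^ k : ℝ) : ℂ) / k.factorial := by
    ext u
    simp [div_eq_inv_mul]
  rw [h3] at h2
  have h4 := congrFun (iteratedDeriv_comp_add_const n (fun u : ℝ => u ^ k) (-x)) x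
  simp only [← sub_eq_add_neg, sub_self] at h4
  rw [h2, h4, iteratedDeriv_fun_pow_zero]
  have : (k.factorial : ℂ) ≠ 0 := by exact_mod_cast k.factorial_ne_zero
  by_cases h : n = k
  · simp [h, this]
  · simp [h]

/-- Only the k-th derivative of the test survives at x, so Leibniz' rule has a single term. These
tests separate the orders of the deltas. -/
theorem iteratedDeriv_monomial_mul {x : ℝ} {k : ℕ} {t : Test}
    (ht : (fun u => (t u : ℂ)) =ᶠ[𝓝 x] fun u => (((u - x) ^ k : ℝ) : ℂ) / k.factorial)
    {f : ℝ → ℂ} (hf : ContDiff ℝ ∞ f) (n : ℕ) :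
    iteratedDeriv n (fun u => (t u : ℂ) * f u) x =
      if k ≤ n then (n.choose k : ℂ) * iteratedDeriv (n - k) f x else 0 := by
  rw [iteratedDeriv_fun_mul (contDiffAt_nat (contDiff_test t) _ _) (contDiffAt_nat hf _ _)]
  have : ∀ i, iteratedDeriv i (fun u => (t u : ℂ)) x = if i = k then 1 else 0 := fun i => by
    rw [ht.iteratedDeriv_eq, iteratedDeriv_monomial]
  simp only [this, mul_ite, mul_one, mul_zero, ite_mul, zero_mul, Finset.sum_ite_eq',
    Finset.mem_range, Nat.lt_succ_iff]

/-! ### The singular part of the differential equation -/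

theorem iteratedDeriv_iteratedDeriv (j m : ℕ) (s : ℝ → ℂ) :
    iteratedDeriv j (iteratedDeriv m s) = iteratedDeriv (j + m) s := by
  simp only [iteratedDeriv_eq_iterate, Function.iterate_add_apply]

/-- The jump of the derivative of order m - 1 - j is created at the (m - j)-th differentiation and
differentiated j more times, ending as a coefficient of δ^(j). The initial deltas simply pass m
derivatives to s. -/
theorem jetAt_iterCons (x : ℝ) (fm fp : ℝ → ℂ) {n : ℕ} (c : Fin n → ℂ) (m : ℕ) (s : ℝ → ℂ) :
    jetAt x (iterCons x fm fp c m) s = (-1) ^ m * jetAt x c (iteratedDeriv m s) +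
      ∑ j ∈ Finset.range m, (-1) ^ j *
        (iteratedDeriv (m - 1 - j) fp x - iteratedDeriv (m - 1 - j) fm x) *
          iteratedDeriv j s x := by
  induction m generalizing s with
  | zero => simp [iterCons]
  | succ m ih =>
    rw [iterCons, jetAt_cons, ih, Finset.sum_range_succ', ← iteratedDeriv_succ', pow_succ]
    have : ∀ j ∈ Finset.range m, (-1 : ℂ) ^ (j + 1) * (iteratedDeriv (m + 1 - 1 - (j + 1)) fp x -
        iteratedDeriv (m + 1 - 1 - (j + 1)) fm x) * iteratedDeriv (j + 1) s x =
        -((-1 : ℂ) ^ j * (iteratedDeriv (m - 1 - j) fp x -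
        iteratedDeriv (m - 1 - j) fm x) * iteratedDeriv j (deriv s) x) := by
      intro j _
      rw [show m + 1 - 1 - (j + 1) = m - 1 - j by omega, iteratedDeriv_succ', pow_succ]
      ring
    rw [Finset.sum_congr rfl this, Finset.sum_neg_distrib]
    simp
    ring

theorem jetAt_eq_single {x : ℝ} {n : ℕ} {c : Fin n → ℂ} {s : ℝ → ℂ} (N : Fin n)
    (h : ∀ j, j ≠ N → c j = 0 ∨ iteratedDeriv j s x = 0) :
    jetAt x c s = c N * ((-1) ^ (N : ℕ) * iteratedDeriv N s x) := by
  rw [jetAt, Finset.sum_eq_single N]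
  · intro j _ hj
    rcases h j hj with h | h <;> simp [h]
  · simp

theorem jetAt_eq_zero_of_forall {x : ℝ} {n : ℕ} {c : Fin n → ℂ} {s : ℝ → ℂ}
    (h : ∀ j : Fin n, iteratedDeriv j s x = 0) : jetAt x c s = 0 := by
  simp [jetAt, h]

/-- If the singular part of the equation vanishes then the unknown has no deltas. -/
theorem coeff_eq_zero_of_singularPart {U : Opens ℝ} {x : ℝ} (hx : x ∈ U) {w : ℂ}
    {am ap bm bp : Fin 2 → ℝ → ℂ}
    (ham : ∀ i, ContDiff ℝ ∞ (am i)) (hap : ∀ i, ContDiff ℝ ∞ (ap i))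
    (hbm : ∀ i, ContDiff ℝ ∞ (bm i)) (hbp : ∀ i, ContDiff ℝ ∞ (bp i))
    {Ac : Fin 2 → Fin 2 → ℂ} {Bc : Fin 2 → Fin 4 → ℂ}
    {fm fp : ℝ → ℂ} (hfm : ContDiff ℝ ∞ fm) (hfp : ContDiff ℝ ∞ fp) {n : ℕ} {c : Fin n → ℂ}
    (ha0 : am 0 x + ap 1 x ≠ 0)
    (h : ∀ t : Test, tsupport t ⊆ U →
      singularPart x w am ap bm bp Ac Bc fm fp c (fun u => (t u : ℂ)) = 0) : c = 0 := by
  by_contra hc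
  obtain ⟨j0, hj0⟩ := Function.ne_iff.mp hc
  have hne : (Finset.univ.filter fun j => c j ≠ 0).Nonempty := ⟨j0, by simpa using hj0⟩
  obtain ⟨N, hN, hmax⟩ := Finset.exists_max_image _ (fun j : Fin n => j) hne
  have hN : c N ≠ 0 := by simpa using hN
  have hgt : ∀ j, N < j → c j = 0 := fun j hj => by
    by_contra hcj
    exact absurd (hmax j (by simpa using hcj)) (not_le.mpr hj)
  -- N + 4 is the order of the highest delta in the fourth derivative of the unknown, and this test
  -- annihilates all lower orders at x.
  obtain ⟨t, htU, ht⟩ := exists_test_monomial hx (N + 4)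
  have hmul := fun {f : ℝ → ℂ} (hf : ContDiff ℝ ∞ f) (m : ℕ) => iteratedDeriv_monomial_mul ht hf m
  -- Deltas of the coefficients: at most two in a_i and i ≤ 2 differentiations, or four in b_i, so
  -- their orders stay below 4.
  have hz : ∀ {m : ℕ} (d : Fin m → ℂ) {f : ℝ → ℂ}, ContDiff ℝ ∞ f → m ≤ 4 →
      jetAt x d (fun u => (t u : ℂ) * f u) = 0 := fun d f hf hm =>
    jetAt_eq_zero_of_forall fun j => by
      rw [hmul hf, if_neg]
      have := j.isLt
      omega
  -- Differentiating the unknown m ≤ 4 times gives deltas of order at most N + m, plus jump terms of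
  -- order below 4. Only m = 4, with the coefficient `c N`, reaches order N + 4.
  have hshift : ∀ {f : ℝ → ℂ}, ContDiff ℝ ∞ f → ∀ m ≤ 4,
      jetAt x (iterCons x fm fp c m) (fun u => (t u : ℂ) * f u) =
        (-1) ^ m * (c N * ((-1) ^ (N : ℕ) * if m = 4 then f x else 0)) := by
    intro f hf m hm
    rw [jetAt_iterCons, jetAt_eq_single N, iteratedDeriv_iteratedDeriv, hmul hf]
    · rw [Finset.sum_eq_zero, add_zero]
      · by_cases h4 : m = 4
        · simp [h4]
        · rw [if_neg h4, if_neg (by omega)]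
      · intro j hj
        rw [hmul hf, if_neg, mul_zero]
        have := Finset.mem_range.mp hj
        omega
    · intro j hj
      rcases lt_or_gt_of_ne hj with hlt | hlt
      · right
        rw [iteratedDeriv_iteratedDeriv, hmul hf, if_neg]
        have : (j : ℕ) < N := hlt
        omega
      · exact .inl (hgt j hlt)
  have hshift0 : ∀ {f : ℝ → ℂ}, ContDiff ℝ ∞ f → jetAt x c (fun u => (t u : ℂ) * f u) = 0 :=
    fun hf => by simpa [iterCons] using hshift hf 0 (by omega)
  have key := h t htU
  have cd : ∀ {f : ℝ → ℂ}, ContDiff ℝ ∞ f → ∀ i, ContDiff ℝ ∞ (iteratedDeriv i f) :=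
    fun hf i => contDiff_iteratedDeriv hf i
  simp only [singularPart, Finset.sum_range_succ, Finset.sum_range_zero] at key
  rw [hz _ (cd hfp (4 - 0)) (by omega), hz _ (cd hfp (4 - 1)) (by omega),
    hz _ (cd hfp (4 - 2)) (by omega), hz _ (cd hfm (4 - 0)) (by omega),
    hz _ (cd hfm (4 - 1)) (by omega), hz _ (cd hfm (4 - 2)) (by omega),
    hshift (cd (ham 0) 0) (4 - 0) (by omega), hshift (cd (ham 0) 1) (4 - 1) (by omega),
    hshift (cd (ham 0) 2) (4 - 2) (by omega),
    hshift (cd (hap 1) 0) (4 - 0) (by omega), hshift (cd (hap 1) 1) (4 - 1) (by omega),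
    hshift (cd (hap 1) 2) (4 - 2) (by omega), hz _ hfp le_rfl, hz _ hfm le_rfl,
    hshift0 (hbm 0), hshift0 (hbp 1)] at key
  simp at key
  have hpow : ((-1 : ℂ)) ^ (N : ℕ) ≠ 0 := pow_ne_zero _ (by simp)
  have : c N * (-1) ^ (N : ℕ) * (am 0 x + ap 1 x) = 0 := by linear_combination key
  exact mul_ne_zero (mul_ne_zero hN hpow) ha0 this

set_option maxHeartbeats 1000000 in
/-- The vanishing of the singular part of the equation is the interface condition. -/
theorem interface_of_singularPart {U : Opens ℝ} {x : ℝ} (hx : x ∈ U) {w : ℂ}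
    {am ap bm bp : Fin 2 → ℝ → ℂ}
    (ham : ∀ i, ContDiff ℝ ∞ (am i)) (hap : ∀ i, ContDiff ℝ ∞ (ap i))
    {Ac : Fin 2 → Fin 2 → ℂ} {Bc : Fin 2 → Fin 4 → ℂ}
    {fm fp : ℝ → ℂ} (hfm : ContDiff ℝ ∞ fm) (hfp : ContDiff ℝ ∞ fp) {n : ℕ}
    (h : ∀ t : Test, tsupport t ⊆ U →
      singularPart x w am ap bm bp Ac Bc fm fp (0 : Fin n → ℂ) (fun u => (t u : ℂ)) = 0) :
    Matrix.mulVec (matrixA w (am 0 + ap 1) (am 0 + am 1) (Ac 1) (Bc 1) x) (jet fm x) =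
      Matrix.mulVec (matrixB w (am 0 + ap 1) (ap 0 + ap 1) (Ac 0) (Bc 0) x) (jet fp x) := by
  have hc0 : ∀ s : ℝ → ℂ, jetAt x (0 : Fin n → ℂ) s = 0 := fun s => by simp [jetAt]
  choose t htU ht using exists_test_monomial hx
  have hmul : ∀ {f : ℝ → ℂ}, ContDiff ℝ ∞ f → ∀ k m i,
      iteratedDeriv m (fun u => (t k u : ℂ) * iteratedDeriv i f u) x =
      if k ≤ m then (m.choose k : ℂ) * iteratedDeriv (m - k + i) f x else 0 := fun hf k m i => by
    rw [iteratedDeriv_monomial_mul (ht k) (contDiff_iteratedDeriv hf i),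
      iteratedDeriv_iteratedDeriv]
  have hmul0 : ∀ {f : ℝ → ℂ}, ContDiff ℝ ∞ f → ∀ k m,
      iteratedDeriv m (fun u => (t k u : ℂ) * f u) x =
      if k ≤ m then (m.choose k : ℂ) * iteratedDeriv (m - k) f x else 0 := fun hf k m =>
    iteratedDeriv_monomial_mul (ht k) hf m
  have key : ∀ k, singularPart x w am ap bm bp Ac Bc fm fp (0 : Fin n → ℂ)
    (fun u => (t k u : ℂ)) = 0 := fun k => h (t k) (htU k)
  have dA : deriv (am 0 + ap 1) x = deriv (am 0) x + deriv (ap 1) x :=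
    deriv_add ((ham 0).differentiable (by simp) x) ((hap 1).differentiable (by simp) x)
  have dm : deriv (am 0 + am 1) x = deriv (am 0) x + deriv (am 1) x :=
    deriv_add ((ham 0).differentiable (by simp) x) ((ham 1).differentiable (by simp) x)
  have dp : deriv (ap 0 + ap 1) x = deriv (ap 0) x + deriv (ap 1) x :=
    deriv_add ((hap 0).differentiable (by simp) x) ((hap 1).differentiable (by simp) x)
  simp only [singularPart, Finset.sum_range_succ, Finset.sum_range_zero, jetAt_iterCons, hc0] at key
  simp only [jetAt, Fin.sum_univ_two, Fin.sum_univ_four, iteratedDeriv_iteratedDeriv,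
    hmul (ham 0), hmul (hap 1), hmul hfm, hmul hfp, hmul0 hfm, hmul0 hfp, Fin.isValue,
    Fin.coe_ofNat_eq_mod] at key
  -- Without deltas in the unknown every remaining delta has order at most 3, so four tests suffice.
  -- The test of degree k gives the row k of the interface condition, up to sign.
  have k0 := key 0
  have k1 := key 1
  have k2 := key 2
  have k3 := key 3
  norm_num [Nat.choose] at k0 k1 k2 k3
  ext i
  fin_cases i
  · simp [Matrix.mulVec, dotProduct, Fin.sum_univ_four, matrixA, matrixB, jet, dA, dm, dp]
    linear_combination -k0
  · simp [Matrix.mulVec, dotProduct, Fin.sum_univ_four, matrixA, matrixB, jet, dA, dm, dp]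
    linear_combination k1
  · simp [Matrix.mulVec, dotProduct, Fin.sum_univ_four, matrixA, matrixB, jet, dA, dm, dp]
    linear_combination -k2
  · simp [Matrix.mulVec, dotProduct, Fin.sum_univ_four, matrixA, matrixB, jet, dA, dm, dp]
    linear_combination k3

/-! ### The elements of `𝒜` -/

theorem jetAt_zero (x : ℝ) (n : ℕ) (s : ℝ → ℂ) : jetAt x (0 : Fin n → ℂ) s = 0 := by
  simp [jetAt]

/-- Two equal branches make no jump. The base point and the number of null coefficients are free, so
a smooth function fits any formula for `jumpDelta`. -/
theorem regular_eq_jumpDelta (x : ℝ) {s : ℝ → ℂ} (hs : Continuous s) (n : ℕ) :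
    regular s = jumpDelta x s s (0 : Fin n → ℂ) := by
  ext t
  rw [jumpDelta_apply x hs hs, jetAt_zero, add_zero, regular_apply hs.locallyIntegrable]
  refine integral_congr_ae ?_
  filter_upwards [jumpFun_ae_eq x s s] with u hu
  rw [hu]
  simp

theorem jumpDelta_self_add (x : ℝ) {g h : ℝ → ℂ} (hg : Continuous g) (hh : Continuous h) {n : ℕ}
    (c : Fin n → ℂ) : jumpDelta x g (g + h) c = regular g + jumpDelta x 0 h c := by
  have hz : Continuous (0 : ℝ → ℂ) := continuous_const
  ext t
  have e : (regular g + jumpDelta x 0 h c) t = regular g t + jumpDelta x 0 h c t := rfl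
  have hi : Integrable fun u => (t u : ℂ) * g u :=
    ((contDiff_test t).continuous.mul hg).integrable_of_hasCompactSupport
      (hasCompactSupport_test t).mul_right
  rw [e, jumpDelta_apply x hg (hg.add hh), jumpDelta_apply x hz hh,
    regular_apply hg.locallyIntegrable, ← add_assoc, ← integral_add hi
    (integrable_mul_jumpFun x (contDiff_test t).continuous (hasCompactSupport_test t) hz hh)]
  congr 1
  have : ∀ᵐ u : ℝ, u ≠ x := by simp [ae_iff]
  refine integral_congr_ae ?_
  filter_upwards [this] with u hu
  rcases lt_or_gt_of_ne hu with h | h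
  · simp [jumpFun_of_lt _ _ h]
  · simp [jumpFun_of_gt _ _ h, mul_add]

theorem D_regular {s : ℝ → ℂ} (hs : ContDiff ℝ ∞ s) (k : ℕ) :
    D k (regular s) = regular (iteratedDeriv k s) := by
  induction k with
  | zero => simp [D_zero]
  | succ k ih =>
    have hk := contDiff_iteratedDeriv hs k
    rw [D_succ, ih, regular_eq_jumpDelta 0 hk.continuous 0, D_one_jumpDelta 0 hk hk,
      regular_eq_jumpDelta 0 (continuous_iteratedDeriv_of_contDiff hs (k + 1)) 1,
      iteratedDeriv_succ]
    congr 1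
    ext j
    fin_cases j
    simp

theorem contDiff_zeroFun : ContDiff ℝ ∞ (0 : ℝ → ℂ) := contDiff_const

theorem iteratedDeriv_zero_fun (k : ℕ) : iteratedDeriv k (0 : ℝ → ℂ) = 0 := by
  ext u
  change iteratedDeriv k (fun _ => (0 : ℂ)) u = 0
  rw [iteratedDeriv_const]
  split_ifs <;> rfl

theorem D_add (F G : Dist) (k : ℕ) : D k (F + G) = D k F + D k G := by
  induction k with
  | zero => rfl
  | succ k ih => rw [D_succ, ih, D_one_add, ← D_succ, ← D_succ]

theorem regular_sum_jumpFun {s : ℝ → ℂ} (hs : ContDiff ℝ ∞ s) (I : Finset ℝ) {h : ℝ → ℝ → ℂ}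
    (hh : ∀ y, ContDiff ℝ ∞ (h y)) :
    regular (fun u => s u + ∑ y ∈ I, jumpFun y 0 (h y) u) =
      regular s + ∑ y ∈ I, jumpDelta y 0 (h y) (0 : Fin 0 → ℂ) := by
  have hz : Continuous (0 : ℝ → ℂ) := continuous_const
  have hloc : ∀ y, LocallyIntegrable (jumpFun y 0 (h y)) := fun y =>
    locallyIntegrable_jumpFun y hz (hh y).continuous
  have hi : ∀ (t : Test) y, Integrable (fun u => (t u : ℂ) * jumpFun y 0 (h y) u) := fun t y =>
    integrable_mul_jumpFun y (contDiff_test t).continuous (hasCompactSupport_test t) hz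
      (hh y).continuous
  have his : ∀ t : Test, Integrable (fun u => (t u : ℂ) * s u) := fun t =>
    ((contDiff_test t).continuous.mul hs.continuous).integrable_of_hasCompactSupport
      (hasCompactSupport_test t).mul_right
  have hsum : LocallyIntegrable (fun u => s u + ∑ y ∈ I, jumpFun y 0 (h y) u) :=
    hs.continuous.locallyIntegrable.add (locallyIntegrable_finsetSum I fun y _ => hloc y)
  ext t
  have e : (regular s + ∑ y ∈ I, jumpDelta y 0 (h y) (0 : Fin 0 → ℂ)) t =
      regular s t + ∑ y ∈ I, jumpDelta y 0 (h y) (0 : Fin 0 → ℂ) t := by simp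
  rw [e, regular_apply hsum, regular_apply hs.continuous.locallyIntegrable]
  simp only [jumpDelta_apply _ hz (hh _).continuous, jetAt_zero, add_zero, mul_add, Finset.mul_sum]
  rw [integral_add (his t) (integrable_finsetSum _ fun y _ => hi t y),
    integral_finsetSum _ fun y _ => hi t y]

/-- Every element of `𝒜` is the sum of a smooth function and of finitely many distributions which
are supported in half-lines, and which are smooth functions except for deltas at the end point. -/
theorem exists_representation {φ : Dist} (hφ : φ ∈ A) (ξ : ℝ) :
    ∃ (I : Finset ℝ) (n : ℕ) (s : ℝ → ℂ) (h : ℝ → ℝ → ℂ) (c : ℝ → Fin n → ℂ), ξ ∈ I ∧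
      ContDiff ℝ ∞ s ∧ (∀ y, ContDiff ℝ ∞ (h y)) ∧
      φ = regular s + ∑ y ∈ I, jumpDelta y 0 (h y) (c y) := by
  classical
  obtain ⟨f, k, hf, rfl⟩ := hφ
  obtain ⟨I, s, h, hs, hh, hae⟩ := hf.exists_decomposition
  -- Pieces outside I are set to zero, so that ξ can be added to the index set without changing the
  -- sum.
  let h' : ℝ → ℝ → ℂ := fun y => if y ∈ I then h y else 0
  have hh' : ∀ y, ContDiff ℝ ∞ (h' y) := fun y => by
    simp only [h']
    split_ifs
    · exact hh y
    · exact contDiff_const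
  have hae' : f =ᵐ[volume] fun u => s u + ∑ y ∈ insert ξ I, jumpFun y 0 (h' y) u := by
    filter_upwards [hae] with u hu
    rw [hu, ← Finset.sum_subset (Finset.subset_insert ξ I)]
    · congr 1
      exact Finset.sum_congr rfl fun y hy => by simp [h', hy]
    · intro y _ hy
      simp [h', hy, jumpFun]
  refine ⟨insert ξ I, 0 + k, iteratedDeriv k s, fun y => iteratedDeriv k (h' y),
    fun y => iterCons y 0 (h' y) (0 : Fin 0 → ℂ) k, Finset.mem_insert_self _ _,
    contDiff_iteratedDeriv hs k, fun y => contDiff_iteratedDeriv (hh' y) k, ?_⟩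
  rw [regular_congr hae', regular_sum_jumpFun hs _ hh', D_add, D_regular hs, D_sum]
  congr 1
  refine Finset.sum_congr rfl fun y _ => ?_
  rw [D_jumpDelta y contDiff_zeroFun (hh' y), iteratedDeriv_zero_fun]

theorem exists_isStarProduct_right {x : ℝ} {fm fp : ℝ → ℂ} (hfm : ContDiff ℝ ∞ fm)
    (hfp : ContDiff ℝ ∞ fp) {m : ℕ} (d : Fin m → ℂ) {s : ℝ → ℂ} (hs : ContDiff ℝ ∞ s)
    (I : Finset ℝ) {h : ℝ → ℝ → ℂ} (hh : ∀ y, ContDiff ℝ ∞ (h y)) {n : ℕ} (c : ℝ → Fin n → ℂ) :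
    ∃ P, IsStarProduct (jumpDelta x fm fp d)
      (regular s + ∑ y ∈ I, jumpDelta y 0 (h y) (c y)) P := by
  classical
  induction I using Finset.induction_on with
  | empty =>
    obtain ⟨P, hP, -⟩ := isStarProduct_jumpDelta x 0 hfm hfp hs hs d (0 : Fin 0 → ℂ)
    rw [Finset.sum_empty, add_zero, regular_eq_jumpDelta 0 hs.continuous 0]
    exact ⟨P, hP⟩
  | insert y I hy ih =>
    obtain ⟨P, hP⟩ := ih
    obtain ⟨Q, hQ, -⟩ := isStarProduct_jumpDelta x y hfm hfp contDiff_const (hh y) d (c y)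
    rw [Finset.sum_insert hy, add_left_comm]
    exact ⟨_, hQ.add_right hP⟩

theorem exists_isStarProduct_left {x : ℝ} {fm fp : ℝ → ℂ} (hfm : ContDiff ℝ ∞ fm)
    (hfp : ContDiff ℝ ∞ fp) {m : ℕ} (d : Fin m → ℂ) {s : ℝ → ℂ} (hs : ContDiff ℝ ∞ s)
    (I : Finset ℝ) {h : ℝ → ℝ → ℂ} (hh : ∀ y, ContDiff ℝ ∞ (h y)) {n : ℕ} (c : ℝ → Fin n → ℂ) :
    ∃ P, IsStarProduct (regular s + ∑ y ∈ I, jumpDelta y 0 (h y) (c y))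
      (jumpDelta x fm fp d) P := by
  classical
  induction I using Finset.induction_on with
  | empty =>
    obtain ⟨P, hP, -⟩ := isStarProduct_jumpDelta 0 x hs hs hfm hfp (0 : Fin 0 → ℂ) d
    rw [Finset.sum_empty, add_zero, regular_eq_jumpDelta 0 hs.continuous 0]
    exact ⟨P, hP⟩
  | insert y I hy ih =>
    obtain ⟨P, hP⟩ := ih
    obtain ⟨Q, hQ, -⟩ := isStarProduct_jumpDelta y x contDiff_const (hh y) hfm hfp (c y) d
    rw [Finset.sum_insert hy, add_left_comm]
    exact ⟨_, hQ.add_left hP⟩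

theorem D_representation {s : ℝ → ℂ} (hs : ContDiff ℝ ∞ s)
    (I : Finset ℝ) {h : ℝ → ℝ → ℂ} (hh : ∀ y, ContDiff ℝ ∞ (h y)) {n : ℕ} (c : ℝ → Fin n → ℂ)
    (k : ℕ) : D k (regular s + ∑ y ∈ I, jumpDelta y 0 (h y) (c y)) =
      regular (iteratedDeriv k s) + ∑ y ∈ I, jumpDelta y 0 (iteratedDeriv k (h y))
        (iterCons y 0 (h y) (c y) k) := by
  rw [D_add, D_regular hs, D_sum]
  congr 1
  refine Finset.sum_congr rfl fun y _ => ?_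
  rw [D_jumpDelta y contDiff_zeroFun (hh y), iteratedDeriv_zero_fun]

theorem starDefined_of_representation (ξ : ℝ) {am ap bm bp : Fin 2 → ℝ → ℂ}
    (ham : ∀ i, ContDiff ℝ ∞ (am i)) (hap : ∀ i, ContDiff ℝ ∞ (ap i))
    (hbm : ∀ i, ContDiff ℝ ∞ (bm i)) (hbp : ∀ i, ContDiff ℝ ∞ (bp i))
    (Ac : Fin 2 → Fin 2 → ℂ) (Bc : Fin 2 → Fin 4 → ℂ) {s : ℝ → ℂ} (hs : ContDiff ℝ ∞ s)
    (I : Finset ℝ) {h : ℝ → ℝ → ℂ} (hh : ∀ y, ContDiff ℝ ∞ (h y)) {n : ℕ} (c : ℝ → Fin n → ℂ) :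
    StarDefined (fun i => jumpDelta ξ (am i) (ap i) (Ac i))
      (fun i => jumpDelta ξ (bm i) (bp i) (Bc i))
      (regular s + ∑ y ∈ I, jumpDelta y 0 (h y) (c y)) := by
  refine ⟨fun i => ⟨?_, ?_⟩, ?_, ?_⟩
  · rw [D_jumpDelta ξ (ham 0) (hap 0), D_representation hs I hh]
    exact exists_isStarProduct_right (contDiff_iteratedDeriv (ham 0) i)
      (contDiff_iteratedDeriv (hap 0) i) _ (contDiff_iteratedDeriv hs _) I
      (fun y => contDiff_iteratedDeriv (hh y) _) _
  · rw [D_jumpDelta ξ (ham 1) (hap 1), D_representation hs I hh]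
    exact exists_isStarProduct_left (contDiff_iteratedDeriv (ham 1) i)
      (contDiff_iteratedDeriv (hap 1) i) _ (contDiff_iteratedDeriv hs _) I
      (fun y => contDiff_iteratedDeriv (hh y) _) _
  · exact exists_isStarProduct_right (hbm 0) (hbp 0) _ hs I hh c
  · exact exists_isStarProduct_left (hbm 1) (hbp 1) _ hs I hh c

/-! ### Localization of piecewise smooth functions with deltas -/

/-- The open ball of centre `x` and radius `r`. -/
def ballOpens (x r : ℝ) : Opens ℝ := ⟨Metric.ball x r, Metric.isOpen_ball⟩

theorem jumpFun_eq_on_ball {x y r : ℝ} (hy : y ∉ ballOpens x r) (fm fp : ℝ → ℂ) {u : ℝ}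
    (hu : u ∈ ballOpens x r) : jumpFun y fm fp u = (if x < y then fm else fp) u := by
  have hu' : |u - x| < r := by simpa [ballOpens, Real.dist_eq] using hu
  have hy' : r ≤ |y - x| := by simpa [ballOpens, Real.dist_eq] using hy
  rw [abs_lt] at hu'
  split_ifs with h
  · rw [abs_of_pos (by linarith)] at hy'
    exact jumpFun_of_lt _ _ (by linarith)
  · rw [abs_of_nonpos (by linarith)] at hy'
    exact jumpFun_of_gt _ _ (by linarith)

theorem ofReal_eq_zero_of_notMem {t : Test} {u : ℝ} (hu : u ∉ tsupport t) : (t u : ℂ) = 0 := by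
  rw [image_eq_zero_of_notMem_tsupport hu, Complex.ofReal_zero]

theorem jumpDelta_apply_of_notMem_ball {x y r : ℝ} (hy : y ∉ ballOpens x r) {fm fp : ℝ → ℂ}
    (hm : Continuous fm) (hp : Continuous fp) {n : ℕ} (c : Fin n → ℂ) (t : Test)
    (ht : tsupport t ⊆ ballOpens x r) :
    jumpDelta y fm fp c t = ∫ u, (t u : ℂ) * (if x < y then fm else fp) u := by
  rw [jumpDelta_apply y hm hp, jetAt_eq_zero, add_zero]
  · refine integral_congr_ae (Filter.Eventually.of_forall fun u => ?_)
    by_cases hu : u ∈ tsupport t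
    · simp only [jumpFun_eq_on_ball hy fm fp (ht hu)]
    · simp only [ofReal_eq_zero_of_notMem hu, zero_mul]
  · have hyt : y ∉ tsupport t := fun h => hy (ht h)
    filter_upwards [notMem_tsupport_iff_eventuallyEq.mp hyt] with u hu
    simp [hu]

theorem eqDistOn_ball_jumpDelta {x y r : ℝ} (hy : y ∉ ballOpens x r) {fm fp : ℝ → ℂ}
    (hm : Continuous fm) (hp : Continuous fp) {n : ℕ} (c : Fin n → ℂ) (m : ℕ) :
    EqDistOn (ballOpens x r) (jumpDelta y fm fp c)
      (jumpDelta x (if x < y then fm else fp) (if x < y then fm else fp) (0 : Fin m → ℂ)) := by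
  have hg : Continuous (if x < y then fm else fp) := by split_ifs <;> assumption
  intro t ht
  rw [jumpDelta_apply_of_notMem_ball hy hm hp c t ht, ← regular_eq_jumpDelta x hg,
    regular_apply hg.locallyIntegrable]

/-- On a ball containing no other singular point, each other piece coincides with one of its
branches, 0 or `h y` according to the side, and is absorbed into the smooth function g. At x the
jump is exactly `h x`. -/
theorem eqDistOn_ball_representation {x r : ℝ} {s : ℝ → ℂ} (hs : ContDiff ℝ ∞ s)
    (I : Finset ℝ) (hx : x ∈ I) (hI : ∀ y ∈ I, y ≠ x → y ∉ ballOpens x r) {h : ℝ → ℝ → ℂ}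
    (hh : ∀ y, ContDiff ℝ ∞ (h y)) {n : ℕ} (c : ℝ → Fin n → ℂ) :
    ∃ g : ℝ → ℂ, ContDiff ℝ ∞ g ∧ EqDistOn (ballOpens x r)
      (regular s + ∑ y ∈ I, jumpDelta y 0 (h y) (c y)) (jumpDelta x g (g + h x) (c x)) := by
  classical
  have hz : Continuous (0 : ℝ → ℂ) := continuous_const
  have hside : ∀ y, ContDiff ℝ ∞ (if x < y then 0 else h y) := fun y => by
    split_ifs
    · exact contDiff_const
    · exact hh y
  let g : ℝ → ℂ := fun u => s u + ∑ y ∈ I.erase x, (if x < y then 0 else h y) u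
  have hg : ContDiff ℝ ∞ g := hs.add (ContDiff.sum fun y _ => hside y)
  refine ⟨g, hg, fun t ht => ?_⟩
  have hmul : ∀ {f : ℝ → ℂ}, ContDiff ℝ ∞ f → Integrable (fun u => (t u : ℂ) * f u) := fun hf =>
    ((contDiff_test t).continuous.mul hf.continuous).integrable_of_hasCompactSupport
      (hasCompactSupport_test t).mul_right
  have e : (regular s + ∑ y ∈ I, jumpDelta y 0 (h y) (c y)) t =
      regular s t + ∑ y ∈ I, jumpDelta y 0 (h y) (c y) t := by simp
  have e1 : ∑ y ∈ I.erase x, jumpDelta y 0 (h y) (c y) t =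
      ∑ y ∈ I.erase x, ∫ u, (t u : ℂ) * (if x < y then 0 else h y) u :=
    Finset.sum_congr rfl fun y hy => by
      have hy' := Finset.mem_erase.mp hy
      rw [jumpDelta_apply_of_notMem_ball (hI y hy'.2 hy'.1) hz (hh y).continuous (c y) t ht]
  have e2 : ∫ u, (t u : ℂ) * g u = (∫ u, (t u : ℂ) * s u) +
      ∑ y ∈ I.erase x, ∫ u, (t u : ℂ) * (if x < y then 0 else h y) u := by
    simp only [g, mul_add, Finset.mul_sum]
    rw [integral_add (hmul hs) (integrable_finsetSum _ fun y _ => hmul (hside y)),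
      integral_finsetSum _ fun y _ => hmul (hside y)]
  have e3 : (regular g + jumpDelta x 0 (h x) (c x)) t =
      regular g t + jumpDelta x 0 (h x) (c x) t := rfl
  rw [e, ← Finset.add_sum_erase I _ hx, e1, jumpDelta_self_add x hg.continuous (hh x).continuous,
    e3, regular_apply hg.continuous.locallyIntegrable, e2,
    regular_apply hs.continuous.locallyIntegrable]
  ring

theorem exists_ball_isolating (I : Finset ℝ) (x : ℝ) :
    ∃ r > 0, ∀ y ∈ I, y ≠ x → y ∉ ballOpens x r := by
  classical
  have hopen : IsOpen (((I.erase x : Finset ℝ) : Set ℝ)ᶜ) :=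
    (I.erase x).finite_toSet.isClosed.isOpen_compl
  obtain ⟨r, hr, hsub⟩ := Metric.isOpen_iff.mp hopen x (by simp)
  exact ⟨r, hr, fun y hy hyx hmem => 
    hsub hmem (Finset.mem_coe.mpr (Finset.mem_erase.mpr ⟨hyx, hy⟩))⟩

/-! ### Flatness -/

/-- The derivatives vanish to the left of x, and each is continuous, so a one-sided neighbourhood
determines the whole jet at x. -/
theorem iteratedDeriv_eq_zero_of_left {f : ℝ → ℂ} (hf : ContDiff ℝ ∞ f) {x r : ℝ} (hr : 0 < r)
    (h : ∀ u ∈ ballOpens x r, u < x → f u = 0) (k : ℕ) : iteratedDeriv k f x = 0 := by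
  have hev : ∀ᶠ u in 𝓝[<] x, iteratedDeriv k f u = 0 := by
    filter_upwards [nhdsWithin_le_nhds ((ballOpens x r).isOpen.mem_nhds
      (Metric.mem_ball_self hr)), self_mem_nhdsWithin] with u hu hux
    have h0 : f =ᶠ[𝓝 u] fun _ => 0 := by
      filter_upwards [(ballOpens x r).isOpen.mem_nhds hu, gt_mem_nhds hux] with v hv hvx
      exact h v hv hvx
    rw [h0.iteratedDeriv_eq, iteratedDeriv_const]
    split_ifs <;> rfl
  have h1 : Filter.Tendsto (iteratedDeriv k f) (𝓝[<] x) (𝓝 (iteratedDeriv k f x)) :=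
    tendsto_nhdsWithin_of_tendsto_nhds (continuous_iteratedDeriv_of_contDiff hf k).continuousAt
  exact tendsto_nhds_unique h1 ((Filter.tendsto_congr' hev).mpr tendsto_const_nhds)

theorem iteratedDeriv_eq_zero_of_right {f : ℝ → ℂ} (hf : ContDiff ℝ ∞ f) {x r : ℝ} (hr : 0 < r)
    (h : ∀ u ∈ ballOpens x r, x < u → f u = 0) (k : ℕ) : iteratedDeriv k f x = 0 := by
  have hev : ∀ᶠ u in 𝓝[>] x, iteratedDeriv k f u = 0 := by
    filter_upwards [nhdsWithin_le_nhds ((ballOpens x r).isOpen.mem_nhds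
      (Metric.mem_ball_self hr)), self_mem_nhdsWithin] with u hu hux
    have h0 : f =ᶠ[𝓝 u] fun _ => 0 := by
      filter_upwards [(ballOpens x r).isOpen.mem_nhds hu, lt_mem_nhds hux] with v hv hvx
      exact h v hv hvx
    rw [h0.iteratedDeriv_eq, iteratedDeriv_const]
    split_ifs <;> rfl
  have h1 : Filter.Tendsto (iteratedDeriv k f) (𝓝[>] x) (𝓝 (iteratedDeriv k f x)) :=
    tendsto_nhdsWithin_of_tendsto_nhds (continuous_iteratedDeriv_of_contDiff hf k).continuousAt
  exact tendsto_nhds_unique h1 ((Filter.tendsto_congr' hev).mpr tendsto_const_nhds)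

theorem beamOp_add (w : ℂ) (a b : ℝ → ℂ) {ψ χ : ℝ → ℂ} (hψ : ContDiff ℝ ∞ ψ)
    (hχ : ContDiff ℝ ∞ χ) : beamOp w a b (ψ + χ) = beamOp w a b ψ + beamOp w a b χ := by
  ext u
  have h : ∀ i, iteratedDeriv i (ψ + χ) u = iteratedDeriv i ψ u + iteratedDeriv i χ u := fun i =>
    iteratedDeriv_add (contDiffAt_nat hψ i u) (contDiffAt_nat hχ i u)
  simp only [beamOp, h, Pi.add_apply, Finset.sum_range_succ, Finset.sum_range_zero]
  ring

theorem iteratedDeriv_mul_eq_zero {f g : ℝ → ℂ} (hf : ContDiff ℝ ∞ f) (hg : ContDiff ℝ ∞ g)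
    {x : ℝ} {n : ℕ} (h : ∀ j ≤ n, iteratedDeriv j g x = 0) :
    iteratedDeriv n (fun u => f u * g u) x = 0 := by
  rw [iteratedDeriv_fun_mul (contDiffAt_nat hf _ _) (contDiffAt_nat hg _ _)]
  exact Finset.sum_eq_zero fun i _ => by rw [h _ (Nat.sub_le _ _), mul_zero]

theorem iteratedDeriv_mul_eq_top {f g : ℝ → ℂ} (hf : ContDiff ℝ ∞ f) (hg : ContDiff ℝ ∞ g)
    {x : ℝ} {n : ℕ} (h : ∀ j < n, iteratedDeriv j g x = 0) :
    iteratedDeriv n (fun u => f u * g u) x = f x * iteratedDeriv n g x := by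
  rw [iteratedDeriv_fun_mul (contDiffAt_nat hf _ _) (contDiffAt_nat hg _ _),
    Finset.sum_eq_single 0]
  · simp
  · intro i hi hi0
    rw [h _ (by have := Finset.mem_range.mp hi; omega), mul_zero]
  · simp

/-- A smooth function with vanishing derivatives up to order 3 at `x`, whose image by the
differential operator is flat at `x`, is flat at `x`. -/
theorem flat_of_beamOp_flat {w : ℂ} {a b h : ℝ → ℂ} (ha : ContDiff ℝ ∞ a) (hb : ContDiff ℝ ∞ b)
    (hh : ContDiff ℝ ∞ h) {x : ℝ} (hax : a x ≠ 0) (h3 : ∀ k < 4, iteratedDeriv k h x = 0)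
    (hL : ∀ k, iteratedDeriv k (beamOp w a b h) x = 0) (k : ℕ) : iteratedDeriv k h x = 0 := by
  induction k using Nat.strong_induction_on with
  | _ k ih =>
    by_cases hk : k < 4
    · exact h3 k hk
    obtain ⟨n, rfl⟩ : ∃ n, k = n + 4 := ⟨k - 4, by omega⟩
    have cd : ∀ {f : ℝ → ℂ}, ContDiff ℝ ∞ f → ∀ i, ContDiff ℝ ∞ (iteratedDeriv i f) :=
      fun hf i => contDiff_iteratedDeriv hf i
    have hfun : beamOp w a b h = fun u => a u * iteratedDeriv 4 h u +
        (2 * (iteratedDeriv 1 a u * iteratedDeriv 3 h u) + (iteratedDeriv 2 a u *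
          iteratedDeriv 2 h u + (-w ^ 2) * (b u * h u))) := by
      ext u
      simp [beamOp, Finset.sum_range_succ]
      ring
    have c1 : ContDiff ℝ ∞ (fun u => a u * iteratedDeriv 4 h u) := ha.mul (cd hh 4)
    have c2 : ContDiff ℝ ∞ (fun u => iteratedDeriv 1 a u * iteratedDeriv 3 h u) :=
      (cd ha 1).mul (cd hh 3)
    have c3 : ContDiff ℝ ∞ (fun u => iteratedDeriv 2 a u * iteratedDeriv 2 h u) :=
      (cd ha 2).mul (cd hh 2)
    have c4 : ContDiff ℝ ∞ (fun u => b u * h u) := hb.mul hh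
    have c2' : ContDiff ℝ ∞ (fun u => 2 * (iteratedDeriv 1 a u * iteratedDeriv 3 h u)) :=
      contDiff_const.mul c2
    have c4' : ContDiff ℝ ∞ (fun u => (-w ^ 2) * (b u * h u)) := contDiff_const.mul c4
    -- In the n-th derivative of the operator at x, the leading term contributes a(x) times the
    -- derivative of h of order n + 4. All other contributions contain lower derivatives of h, which
    -- vanish by induction.
    have e := hL n
    rw [hfun, iteratedDeriv_fun_add (contDiffAt_nat c1 _ _)
      (contDiffAt_nat (c2'.add (c3.add c4')) _ _), iteratedDeriv_fun_add (contDiffAt_nat c2' _ _)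
      (contDiffAt_nat (c3.add c4') _ _), iteratedDeriv_fun_add (contDiffAt_nat c3 _ _)
      (contDiffAt_nat c4' _ _), iteratedDeriv_const_mul _ (contDiffAt_nat c2 _ _),
      iteratedDeriv_const_mul _ (contDiffAt_nat c4 _ _),
      iteratedDeriv_mul_eq_zero (cd ha 1) (cd hh 3), iteratedDeriv_mul_eq_zero (cd ha 2) (cd hh 2),
      iteratedDeriv_mul_eq_zero hb hh, iteratedDeriv_mul_eq_top ha (cd hh 4),
      iteratedDeriv_iteratedDeriv] at e
    · simpa [hax] using e
    · intro j hj
      rw [iteratedDeriv_iteratedDeriv]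
      exact ih _ (by omega)
    · exact fun j hj => ih _ (by omega)
    · intro j hj
      rw [iteratedDeriv_iteratedDeriv]
      exact ih _ (by omega)
    · intro j hj
      rw [iteratedDeriv_iteratedDeriv]
      exact ih _ (by omega)

/-! ### Structure of the solutions -/

/-- A solution which is piecewise smooth with deltas at a point `x`, near which the same holds for
the coefficients, has no delta at `x`, satisfies the equation classically on both sides of `x`, and
satisfies the interface condition at `x`. -/
theorem IsSolution.local_structure {U : Opens ℝ} {x : ℝ} (hx : x ∈ U) {w : ℂ} {a b : Fin 2 → Dist}
    {φ : Dist} (hdef : StarDefined a b φ) (hφ : IsSolution w a b φ) {am ap bm bp : Fin 2 → ℝ → ℂ}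
    (ham : ∀ i, ContDiff ℝ ∞ (am i)) (hap : ∀ i, ContDiff ℝ ∞ (ap i))
    (hbm : ∀ i, ContDiff ℝ ∞ (bm i)) (hbp : ∀ i, ContDiff ℝ ∞ (bp i))
    {Ac : Fin 2 → Fin 2 → ℂ} {Bc : Fin 2 → Fin 4 → ℂ}
    {fm fp : ℝ → ℂ} (hfm : ContDiff ℝ ∞ fm) (hfp : ContDiff ℝ ∞ fp) {n : ℕ} {c : Fin n → ℂ}
    (ha0 : am 0 x + ap 1 x ≠ 0)
    (ha : ∀ i, EqDistOn U (a i) (jumpDelta x (am i) (ap i) (Ac i)))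
    (hb : ∀ i, EqDistOn U (b i) (jumpDelta x (bm i) (bp i) (Bc i)))
    (hf : EqDistOn U φ (jumpDelta x fm fp c)) :
    c = 0 ∧ (∀ u ∈ U, u < x → beamOp w (am 0 + am 1) (bm 0 + bm 1) fm u = 0) ∧
      (∀ u ∈ U, x < u → beamOp w (ap 0 + ap 1) (bp 0 + bp 1) fp u = 0) ∧
      Matrix.mulVec (matrixA w (am 0 + ap 1) (am 0 + am 1) (Ac 1) (Bc 1) x) (jet fm x) =
        Matrix.mulVec (matrixB w (am 0 + ap 1) (ap 0 + ap 1) (Ac 0) (Bc 0) x) (jet fp x) := by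
  obtain ⟨hm, hp, hS⟩ := vanish_of_local_equation
    (contDiff_beamOp w ((ham 0).add (ham 1)) ((hbm 0).add (hbm 1)) hfm).continuous
    (contDiff_beamOp w ((hap 0).add (hap 1)) ((hbp 0).add (hbp 1)) hfp).continuous
    (fun _ hs => singularPart_eq_zero x w am ap bm bp Ac Bc fm fp c hs)
    (local_equation hdef hφ ham hap hbm hbp hfm hfp ha hb hf)
  have hc := coeff_eq_zero_of_singularPart hx ham hap hbm hbp hfm hfp ha0 hS
  subst hc
  exact ⟨rfl, hm, hp, interface_of_singularPart hx ham hap hfm hfp hS⟩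

/-- Where the coefficients are smooth, the interface condition is the continuity of the first four
derivatives. -/
theorem jet_eq_of_interface {w : ℂ} {a : ℝ → ℂ} {x : ℝ} (hax : a x ≠ 0) {f g : ℝ → ℂ}
    (h : Matrix.mulVec (matrixA w a a (0 : Fin 2 → ℂ) (0 : Fin 4 → ℂ) x) (jet f x) =
      Matrix.mulVec (matrixB w a a (0 : Fin 2 → ℂ) (0 : Fin 4 → ℂ) x) (jet g x)) :
    ∀ k < 4, iteratedDeriv k f x = iteratedDeriv k g x := by
  have h0 := congrFun h 0
  have h1 := congrFun h 1
  have h2 := congrFun h 2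
  have h3 := congrFun h 3
  simp [Matrix.mulVec, dotProduct, Fin.sum_univ_four, matrixA, matrixB, jet, hax] at h0 h1 h2 h3
  -- Without deltas, rows 1 and 3 give equality of the second derivatives and of the values.
  -- Substituting these cancels the terms with a' in rows 0 and 2, leaving the third and the first
  -- derivatives.
  rw [h1] at h0
  rw [h3] at h2
  have e0 : f x = g x := h3
  have e1 : iteratedDeriv 1 f x = iteratedDeriv 1 g x :=
    mul_left_cancel₀ hax (by simpa using h2)
  have e2 : iteratedDeriv 2 f x = iteratedDeriv 2 g x := h1
  have e3 : iteratedDeriv 3 f x = iteratedDeriv 3 g x :=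
    mul_left_cancel₀ hax (by simpa using h0)
  intro k hk
  interval_cases k
  · simpa using e0
  · exact e1
  · exact e2
  · exact e3

theorem iteratedDeriv_eq_zero_of_add {f h : ℝ → ℂ} (hf : ContDiff ℝ ∞ f) (hh : ContDiff ℝ ∞ h)
    {x : ℝ} {k : ℕ} (e : iteratedDeriv k f x = iteratedDeriv k (f + h) x) :
    iteratedDeriv k h x = 0 := by
  rw [iteratedDeriv_add (contDiffAt_nat hf _ _) (contDiffAt_nat hh _ _)] at e
  exact left_eq_add.mp e

/-- At a point where the coefficients are smooth, a solution which is piecewise smooth with deltas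
is smooth. -/
theorem IsSolution.flat_of_smooth_coeff {x r : ℝ} (hr : 0 < r) {w : ℂ} {a b : Fin 2 → Dist}
    {φ : Dist} (hdef : StarDefined a b φ) (hφ : IsSolution w a b φ) {α β : Fin 2 → ℝ → ℂ}
    (hα : ∀ i, ContDiff ℝ ∞ (α i)) (hβ : ∀ i, ContDiff ℝ ∞ (β i)) (ha0 : α 0 x + α 1 x ≠ 0)
    (ha : ∀ i, EqDistOn (ballOpens x r) (a i) (jumpDelta x (α i) (α i) (0 : Fin 2 → ℂ)))
    (hb : ∀ i, EqDistOn (ballOpens x r) (b i) (jumpDelta x (β i) (β i) (0 : Fin 4 → ℂ)))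
    {g h : ℝ → ℂ} (hg : ContDiff ℝ ∞ g) (hh : ContDiff ℝ ∞ h) {n : ℕ} {c : Fin n → ℂ}
    (hf : EqDistOn (ballOpens x r) φ (jumpDelta x g (g + h) c)) :
    c = 0 ∧ ∀ k, iteratedDeriv k h x = 0 := by
  have hx : x ∈ ballOpens x r := Metric.mem_ball_self hr
  have hgh : ContDiff ℝ ∞ (g + h) := hg.add hh
  obtain ⟨hc, hm, hp, hi⟩ := hφ.local_structure (Ac := fun _ => 0) (Bc := fun _ => 0) hx hdef hα hα
    hβ hβ hg hgh ha0 ha hb hf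
  have hα' : ContDiff ℝ ∞ (α 0 + α 1) := (hα 0).add (hα 1)
  have hβ' : ContDiff ℝ ∞ (β 0 + β 1) := (hβ 0).add (hβ 1)
  have h3 : ∀ k < 4, iteratedDeriv k h x = 0 := fun k hk =>
    iteratedDeriv_eq_zero_of_add hg hh (jet_eq_of_interface (a := α 0 + α 1) ha0 hi k hk)
  refine ⟨hc, flat_of_beamOp_flat (w := w) hα' hβ' hh ha0 h3 fun k => ?_⟩
  have hLg := contDiff_beamOp w hα' hβ' hg
  have hLh := contDiff_beamOp w hα' hβ' hh
  -- The operator maps g to a function vanishing on the left of x and g + h to one vanishing on the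
  -- right. Both images are flat at x, hence so is the image of h.
  refine iteratedDeriv_eq_zero_of_add hLg hLh ?_
  rw [← beamOp_add w _ _ hg hh, iteratedDeriv_eq_zero_of_left hLg hr hm,
    iteratedDeriv_eq_zero_of_right (contDiff_beamOp w hα' hβ' hgh) hr hp]

theorem eq_zero_on_Iic {f : ℝ → ℂ} (hf : Continuous f) {x : ℝ} (h : ∀ u < x, f u = 0) :
    ∀ u ∈ Set.Iic x, f u = 0 := by
  have : closure (Set.Iio x) ⊆ f ⁻¹' {0} :=
    closure_minimal h (isClosed_singleton.preimage hf)
  rwa [closure_Iio] at this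

theorem eq_zero_on_Ici {f : ℝ → ℂ} (hf : Continuous f) {x : ℝ} (h : ∀ u, x < u → f u = 0) :
    ∀ u ∈ Set.Ici x, f u = 0 := by
  have : closure (Set.Ioi x) ⊆ f ⁻¹' {0} :=
    closure_minimal h (isClosed_singleton.preimage hf)
  rwa [closure_Ioi] at this

theorem jumpDelta_zero (x : ℝ) (fm fp : ℝ → ℂ) (n : ℕ) :
    jumpDelta x fm fp (0 : Fin n → ℂ) = regular (jumpFun x fm fp) := by
  have : ∑ j : Fin n, (0 : ℂ) • D j (dirac x) = 0 := Finset.sum_eq_zero fun j _ => by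
    ext t
    exact zero_smul ℂ (D j (dirac x) t)
  exact (congrArg _ this).trans (add_zero _)

/-- Pieces without deltas that are flat at their end point are smooth on the whole line, so only the
piece at x keeps a singularity. -/
theorem regular_add_sum_jumpDelta {x : ℝ} {s : ℝ → ℂ} (hs : ContDiff ℝ ∞ s) {I : Finset ℝ}
    (hx : x ∈ I) {h : ℝ → ℝ → ℂ} (hh : ∀ y, ContDiff ℝ ∞ (h y)) {n : ℕ} {c : ℝ → Fin n → ℂ}
    (hflat : ∀ y ∈ I.erase x, c y = 0 ∧ ∀ k, iteratedDeriv k (h y) y = 0) :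
    ∃ ψ : ℝ → ℂ, ContDiff ℝ ∞ ψ ∧ regular s + ∑ y ∈ I, jumpDelta y 0 (h y) (c y) =
      jumpDelta x ψ (ψ + h x) (c x) := by
  let ψ : ℝ → ℂ := fun u => s u + ∑ y ∈ I.erase x, jumpFun y 0 (h y) u
  have hψ : ContDiff ℝ ∞ ψ := hs.add (ContDiff.sum fun y hy =>
    contDiff_jumpFun_of_flat y (hh y) (hflat y hy).2)
  refine ⟨ψ, hψ, ?_⟩
  have e1 : ∑ y ∈ I.erase x, jumpDelta y 0 (h y) (c y) =
      ∑ y ∈ I.erase x, jumpDelta y 0 (h y) (0 : Fin 0 → ℂ) :=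
    Finset.sum_congr rfl fun y hy => by rw [(hflat y hy).1, jumpDelta_zero, jumpDelta_zero]
  rw [← Finset.add_sum_erase I _ hx, add_left_comm, e1, ← regular_sum_jumpFun hs _ hh]
  change jumpDelta x 0 (h x) (c x) + regular ψ = _
  rw [add_comm, jumpDelta_self_add x hψ.continuous (hh x).continuous]

theorem ite_add_ite_ne_zero {am ap : Fin 2 → ℝ → ℂ} (hm : ∀ x, am 0 x + am 1 x ≠ 0)
    (hp : ∀ x, ap 0 x + ap 1 x ≠ 0) (P : Prop) [Decidable P] (x : ℝ) :
    (if P then am 0 else ap 0) x + (if P then am 1 else ap 1) x ≠ 0 := by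
  split_ifs
  · exact hm x
  · exact hp x

/-- Every solution is piecewise smooth with deltas at the singular point of the coefficients. -/
theorem IsSolution.eq_jumpDelta {ξ : ℝ} {w : ℂ} {am ap bm bp : Fin 2 → ℝ → ℂ}
    (ham : ∀ i, ContDiff ℝ ∞ (am i)) (hap : ∀ i, ContDiff ℝ ∞ (ap i))
    (hbm : ∀ i, ContDiff ℝ ∞ (bm i)) (hbp : ∀ i, ContDiff ℝ ∞ (bp i))
    {Ac : Fin 2 → Fin 2 → ℂ} {Bc : Fin 2 → Fin 4 → ℂ}
    (hm : ∀ x, am 0 x + am 1 x ≠ 0) (hp : ∀ x, ap 0 x + ap 1 x ≠ 0) {φ : Dist}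
    (hφ : IsSolution w (fun i => jumpDelta ξ (am i) (ap i) (Ac i))
      (fun i => jumpDelta ξ (bm i) (bp i) (Bc i)) φ) :
    StarDefined (fun i => jumpDelta ξ (am i) (ap i) (Ac i))
      (fun i => jumpDelta ξ (bm i) (bp i) (Bc i)) φ ∧
    ∃ (f g : ℝ → ℂ) (n : ℕ) (c : Fin n → ℂ), ContDiff ℝ ∞ f ∧ ContDiff ℝ ∞ g ∧
      φ = jumpDelta ξ f g c := by
  classical
  obtain ⟨I, n, s, h, c, hξ, hs, hh, rfl⟩ := exists_representation hφ.1 ξ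
  have hdef := starDefined_of_representation ξ ham hap hbm hbp Ac Bc hs I hh c
  obtain ⟨ψ, hψ, e⟩ := regular_add_sum_jumpDelta hs hξ hh (c := c) fun y hy => by
    obtain ⟨hyξ, hyI⟩ := Finset.mem_erase.mp hy
    obtain ⟨r, hr, hiso⟩ := exists_ball_isolating I y
    obtain ⟨g, hg, hf⟩ := eqDistOn_ball_representation hs I hyI hiso hh c
    have hside : ∀ {p q : ℝ → ℂ}, ContDiff ℝ ∞ p → ContDiff ℝ ∞ q →
        ContDiff ℝ ∞ (if y < ξ then p else q) := fun hp hq => by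
      split_ifs <;> assumption
    -- The ball around y excludes ξ, because ξ belongs to the index set. The coefficients are
    -- therefore smooth on it, equal to their left or right branch according to the side of ξ on
    -- which y lies.
    have hout := hiso ξ hξ hyξ.symm
    exact hφ.flat_of_smooth_coeff hr hdef (α := fun i => if y < ξ then am i else ap i)
      (β := fun i => if y < ξ then bm i else bp i)
      (fun i => hside (ham i) (hap i)) (fun i => hside (hbm i) (hbp i))
      (ite_add_ite_ne_zero hm hp _ y)
      (fun i => eqDistOn_ball_jumpDelta hout (ham i).continuous (hap i).continuous (Ac i) 2)
      (fun i => eqDistOn_ball_jumpDelta hout (hbm i).continuous (hbp i).continuous (Bc i) 4)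
      hg (hh y) hf
  exact ⟨hdef, ψ, ψ + h ξ, n, c ξ, hψ, hψ.add (hh ξ), e⟩

end DistODE

end

/-! ### The interface problem equivalent to the equation -/

theorem theorem3p2 (ξ₀ : ℝ) (w : ℂ)
    (am ap bm bp : Fin 2 → ℝ → ℂ)
    (ham : ∀ i, ContDiff ℝ ∞ (am i)) (hap : ∀ i, ContDiff ℝ ∞ (ap i))
    (hbm : ∀ i, ContDiff ℝ ∞ (bm i)) (hbp : ∀ i, ContDiff ℝ ∞ (bp i))
    (Ac : Fin 2 → Fin 2 → ℂ) (Bc : Fin 2 → Fin 4 → ℂ)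
    (hC1 : am 0 ξ₀ + ap 1 ξ₀ ≠ 0)
    (hC2m : ∀ x, am 0 x + am 1 x ≠ 0) (hC2p : ∀ x, ap 0 x + ap 1 x ≠ 0)
    (φ : DistODE.Dist)
    (hφ : DistODE.IsSolution w
      (fun i => DistODE.jumpDelta ξ₀ (am i) (ap i) (Ac i))
      (fun i => DistODE.jumpDelta ξ₀ (bm i) (bp i) (Bc i)) φ) :
    ∃ φ₁ φ₂ : ℝ → ℂ, ContDiff ℝ ∞ φ₁ ∧ ContDiff ℝ ∞ φ₂ ∧
      φ = DistODE.regular (fun x =>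
        DistODE.heaviside (ξ₀ - x) * φ₁ x + DistODE.heaviside (x - ξ₀) * φ₂ x) ∧
      DistODE.SolvesClassicalOn (Set.Iic ξ₀) w (am 0 + am 1) (bm 0 + bm 1) φ₁ ∧
      DistODE.SolvesClassicalOn (Set.Ici ξ₀) w (ap 0 + ap 1) (bp 0 + bp 1) φ₂ ∧
      Matrix.mulVec (DistODE.matrixA w (am 0 + ap 1) (am 0 + am 1) (Ac 1) (Bc 1) ξ₀)
          (DistODE.jet φ₁ ξ₀) =
        Matrix.mulVec (DistODE.matrixB w (am 0 + ap 1) (ap 0 + ap 1) (Ac 0) (Bc 0) ξ₀)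
          (DistODE.jet φ₂ ξ₀) := by
  obtain ⟨hdef, f, g, n, c, hf, hg, rfl⟩ := hφ.eq_jumpDelta ham hap hbm hbp hC2m hC2p
  -- The unknown and the coefficients now have the same global form with singular point ξ₀, so the
  -- local analysis applies on the whole line. Nonvanishing of a₀₋ + a₁₊ at ξ₀ removes the remaining
  -- deltas.
  obtain ⟨rfl, hm, hp, hi⟩ := hφ.local_structure (U := ⊤) (x := ξ₀) trivial hdef ham hap hbm hbp
    hf hg hC1 (fun i => DistODE.EqDistOn.refl _ _) (fun i => DistODE.EqDistOn.refl _ _)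
    (DistODE.EqDistOn.refl _ _)
  refine ⟨f, g, hf, hg, ?_, ?_, ?_, hi⟩
  · rw [DistODE.jumpDelta_zero]
    congr 1
    ext u
    rw [DistODE.jumpFun, mul_comm, mul_comm (g u)]
  -- The equation holds on the open half-line and extends to its end point by continuity.
  · exact DistODE.eq_zero_on_Iic (DistODE.contDiff_beamOp w ((ham 0).add (ham 1))
      ((hbm 0).add (hbm 1)) hf).continuous fun u hu => hm u trivial hu
  · exact DistODE.eq_zero_on_Ici (DistODE.contDiff_beamOp w ((hap 0).add (hap 1))
      ((hbp 0).add (hbp 1)) hg).continuous fun u hu => hp u trivial hu
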